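/- Let $\Sigma$ be a compact smooth surface without boundary, and let $J\subset\mathbb R$ be open. For $t\in J$ let $g=g(t)$ be a Riemannian metric on $\Sigma$ with measure $\mu_g$, $N=N(t)>0$ a function (lapse) and $\nu=\nu(t)$ a vector field (shift), all of class $C^2$ on $J\times\Sigma$; they define the Lorentzian metric $${}^{(3)}g=-N^2dt^2+g_{ab}(dx^a+\nu^adt)(dx^b+\nu^bdt).$$ Let $\nabla$ be the covariant derivative of $g$, $\Delta_g=g^{ab}\nabla_a\partial_b$, raise indices with $g$, and put $$k_{ab}=(2N)^{-1}(-\partial_tg_{ab}+\nabla_a\nu_b+\nabla_b\nu_a),\qquad h_{ab}=k_{ab}-\tfrac12 g_{ab}\,g^{cd}k_{cd}.$$ Suppose that $g^{ab}k_{ab}=\tau(t)$ is constant on each slice. Let $u$ be a real function of class $C^3$ on $J\times\Sigma$, and put $\partial_0=\partial_t-\nu^a\partial_a$ on functions and $u'=N^{-1}\partial_0u$. A dot is the scalar product $p.q=2pq$ of the (polarized) target; correspondingly $|Du'|_g^2=g^{ab}\partial_au'.\partial_bu'$ and $|\Delta_gu|^2=\Delta_gu.\Delta_gu$. Suppose that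 $({}^{(3)}g,u)$ satisfies the momentum constraint and the wave equation $$N(-\nabla_bk_a^b+\partial_a\tau)=\partial_0u.\partial_au,\qquad \partial_0u'=N\Delta_gu+\partial^aN\,\partial_au+\tau Nu'$$ on $J\times\Sigma$. Let $$J_0=\tfrac12|Du'|_g^2,\qquad J_1=\tfrac12|\Delta_gu|^2,\qquad E^{(1)}(t)=\int_\Sigma(J_0+J_1)\,\mu_g .$$ Then the function $E^{(1)}$ is differentiable on $J$, all the integrands in the formulas for $E^{(1)}$ and below are integrable, and for every $t\in J$ $$\frac{dE^{(1)}}{dt}-2\tau E^{(1)}=\tau\int_\Sigma\{NJ_0+(N-2)(J_0+J_1)\}\,\mu_g+Z,$$ where $$Z=\int_\Sigma\big\{Nh^{ab}\partial_au'.\partial_bu'+2Nh^{ab}\nabla_a\partial_bu.\Delta_gu+\big(\nabla_b(\partial^aN\,\partial_au)+\tau\,\partial_bN\,u'\big).\partial^bu'\big\}\mu_g+Y_1,$$ $$Y_1=\int_\Sigma\big\{\big(2\partial_aN\,h^{ac}-2N\,(\partial^cu.u')\big)\partial_cu+2\partial^aN\,\partial_au'+u'\Delta_gN\big\}.\Delta_gu\;\mu_g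 .$$ -/

import Mathlib

open scoped Manifold ContDiff
open MeasureTheory

noncomputable section

namespace PolarizedU1

/-- The coordinate plane in which the charts of a surface take their values. -/
abbrev Plane : Type := EuclideanSpace ℝ (Fin 2)

/-! ### Tensor calculus in one coordinate system -/

/-- The partial derivative `∂_a f` at `y`. -/
def pd (a : Fin 2) (f : Plane → ℝ) (y : Plane) : ℝ :=
  fderiv ℝ f y (EuclideanSpace.single a 1)

/-- The Christoffel symbols
`Γ^c_{ab} = ½ g^{cd} (∂_a g_{db} + ∂_b g_{da} - ∂_d g_{ab})` of a metric `G = (g_{ab})`. -/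
def christoffel (G : Plane → Matrix (Fin 2) (Fin 2) ℝ) (c a b : Fin 2) (y : Plane) : ℝ :=
  (1 / 2) * ∑ d, (G y)⁻¹ c d *
    (pd a (fun z => G z d b) y + pd b (fun z => G z d a) y - pd d (fun z => G z a b) y)

/-- The Hessian `∇_a ∂_b f = ∂_a ∂_b f - Γ^c_{ab} ∂_c f`. -/
def hess (G : Plane → Matrix (Fin 2) (Fin 2) ℝ) (f : Plane → ℝ) (a b : Fin 2) (y : Plane) : ℝ :=
  pd a (pd b f) y - ∑ c, christoffel G c a b y * pd c f y

/-- The covariant derivative `∇_a w_b = ∂_a w_b - Γ^c_{ab} w_c` of a covector field. -/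
def covDerivCovector (G : Plane → Matrix (Fin 2) (Fin 2) ℝ) (w : Plane → Fin 2 → ℝ)
    (a b : Fin 2) (y : Plane) : ℝ :=
  pd a (fun z => w z b) y - ∑ c, christoffel G c a b y * w y c

/-- The covariant derivative
`∇_c T_{ab} = ∂_c T_{ab} - Γ^d_{ca} T_{db} - Γ^d_{cb} T_{ad}` of a covariant 2-tensor field. -/
def covDerivTensor (G T : Plane → Matrix (Fin 2) (Fin 2) ℝ) (c a b : Fin 2) (y : Plane) : ℝ :=
  pd c (fun z => T z a b) y - ∑ d, christoffel G d c a y * T y d b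
    - ∑ d, christoffel G d c b y * T y a d

/-- The scalar product of the target, `a . b = 2 a b` in the polarized case. For a contraction
such as `g^{ab} ∂_a f . ∂_b f = 2 g^{ab} ∂_a f ∂_b f` it is applied as `dot 1 (g^{ab} ∂_a f ∂_b f)`. -/
def dot (a b : ℝ) : ℝ := 2 * a * b

/-! ### Time dependent metric, lapse and shift on a surface -/

variable {M : Type*} [TopologicalSpace M] [ChartedSpace Plane M]

/-- The metric `g` on the surface, the lapse `N` and the shift `ν`, all depending on the time;
they form the three dimensional metric `-N² dt² + g_{ab} (dx^a + ν^a dt) (dx^b + ν^b dt)`. -/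
structure Slicing (M : Type*) [TopologicalSpace M] [ChartedSpace Plane M] where
  g : ℝ → (x : M) → TangentSpace (𝓡 2) x →L[ℝ] TangentSpace (𝓡 2) x →L[ℝ] ℝ
  N : ℝ → M → ℝ
  ν : ℝ → (x : M) → TangentSpace (𝓡 2) x

/-- The coordinate vector field `∂_a` of the chart `e`, at the point with coordinates `y`. -/
def coordVector (e : OpenPartialHomeomorph M Plane) (y : Plane) (a : Fin 2) :
    TangentSpace (𝓡 2) (e.symm y) :=
  mfderiv (𝓡 2) (𝓡 2) e.symm y (EuclideanSpace.single a (1 : ℝ) : Plane)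

namespace Slicing

variable (S : Slicing M)

/-- The components `g_{ab}` in the chart `e`, as functions of the coordinates. -/
def G (e : OpenPartialHomeomorph M Plane) (t : ℝ) (y : Plane) : Matrix (Fin 2) (Fin 2) ℝ :=
  Matrix.of fun a b => S.g t (e.symm y) (coordVector e y a) (coordVector e y b)

/-- The components `ν^a` of the shift in the chart `e`. -/
def shiftUp (e : OpenPartialHomeomorph M Plane) (t : ℝ) (y : Plane) (a : Fin 2) : ℝ :=
  (EuclideanSpace.proj a : Plane →L[ℝ] ℝ) (mfderiv (𝓡 2) (𝓡 2) e (e.symm y) (S.ν t (e.symm y)))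

/-- The covariant components `ν_a = g_{ab} ν^b` of the shift in the chart `e`. -/
def shiftDown (e : OpenPartialHomeomorph M Plane) (t : ℝ) (y : Plane) (a : Fin 2) : ℝ :=
  ∑ b, S.G e t y a b * S.shiftUp e t y b

/-- The extrinsic curvature
`k_{ab} = (2N)⁻¹ (-∂_t g_{ab} + ∇_a ν_b + ∇_b ν_a)` in the chart `e`. -/
def k (e : OpenPartialHomeomorph M Plane) (t : ℝ) (y : Plane) : Matrix (Fin 2) (Fin 2) ℝ :=
  Matrix.of fun a b => (2 * S.N t (e.symm y))⁻¹ *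
    (-deriv (fun s => S.G e s y a b) t
      + covDerivCovector (S.G e t) (S.shiftDown e t) a b y
      + covDerivCovector (S.G e t) (S.shiftDown e t) b a y)

/-- The mean curvature `g^{ab} k_{ab}` in the chart `e`. -/
def trk (e : OpenPartialHomeomorph M Plane) (t : ℝ) (y : Plane) : ℝ :=
  ∑ a, ∑ b, (S.G e t y)⁻¹ a b * S.k e t y a b

/-- The divergence `∇_b k_a^b = g^{bc} ∇_c k_{ab}` in the chart `e`. -/
def divk (e : OpenPartialHomeomorph M Plane) (t : ℝ) (y : Plane) (a : Fin 2) : ℝ :=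
  ∑ b, ∑ c, (S.G e t y)⁻¹ b c * covDerivTensor (S.G e t) (S.k e t) c a b y

/-- The traceless part `h_{ab} = k_{ab} - ½ g_{ab} g^{cd} k_{cd}` in the chart `e`. -/
def h (e : OpenPartialHomeomorph M Plane) (t : ℝ) (y : Plane) : Matrix (Fin 2) (Fin 2) ℝ :=
  Matrix.of fun a b => S.k e t y a b - (1 / 2) * S.G e t y a b * S.trk e t y

/-- The contravariant components `h^{ab} = g^{ac} g^{bd} h_{cd}` in the chart `e`. -/
def hUp (e : OpenPartialHomeomorph M Plane) (t : ℝ) (y : Plane) (a b : Fin 2) : ℝ :=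
  ∑ c, ∑ d, (S.G e t y)⁻¹ a c * (S.G e t y)⁻¹ b d * S.h e t y c d

/-! ### Scalar functions on the surface, computed at `x` in the chart around `x` -/

/-- `g^{ab} ∂_a f₁ ∂_b f₂`. -/
def gradInner (t : ℝ) (f₁ f₂ : M → ℝ) (x : M) : ℝ :=
  let e := chartAt Plane x
  ∑ a, ∑ b, (S.G e t (e x))⁻¹ a b * pd a (f₁ ∘ e.symm) (e x) * pd b (f₂ ∘ e.symm) (e x)

/-- The Laplacian `Δ_g f = g^{ab} ∇_a ∂_b f`. -/
def lap (t : ℝ) (f : M → ℝ) (x : M) : ℝ :=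
  let e := chartAt Plane x
  ∑ a, ∑ b, (S.G e t (e x))⁻¹ a b * hess (S.G e t) (f ∘ e.symm) a b (e x)

/-- `h^{ab} ∂_a f₁ ∂_b f₂`. -/
def hGrad (t : ℝ) (f₁ f₂ : M → ℝ) (x : M) : ℝ :=
  let e := chartAt Plane x
  ∑ a, ∑ b, S.hUp e t (e x) a b * pd a (f₁ ∘ e.symm) (e x) * pd b (f₂ ∘ e.symm) (e x)

/-- `h^{ab} ∇_a ∂_b f`. -/
def hHess (t : ℝ) (f : M → ℝ) (x : M) : ℝ :=
  let e := chartAt Plane x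
  ∑ a, ∑ b, S.hUp e t (e x) a b * hess (S.G e t) (f ∘ e.symm) a b (e x)

/-- The derivative `∂₀ f = ∂_t f - ν^a ∂_a f` of a time dependent function. -/
def dZero (f : ℝ → M → ℝ) (t : ℝ) (x : M) : ℝ :=
  let shiftDeriv : ℝ := mfderiv (𝓡 2) 𝓘(ℝ, ℝ) (f t) x (S.ν t x)
  deriv (fun s => f s x) t - shiftDeriv

/-- `u' = N⁻¹ ∂₀ u`. -/
def prime (u : ℝ → M → ℝ) (t : ℝ) (x : M) : ℝ :=
  (S.N t x)⁻¹ * S.dZero u t x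

/-! ### The area measure and the second energy -/

/-- The Riemannian measure `μ_g`, with density `√(det g_{ab})` in each chart, glued from the
charts by a smooth partition of unity (the result does not depend on the partition). -/
def area [IsManifold (𝓡 2) ∞ M] [T2Space M] [CompactSpace M] [MeasurableSpace M]
    (t : ℝ) : Measure M :=
  let ex := SmoothPartitionOfUnity.exists_isSubordinate (M := M) (𝓡 2) isClosed_univ
    (fun p : M => (chartAt Plane p).source) (fun p => (chartAt Plane p).open_source)
    (fun p _ => Set.mem_iUnion.2 ⟨p, mem_chart_source Plane p⟩)
  Measure.sum fun p : M =>
    (Measure.map (chartAt Plane p).symm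
      ((volume.restrict (chartAt Plane p).target).withDensity
        fun y => ENNReal.ofReal (Real.sqrt (S.G (chartAt Plane p) t y).det))).withDensity
      fun x => ENNReal.ofReal (ex.choose p x)

/-- `J₀ = ½ |Du'|²_g`. -/
def J0 (u : ℝ → M → ℝ) (t : ℝ) (x : M) : ℝ :=
  (1 / 2) * dot 1 (S.gradInner t (S.prime u t) (S.prime u t) x)

/-- `J₁ = ½ |Δ_g u|²`. -/
def J1 (u : ℝ → M → ℝ) (t : ℝ) (x : M) : ℝ :=
  (1 / 2) * dot (S.lap t (u t) x) (S.lap t (u t) x)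

/-- The second energy `∫ (J₀ + J₁) μ_g`. -/
def energyOne [IsManifold (𝓡 2) ∞ M] [T2Space M] [CompactSpace M] [MeasurableSpace M]
    (u : ℝ → M → ℝ) (t : ℝ) : ℝ :=
  ∫ x, (S.J0 u t x + S.J1 u t x) ∂(S.area t)

/-- The integrand
`{(2 ∂_a N h^{ac} - 2 N ∂^c u . u') ∂_c u + 2 ∂^a N ∂_a u' + u' Δ_g N} . Δ_g u` of `Y₁`. -/
def Y1Density (u : ℝ → M → ℝ) (t : ℝ) (x : M) : ℝ :=
  dot (2 * S.hGrad t (S.N t) (u t) x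
      - 2 * S.N t x * dot (S.gradInner t (u t) (u t) x) (S.prime u t x)
      + 2 * S.gradInner t (S.N t) (S.prime u t) x
      + S.prime u t x * S.lap t (S.N t) x)
    (S.lap t (u t) x)

/-- The integrand of `Z`:
`N h^{ab} ∂_a u' . ∂_b u' + 2 N h^{ab} ∇_a ∂_b u . Δ_g u
  + (∇_b (∂^a N ∂_a u) + τ ∂_b N u') . ∂^b u'`, plus the integrand of `Y₁`. -/
def ZDensity (τ : ℝ → ℝ) (u : ℝ → M → ℝ) (t : ℝ) (x : M) : ℝ :=
  S.N t x * dot 1 (S.hGrad t (S.prime u t) (S.prime u t) x)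
    + 2 * S.N t x * dot (S.hHess t (u t) x) (S.lap t (u t) x)
    + dot 1 (S.gradInner t (S.gradInner t (S.N t) (u t)) (S.prime u t) x)
    + τ t * dot (S.prime u t x) (S.gradInner t (S.N t) (S.prime u t) x)
    + S.Y1Density u t x

/-! ### The equations -/

/-- For times in `J`: `(g, N, ν)` is a `C²` Lorentzian metric with spacelike slices of
constant mean curvature `τ(t)`, and `u` is a `C³` function which satisfies, with this metric,
the momentum constraint and the wave equation. -/
structure IsSolution (J : Set ℝ) (τ : ℝ → ℝ) (u : ℝ → M → ℝ) : Prop where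
  g_symm : ∀ t ∈ J, ∀ x v w, S.g t x v w = S.g t x w v
  g_pos : ∀ t ∈ J, ∀ x v, v ≠ 0 → 0 < S.g t x v v
  N_pos : ∀ t ∈ J, ∀ x, 0 < S.N t x
  g_reg : ∀ e ∈ atlas Plane M, ∀ a b,
    ContDiffOn ℝ 2 (fun z : ℝ × Plane => S.G e z.1 z.2 a b) (J ×ˢ e.target)
  ν_reg : ∀ e ∈ atlas Plane M, ∀ a,
    ContDiffOn ℝ 2 (fun z : ℝ × Plane => S.shiftUp e z.1 z.2 a) (J ×ˢ e.target)
  N_reg : ∀ e ∈ atlas Plane M,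
    ContDiffOn ℝ 2 (fun z : ℝ × Plane => S.N z.1 (e.symm z.2)) (J ×ˢ e.target)
  u_reg : ∀ e ∈ atlas Plane M,
    ContDiffOn ℝ 3 (fun z : ℝ × Plane => u z.1 (e.symm z.2)) (J ×ˢ e.target)
  /-- The mean curvature is constant on each slice. -/
  cmc : ∀ e ∈ atlas Plane M, ∀ t ∈ J, ∀ y ∈ e.target, S.trk e t y = τ t
  /-- `N (-∇_b k_a^b + ∂_a τ) = ∂₀ u . ∂_a u`. -/
  momentum : ∀ e ∈ atlas Plane M, ∀ t ∈ J, ∀ y ∈ e.target, ∀ a,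
    S.N t (e.symm y) * (-S.divk e t y a + pd a (S.trk e t) y)
      = dot (S.dZero u t (e.symm y)) (pd a (u t ∘ e.symm) y)
  /-- `∂₀ u' = N Δ_g u + ∂^a N ∂_a u + τ N u'`. -/
  wave : ∀ t ∈ J, ∀ x, S.dZero (S.prime u) t x
    = S.N t x * S.lap t (u t) x + S.gradInner t (S.N t) (u t) x + τ t * S.N t x * S.prime u t x

end Slicing

end PolarizedU1

end

open scoped Manifold ContDiff
open MeasureTheory

noncomputable section

/-! Put F = J₀ + J₁ = |Du'|² + (Δu)². In a chart the energy integrates F √(det g), so everything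
rests on a pointwise formula for ∂_t F + F ∂_t log √(det g): it equals the integrand of the
right-hand side plus the divergence of the vector field F ν + 2 N Δu Du'
(`IsSlicingOn.local_energy`). On a closed surface the divergence integrates to zero
(`sum_integral_divergence`).

For the pointwise formula, write ∂_t = ∂₀ + ν^a ∂_a and view ∂₀ as a Lie derivative. It sends g^{ab}
to 2 N k^{ab} and multiplies the area form by -Nτ. Hence the Lie derivative of grad f is 2 N k^{ab}
∂_b f + grad ∂₀f (`lieVec_grd`), and, as τ is constant on slices, ∂₀ commutes with the divergence up
to -τ X^a ∂_a N (`dNorm_dvg`). Since Δ = div grad, these two facts give the commutator of ∂₀ and Δ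
without any evolution equation for the Christoffel symbols (`dNorm_lapl`). Its term with div k is
removed by the momentum constraint and becomes the cubic term of Y₁; the wave equation replaces
∂₀u'. The third derivatives of u that remain, 2 N ∂^a u' ∂_a Δu and 2 N Δu Δu', are absorbed by the
divergence of 2 N Δu Du'. Transport along the shift and the change of area combine to div(F ν) -
NτF. With k = h + ½ τ g the multiples of τ without derivatives of N add up to τN(-(J₀ + J₁) + 3 J₀ +
2 J₁) = 2τF + τ(N J₀ + (N - 2) F).

To globalize, note that the scalars of the statement are computed at each point in the preferred
chart there. They agree with their expressions in any other chart by the tensor law for covariant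
derivatives (`covDerivCovector_change`). The energy is then a finite sum of plane integrals weighted
by a partition of unity, each with a C¹ integrand vanishing off a fixed compact set, so
differentiation under the integral is allowed. Integrating the flux by parts chart by chart leaves
derivatives of the partition functions, whose sum is the derivative of 1. -/

namespace PolarizedU1

/-! ### Directional derivatives of scalar functions -/

section DirectionalDerivative

variable {E : Type*} [NormedAddCommGroup E] [NormedSpace ℝ E]

/-- The derivative of `F` at `z` in the direction `v`. -/
def dirD (v : E) (F : E → ℝ) (z : E) : ℝ := fderiv ℝ F z v

lemma pd_eq_dirD (a : Fin 2) : pd a = dirD (EuclideanSpace.single a (1 : ℝ) : Plane) := rfl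

variable {v w z : E} {F F' : E → ℝ}

lemma dirD_congr (h : F =ᶠ[nhds z] F') : dirD v F z = dirD v F' z := by
  simp only [dirD, h.fderiv_eq]

lemma dirD_congr_of_eqOn {U : Set E} (hU : IsOpen U) (hz : z ∈ U) (h : Set.EqOn F F' U) :
    dirD v F z = dirD v F' z :=
  dirD_congr (h.eventuallyEq_of_mem (hU.mem_nhds hz))

lemma dirD_const (c : ℝ) : dirD v (fun _ : E => c) z = 0 := by simp [dirD]

lemma dirD_add (h : DifferentiableAt ℝ F z) (h' : DifferentiableAt ℝ F' z) :
    dirD v (fun y => F y + F' y) z = dirD v F z + dirD v F' z := by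
  simp [dirD, fderiv_fun_add h h']

lemma dirD_sub (h : DifferentiableAt ℝ F z) (h' : DifferentiableAt ℝ F' z) :
    dirD v (fun y => F y - F' y) z = dirD v F z - dirD v F' z := by
  simp [dirD, fderiv_fun_sub h h']

lemma dirD_neg : dirD v (fun y => -F y) z = -dirD v F z := by
  simp [dirD, fderiv_fun_neg]

lemma dirD_mul (h : DifferentiableAt ℝ F z) (h' : DifferentiableAt ℝ F' z) :
    dirD v (fun y => F y * F' y) z = dirD v F z * F' z + F z * dirD v F' z := by
  simp [dirD, fderiv_fun_mul h h']
  ring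

lemma dirD_const_mul (c : ℝ) (h : DifferentiableAt ℝ F z) :
    dirD v (fun y => c * F y) z = c * dirD v F z := by
  simp [dirD, fderiv_const_mul h]

lemma dirD_sum {ι : Type*} (s : Finset ι) {f : ι → E → ℝ}
    (h : ∀ i ∈ s, DifferentiableAt ℝ (f i) z) :
    dirD v (fun y => ∑ i ∈ s, f i y) z = ∑ i ∈ s, dirD v (f i) z := by
  simp [dirD, fderiv_fun_sum h]

lemma dirD_sum_mul {ι : Type*} (s : Finset ι) {f f' : ι → E → ℝ}
    (h : ∀ i ∈ s, DifferentiableAt ℝ (f i) z) (h' : ∀ i ∈ s, DifferentiableAt ℝ (f' i) z) :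
    dirD v (fun y => ∑ i ∈ s, f i y * f' i y) z
      = ∑ i ∈ s, (dirD v (f i) z * f' i z + f i z * dirD v (f' i) z) := by
  rw [dirD_sum s fun i hi => (h i hi).fun_mul (h' i hi)]
  exact Finset.sum_congr rfl fun i hi => dirD_mul (h i hi) (h' i hi)

lemma dirD_comp {φ : ℝ → ℝ} {φ' : ℝ} (hφ : HasDerivAt φ φ' (F z)) (h : DifferentiableAt ℝ F z) :
    dirD v (fun y => φ (F y)) z = φ' * dirD v F z := by
  have := (hφ.comp_hasFDerivAt z h.hasFDerivAt).fderiv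
  simp only [dirD]
  rw [show (fun y => φ (F y)) = φ ∘ F from rfl, this]
  simp

lemma contDiffOn_dirD {n m : WithTop ℕ∞} {U : Set E} (hF : ContDiffOn ℝ m F U) (hU : IsOpen U)
    (hnm : n + 1 ≤ m) (v : E) : ContDiffOn ℝ n (dirD v F) U :=
  (hF.fderiv_of_isOpen hU hnm).clm_apply contDiffOn_const

lemma dirD_comm (h : ContDiffAt ℝ 2 F z) :
    dirD v (dirD w F) z = dirD w (dirD v F) z := by
  have hd : DifferentiableAt ℝ (fderiv ℝ F) z :=
    (h.fderiv_right (m := 1) (by norm_num)).differentiableAt (by norm_num)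
  have hs : IsSymmSndFDerivAt ℝ F z := h.isSymmSndFDerivAt (by simp)
  have key : ∀ v w : E, dirD v (dirD w F) z
      = fderiv ℝ (fderiv ℝ F) z v w := by
    intro v w
    rw [show dirD w F = fun y => fderiv ℝ F y w from rfl, dirD,
      fderiv_clm_apply hd (differentiableAt_const w)]
    simp
  rw [key, key, hs.eq]

end DirectionalDerivative

lemma _root_.ContDiffOn.differentiableAt_of_isOpen {E F : Type*} [NormedAddCommGroup E] [NormedSpace ℝ E]
    [NormedAddCommGroup F] [NormedSpace ℝ F] {f : E → F} {U : Set E} {n : WithTop ℕ∞}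
    (h : ContDiffOn ℝ n f U) (hU : IsOpen U) (hn : n ≠ 0) {z : E} (hz : z ∈ U) :
    DifferentiableAt ℝ f z :=
  (h.contDiffAt (hU.mem_nhds hz)).differentiableAt hn

/-! ### Space and time derivatives on `ℝ × Plane` -/

/-- The time direction in `ℝ × Plane`. -/
def vt : ℝ × Plane := (1, 0)

/-- The `a`-th space direction in `ℝ × Plane`. -/
def vx (a : Fin 2) : ℝ × Plane := (0, EuclideanSpace.single a (1 : ℝ))

/-- The definitions of the statement differentiate in space on a slice and in time at a fixed point.
The calculations use joint functions on `ℝ × Plane`, where time and space derivatives are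
directional derivatives that commute. This lemma and `deriv_slice` translate. -/
lemma pd_slice {F : ℝ × Plane → ℝ} {t : ℝ} {y : Plane} (h : DifferentiableAt ℝ F (t, y))
    (a : Fin 2) : pd a (fun y' => F (t, y')) y = dirD (vx a) F (t, y) := by
  have h1 : HasFDerivAt (fun y' : Plane => (t, y')) (ContinuousLinearMap.inr ℝ ℝ Plane) y :=
    hasFDerivAt_prodMk_right t y
  have := (h.hasFDerivAt.comp y h1).fderiv
  simp only [pd, dirD, vx]
  rw [show (fun y' => F (t, y')) = F ∘ fun y' : Plane => (t, y') from rfl, this]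
  simp

lemma hasDerivAt_slice {F : ℝ × Plane → ℝ} {t : ℝ} {y : Plane}
    (h : DifferentiableAt ℝ F (t, y)) :
    HasDerivAt (fun s => F (s, y)) (dirD vt F (t, y)) t := by
  have h1 : HasFDerivAt (fun s : ℝ => (s, y)) (ContinuousLinearMap.inl ℝ ℝ Plane) t :=
    hasFDerivAt_prodMk_left t y
  have := (h.hasFDerivAt.comp t h1).hasDerivAt
  simpa [dirD, vt, Function.comp_def] using this

lemma deriv_slice {F : ℝ × Plane → ℝ} {t : ℝ} {y : Plane} (h : DifferentiableAt ℝ F (t, y)) :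
    deriv (fun s => F (s, y)) t = dirD vt F (t, y) :=
  (hasDerivAt_slice h).deriv

/-! ### Metrics in an open set of `ℝ × Plane` -/

section JointTensors

variable (g : ℝ × Plane → Matrix (Fin 2) (Fin 2) ℝ)

/-- The Christoffel symbols as functions of time and coordinates. -/
def chr (c a b : Fin 2) (z : ℝ × Plane) : ℝ :=
  (1 / 2) * ∑ d, (g z)⁻¹ c d * (dirD (vx a) (fun y => g y d b) z
    + dirD (vx b) (fun y => g y d a) z - dirD (vx d) (fun y => g y a b) z)

/-- The covariant derivative of a covector field, as a function of time and coordinates. -/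
def cov (w : Fin 2 → ℝ × Plane → ℝ) (a b : Fin 2) (z : ℝ × Plane) : ℝ :=
  dirD (vx a) (w b) z - ∑ c, chr g c a b z * w c z

/-- The covariant derivative of a 2-tensor field, as a function of time and coordinates. -/
def covT (T : ℝ × Plane → Matrix (Fin 2) (Fin 2) ℝ) (c a b : Fin 2) (z : ℝ × Plane) : ℝ :=
  dirD (vx c) (fun y => T y a b) z - ∑ d, chr g d c a z * T z d b - ∑ d, chr g d c b z * T z a d

/-- The logarithm of the area density. -/
def logDensity (z : ℝ × Plane) : ℝ := (1 / 2) * Real.log (g z).det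

/-- The divergence of a vector field, as a function of time and coordinates. -/
def dvg (X : Fin 2 → ℝ × Plane → ℝ) (z : ℝ × Plane) : ℝ :=
  ∑ a, (dirD (vx a) (X a) z + dirD (vx a) (logDensity g) z * X a z)

/-- The contravariant components of the gradient. -/
def grd (f : ℝ × Plane → ℝ) (a : Fin 2) (z : ℝ × Plane) : ℝ :=
  ∑ b, (g z)⁻¹ a b * dirD (vx b) f z

/-- The Laplacian as a function of time and coordinates. -/
def lapl (f : ℝ × Plane → ℝ) (z : ℝ × Plane) : ℝ :=
  ∑ a, ∑ b, (g z)⁻¹ a b * cov g (fun c => dirD (vx c) f) a b z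

/-- The scalar product of two gradients. -/
def grdInner (f₁ f₂ : ℝ × Plane → ℝ) (z : ℝ × Plane) : ℝ :=
  ∑ a, ∑ b, (g z)⁻¹ a b * dirD (vx a) f₁ z * dirD (vx b) f₂ z

/-- Raising both indices. -/
def raise (T : ℝ × Plane → Matrix (Fin 2) (Fin 2) ℝ) (a b : Fin 2) (z : ℝ × Plane) : ℝ :=
  ∑ c, ∑ d, (g z)⁻¹ a c * (g z)⁻¹ b d * T z c d

end JointTensors

lemma dvg_mul {g : ℝ × Plane → Matrix (Fin 2) (Fin 2) ℝ} {z : ℝ × Plane}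
    {φ : ℝ × Plane → ℝ} {X : Fin 2 → ℝ × Plane → ℝ} (hφ : DifferentiableAt ℝ φ z)
    (hX : ∀ a, DifferentiableAt ℝ (X a) z) :
    dvg g (fun a y => φ y * X a y) z = φ z * dvg g X z + ∑ a, X a z * dirD (vx a) φ z := by
  simp only [dvg, dirD_mul hφ (hX _), Fin.sum_univ_two]
  ring

/-- A metric of class `C²` on an open set. -/
structure IsMetricOn (U : Set (ℝ × Plane)) (g : ℝ × Plane → Matrix (Fin 2) (Fin 2) ℝ) : Prop where
  isOpen : IsOpen U
  contDiff : ∀ a b, ContDiffOn ℝ 2 (fun z => g z a b) U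
  symm : ∀ z ∈ U, ∀ a b, g z a b = g z b a
  det_pos : ∀ z ∈ U, 0 < (g z).det

namespace IsMetricOn

variable {U : Set (ℝ × Plane)} {g : ℝ × Plane → Matrix (Fin 2) (Fin 2) ℝ}
  {z : ℝ × Plane} {v : ℝ × Plane}

lemma inv_apply (A : Matrix (Fin 2) (Fin 2) ℝ) (a b : Fin 2) :
    A⁻¹ a b = (A.det)⁻¹ * (!![A 1 1, -A 0 1; -A 1 0, A 0 0] : Matrix (Fin 2) (Fin 2) ℝ) a b := by
  rw [Matrix.inv_def, Matrix.adjugate_fin_two, Ring.inverse_eq_inv', Matrix.smul_apply, smul_eq_mul]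

variable (hg : IsMetricOn U g)
include hg

lemma diff (hz : z ∈ U) (a b : Fin 2) : DifferentiableAt ℝ (fun y => g y a b) z :=
  (hg.contDiff a b).differentiableAt_of_isOpen hg.isOpen (by norm_num) hz

lemma contDiff_det : ContDiffOn ℝ 2 (fun z => (g z).det) U := by
  simp only [Matrix.det_fin_two]
  exact ((hg.contDiff 0 0).mul (hg.contDiff 1 1)).sub ((hg.contDiff 0 1).mul (hg.contDiff 1 0))

lemma contDiff_logDensity : ContDiffOn ℝ 2 (logDensity g) U :=
  contDiffOn_const.mul (hg.contDiff_det.log fun z hz => (hg.det_pos z hz).ne')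

lemma contDiff_inv (a b : Fin 2) : ContDiffOn ℝ 2 (fun z => (g z)⁻¹ a b) U := by
  have hd : ContDiffOn ℝ 2 (fun z => ((g z).det)⁻¹) U :=
    hg.contDiff_det.inv fun z hz => (hg.det_pos z hz).ne'
  simp only [inv_apply]
  refine hd.mul ?_
  fin_cases a <;> fin_cases b
  · exact hg.contDiff 1 1
  · exact (hg.contDiff 0 1).neg
  · exact (hg.contDiff 1 0).neg
  · exact hg.contDiff 0 0

lemma diff_inv (hz : z ∈ U) (a b : Fin 2) : DifferentiableAt ℝ (fun y => (g y)⁻¹ a b) z :=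
  (hg.contDiff_inv a b).differentiableAt_of_isOpen hg.isOpen (by norm_num) hz

lemma isUnit_det (hz : z ∈ U) : IsUnit (g z).det := (hg.det_pos z hz).ne'.isUnit

lemma inv_symm (hz : z ∈ U) (a b : Fin 2) : (g z)⁻¹ a b = (g z)⁻¹ b a := by
  have h := hg.symm z hz 0 1
  fin_cases a <;> fin_cases b <;> simp [inv_apply, h]

lemma dirD_symm (hz : z ∈ U) (a b : Fin 2) :
    dirD v (fun y => g y a b) z = dirD v (fun y => g y b a) z :=
  dirD_congr_of_eqOn hg.isOpen hz fun y hy => hg.symm y hy a b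

lemma inv_mul (hz : z ∈ U) (a b : Fin 2) :
    ∑ c, (g z)⁻¹ a c * g z c b = if a = b then 1 else 0 := by
  rw [← Matrix.mul_apply, Matrix.nonsing_inv_mul _ (hg.isUnit_det hz), Matrix.one_apply]

/-- The derivative of the inverse metric. -/
lemma dirD_inv (hz : z ∈ U) (a b : Fin 2) :
    dirD v (fun y => (g y)⁻¹ a b) z
      = -∑ c, ∑ d, (g z)⁻¹ a c * dirD v (fun y => g y c d) z * (g z)⁻¹ d b := by
  set W := (g z)⁻¹ with hW
  set D : Matrix (Fin 2) (Fin 2) ℝ := Matrix.of fun a b => dirD v (fun y => (g y)⁻¹ a b) z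
  set H : Matrix (Fin 2) (Fin 2) ℝ := Matrix.of fun a b => dirD v (fun y => g y a b) z
  -- Differentiate g⁻¹ g = 1; multiplication by g⁻¹ on the right then isolates `D`.
  have h1 : D * g z + W * H = 0 := by
    ext a b
    have h0 : dirD v (fun y => ∑ c, (g y)⁻¹ a c * g y c b) z = 0 := by
      rw [dirD_congr_of_eqOn hg.isOpen hz fun y hy => hg.inv_mul hy a b, dirD_const]
    rw [dirD_sum_mul _ (fun c _ => hg.diff_inv hz a c) (fun c _ => hg.diff hz c b)] at h0
    simpa [Matrix.mul_apply, Finset.sum_add_distrib, D, H] using h0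
  have h2 : D = -(W * H * W) := by
    have h3 : g z * W = 1 := Matrix.mul_nonsing_inv _ (hg.isUnit_det hz)
    calc D = D * (g z * W) := by rw [h3, mul_one]
      _ = D * g z * W := by rw [mul_assoc]
      _ = _ := by rw [eq_neg_of_add_eq_zero_left h1, neg_mul]
  have h4 := congrFun (congrFun h2 a) b
  simp only [Matrix.neg_apply, Matrix.mul_apply] at h4
  rw [show dirD v (fun y => (g y)⁻¹ a b) z = D a b from rfl, h4]
  simp only [Fin.sum_univ_two, H, Matrix.of_apply]
  ring

/-- The derivative of the inverse metric in terms of the Christoffel symbols. -/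
lemma dirD_inv_chr (hz : z ∈ U) (c a b : Fin 2) :
    dirD (vx c) (fun y => (g y)⁻¹ a b) z
      = -(∑ d, chr g a c d z * (g z)⁻¹ d b) - ∑ d, chr g b c d z * (g z)⁻¹ a d := by
  rw [hg.dirD_inv hz]
  have h1 : ∀ v : ℝ × Plane, _ := fun v => hg.dirD_symm (v := v) hz 1 0
  have h2 := hg.inv_symm hz 1 0
  fin_cases a <;> fin_cases b <;> fin_cases c <;>
    simp only [chr, Fin.sum_univ_two, Fin.isValue, Fin.zero_eta, Fin.mk_one, h1, h2] <;> ring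

lemma chr_symm (hz : z ∈ U) (c a b : Fin 2) : chr g c a b z = chr g c b a z := by
  simp only [chr]
  congr 1
  refine Finset.sum_congr rfl fun d _ => ?_
  rw [hg.dirD_symm hz a b]
  ring

lemma dirD_logDensity (hz : z ∈ U) :
    dirD v (logDensity g) z
      = (1 / 2) * ∑ a, ∑ b, (g z)⁻¹ a b * dirD v (fun y => g y a b) z := by
  have hd : DifferentiableAt ℝ (fun y => (g y).det) z :=
    hg.contDiff_det.differentiableAt_of_isOpen hg.isOpen (by norm_num) hz
  have h1 : dirD v (fun y => Real.log (g y).det) z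
      = ((g z).det)⁻¹ * dirD v (fun y => (g y).det) z :=
    dirD_comp (Real.hasDerivAt_log (hg.det_pos z hz).ne') hd
  have h2 : dirD v (fun y => (g y).det) z
      = dirD v (fun y => g y 0 0) z * g z 1 1 + g z 0 0 * dirD v (fun y => g y 1 1) z
        - (dirD v (fun y => g y 0 1) z * g z 1 0 + g z 0 1 * dirD v (fun y => g y 1 0) z) := by
    have e := hg.diff hz
    simp only [Matrix.det_fin_two]
    rw [dirD_sub ((e 0 0).fun_mul (e 1 1)) ((e 0 1).fun_mul (e 1 0)), dirD_mul (e 0 0) (e 1 1),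
      dirD_mul (e 0 1) (e 1 0)]
  rw [show dirD v (logDensity g) z = (1 / 2) * dirD v (fun y => Real.log (g y).det) z from
    dirD_const_mul _ (hd.log (hg.det_pos z hz).ne'), h1, h2]
  simp only [Fin.sum_univ_two, inv_apply]
  simp [hg.dirD_symm hz 1 0, hg.symm z hz 1 0]
  ring

/-- In the contracted symbol two of the three metric derivatives cancel by symmetry. This identifies
`dvg` with the covariant divergence ∇_a X^a. -/
lemma dirD_logDensity_chr (hz : z ∈ U) (a : Fin 2) :
    dirD (vx a) (logDensity g) z = ∑ c, chr g c c a z := by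
  rw [hg.dirD_logDensity hz]
  have h1 : ∀ v : ℝ × Plane, _ := fun v => hg.dirD_symm (v := v) hz 1 0
  have h2 := hg.inv_symm hz 1 0
  fin_cases a <;>
    simp only [chr, Fin.sum_univ_two, Fin.isValue, Fin.zero_eta, Fin.mk_one, h1, h2] <;> ring

lemma chr_lower (hz : z ∈ U) (a b d : Fin 2) :
    ∑ c, chr g c a b z * g z c d = (1 / 2) * (dirD (vx a) (fun y => g y d b) z
      + dirD (vx b) (fun y => g y d a) z - dirD (vx d) (fun y => g y a b) z) := by
  have h1 : ∀ e, ∑ c, (g z)⁻¹ c e * g z c d = if e = d then 1 else 0 := fun e => by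
    rw [← hg.inv_mul hz e d]
    exact Finset.sum_congr rfl fun c _ => by rw [hg.inv_symm hz]
  have h2 := h1 0
  have h3 := h1 1
  simp only [Fin.sum_univ_two] at h2 h3
  fin_cases d <;> simp at h2 h3 <;> simp only [chr, Fin.sum_univ_two, Fin.isValue, Fin.zero_eta, Fin.mk_one]
  · linear_combination
      (1 / 2) * (dirD (vx a) (fun y => g y 0 b) z + dirD (vx b) (fun y => g y 0 a) z
        - dirD (vx 0) (fun y => g y a b) z) * h2
      + (1 / 2) * (dirD (vx a) (fun y => g y 1 b) z + dirD (vx b) (fun y => g y 1 a) z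
        - dirD (vx 1) (fun y => g y a b) z) * h3
  · linear_combination
      (1 / 2) * (dirD (vx a) (fun y => g y 0 b) z + dirD (vx b) (fun y => g y 0 a) z
        - dirD (vx 0) (fun y => g y a b) z) * h2
      + (1 / 2) * (dirD (vx a) (fun y => g y 1 b) z + dirD (vx b) (fun y => g y 1 a) z
        - dirD (vx 1) (fun y => g y a b) z) * h3

lemma contDiff_chr (c a b : Fin 2) : ContDiffOn ℝ 1 (chr g c a b) U := by
  refine contDiffOn_const.mul (ContDiffOn.sum fun d _ => ?_)
  have h := fun (v : ℝ × Plane) a b =>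
    contDiffOn_dirD (n := 1) (hg.contDiff a b) hg.isOpen (by norm_num) v
  exact ((hg.contDiff_inv c d).of_le (by norm_num)).mul (((h _ _ _).add (h _ _ _)).sub (h _ _ _))

/-- By ∇g⁻¹ = 0 and Γ^c_{ca} = ∂_a log √(det g). The divergence form contains no Christoffel
symbols, which makes the time derivative of the Laplacian tractable. -/
lemma dvg_grd {f : ℝ × Plane → ℝ} (hf : ContDiffOn ℝ 2 f U) (hz : z ∈ U) :
    dvg g (grd g f) z = lapl g f z := by
  have hfd : ∀ b, DifferentiableAt ℝ (dirD (vx b) f) z := fun b =>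
    (contDiffOn_dirD (n := 1) hf hg.isOpen (by norm_num) _).differentiableAt_of_isOpen hg.isOpen (by norm_num) hz
  have h1 : ∀ a, dirD (vx a) (grd g f a) z = _ := fun a =>
    dirD_sum_mul (v := vx a) Finset.univ (fun b _ => hg.diff_inv hz a b) (fun b _ => hfd b)
  simp only [dvg, h1, hg.dirD_logDensity_chr hz, hg.dirD_inv_chr hz, lapl, cov, grd,
    Fin.sum_univ_two, hg.chr_symm hz _ 1 0]
  ring

end IsMetricOn

/-! ### Lapse, shift and extrinsic curvature -/

section Extrinsic

variable (g : ℝ × Plane → Matrix (Fin 2) (Fin 2) ℝ) (N : ℝ × Plane → ℝ)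
  (n : Fin 2 → ℝ × Plane → ℝ)

/-- Lowering the index of a vector field. -/
def lower (a : Fin 2) (z : ℝ × Plane) : ℝ := ∑ b, g z a b * n b z

/-- The extrinsic curvature as a function of time and coordinates. -/
def extr (z : ℝ × Plane) : Matrix (Fin 2) (Fin 2) ℝ :=
  Matrix.of fun a b => (2 * N z)⁻¹ * (-dirD vt (fun y => g y a b) z
    + cov g (lower g n) a b z + cov g (lower g n) b a z)

/-- The derivative `∂_t f - ν^a ∂_a f` as a function of time and coordinates. -/
def dNorm (f : ℝ × Plane → ℝ) (z : ℝ × Plane) : ℝ :=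
  dirD vt f z - ∑ a, n a z * dirD (vx a) f z

/-- The Lie derivative `∂_t X^a - ν^c ∂_c X^a + X^c ∂_c ν^a` of a vector field. -/
def lieVec (X : Fin 2 → ℝ × Plane → ℝ) (a : Fin 2) (z : ℝ × Plane) : ℝ :=
  dNorm n (X a) z + ∑ c, X c z * dirD (vx c) (n a) z

end Extrinsic

/-- A metric, a positive lapse and a shift of class `C²` on an open set. -/
structure IsSlicingOn (U : Set (ℝ × Plane)) (g : ℝ × Plane → Matrix (Fin 2) (Fin 2) ℝ)
    (N : ℝ × Plane → ℝ) (n : Fin 2 → ℝ × Plane → ℝ) : Prop extends IsMetricOn U g where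
  contDiff_lapse : ContDiffOn ℝ 2 N U
  lapse_pos : ∀ z ∈ U, 0 < N z
  contDiff_shift : ∀ a, ContDiffOn ℝ 2 (n a) U

section DNorm

variable {n : Fin 2 → ℝ × Plane → ℝ} {z : ℝ × Plane} {f f' : ℝ × Plane → ℝ}

lemma dNorm_mul (h : DifferentiableAt ℝ f z) (h' : DifferentiableAt ℝ f' z) :
    dNorm n (fun y => f y * f' y) z = dNorm n f z * f' z + f z * dNorm n f' z := by
  simp only [dNorm, dirD_mul h h', Fin.sum_univ_two]
  ring

lemma dNorm_add (h : DifferentiableAt ℝ f z) (h' : DifferentiableAt ℝ f' z) :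
    dNorm n (fun y => f y + f' y) z = dNorm n f z + dNorm n f' z := by
  simp only [dNorm, dirD_add h h', Fin.sum_univ_two]
  ring

lemma dNorm_sum {ι : Type*} (s : Finset ι) {f : ι → ℝ × Plane → ℝ}
    (h : ∀ i ∈ s, DifferentiableAt ℝ (f i) z) :
    dNorm n (fun y => ∑ i ∈ s, f i y) z = ∑ i ∈ s, dNorm n (f i) z := by
  simp only [dNorm, dirD_sum s h, Fin.sum_univ_two, Finset.sum_sub_distrib, Finset.sum_add_distrib,
    Finset.mul_sum]

end DNorm

/-! ### Evolution of the metric, the area density, gradients and divergences. -/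

namespace IsSlicingOn

variable {U : Set (ℝ × Plane)} {g : ℝ × Plane → Matrix (Fin 2) (Fin 2) ℝ}
  {N : ℝ × Plane → ℝ} {n : Fin 2 → ℝ × Plane → ℝ} {z : ℝ × Plane}
  (hs : IsSlicingOn U g N n)
include hs

lemma diff_shift (hz : z ∈ U) (a : Fin 2) : DifferentiableAt ℝ (n a) z :=
  (hs.contDiff_shift a).differentiableAt_of_isOpen hs.isOpen (by norm_num) hz

lemma diff_lapse (hz : z ∈ U) : DifferentiableAt ℝ N z :=
  hs.contDiff_lapse.differentiableAt_of_isOpen hs.isOpen (by norm_num) hz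

/-- Both sides are the Lie derivative of g along the shift: the lowered Christoffel symbols are
plain metric derivatives (`chr_lower`). It yields ∂_t g in terms of k and partial derivatives only.
-/
lemma cov_lower_add (hz : z ∈ U) (a b : Fin 2) :
    cov g (lower g n) a b z + cov g (lower g n) b a z
      = ∑ c, (n c z * dirD (vx c) (fun y => g y a b) z + g z c b * dirD (vx a) (n c) z
        + g z a c * dirD (vx b) (n c) z) := by
  have h1 : ∀ v b, dirD v (lower g n b) z = _ := fun v b =>
    dirD_sum_mul (v := v) Finset.univ (fun c _ => hs.diff hz b c) (fun c _ => hs.diff_shift hz c)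
  have h2 : ∀ a b, ∑ c, chr g c a b z * lower g n c z
      = ∑ d, n d z * ((1 / 2) * (dirD (vx a) (fun y => g y d b) z
      + dirD (vx b) (fun y => g y d a) z - dirD (vx d) (fun y => g y a b) z)) := by
    intro a b
    simp only [← hs.chr_lower hz, lower, Fin.sum_univ_two]
    ring
  have h3 := hs.symm z hz 1 0
  have h4 : ∀ v : ℝ × Plane, _ := fun v => hs.dirD_symm (v := v) hz 1 0
  simp only [cov, h1, h2]
  fin_cases a <;> fin_cases b <;>
    simp only [Fin.sum_univ_two, Fin.isValue, Fin.zero_eta, Fin.mk_one, h3, h4] <;> ring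

lemma extr_symm (hz : z ∈ U) (a b : Fin 2) : extr g N n z a b = extr g N n z b a := by
  simp only [extr, Matrix.of_apply, hs.dirD_symm hz a b]
  ring

/-- The time derivative of the metric. -/
lemma dirD_vt_metric (hz : z ∈ U) (a b : Fin 2) :
    dirD vt (fun y => g y a b) z = -(2 * N z * extr g N n z a b)
      + ∑ c, (n c z * dirD (vx c) (fun y => g y a b) z + g z c b * dirD (vx a) (n c) z
        + g z a c * dirD (vx b) (n c) z) := by
  have hN := (hs.lapse_pos z hz).ne'
  rw [← hs.cov_lower_add hz]
  simp only [extr, Matrix.of_apply]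
  field_simp
  ring

/-- The evolution of the inverse metric. -/
lemma dNorm_inv (hz : z ∈ U) (a b : Fin 2) :
    dNorm n (fun y => (g y)⁻¹ a b) z = 2 * N z * raise g (extr g N n) a b z
      - ∑ c, (g z)⁻¹ c b * dirD (vx c) (n a) z - ∑ c, (g z)⁻¹ a c * dirD (vx c) (n b) z := by
  have h3 := hs.inv_symm hz 1 0
  have e : ∀ a b, (g z)⁻¹ a 0 * g z 0 b + (g z)⁻¹ a 1 * g z 1 b = if a = b then 1 else 0 :=
    fun a b => by rw [← hs.inv_mul hz a b, Fin.sum_univ_two]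
  have e' : ∀ a b, g z a 0 * (g z)⁻¹ 0 b + g z a 1 * (g z)⁻¹ 1 b = if a = b then 1 else 0 := by
    intro a b
    have := congrFun (congrFun (Matrix.mul_nonsing_inv _ (hs.isUnit_det hz)) a) b
    rwa [Matrix.mul_apply, Fin.sum_univ_two, Matrix.one_apply] at this
  -- The ∂ν terms of ∂_t g with both indices raised: in each, the factor g meets one of the two
  -- inverse metrics and contracts to δ.
  have key : ∑ c, ∑ d, (g z)⁻¹ a c * (∑ e, (g z e d * dirD (vx c) (n e) z
        + g z c e * dirD (vx d) (n e) z)) * (g z)⁻¹ d b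
      = ∑ c, (g z)⁻¹ a c * dirD (vx c) (n b) z + ∑ c, (g z)⁻¹ c b * dirD (vx c) (n a) z := by
    have s1 : ∑ c, ∑ d, (g z)⁻¹ a c * (∑ e, (g z e d * dirD (vx c) (n e) z
        + g z c e * dirD (vx d) (n e) z)) * (g z)⁻¹ d b
        = ∑ c, (g z)⁻¹ a c * ∑ e, dirD (vx c) (n e) z * (g z e 0 * (g z)⁻¹ 0 b
            + g z e 1 * (g z)⁻¹ 1 b)
          + ∑ d, (g z)⁻¹ d b * ∑ e, dirD (vx d) (n e) z * ((g z)⁻¹ a 0 * g z 0 e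
            + (g z)⁻¹ a 1 * g z 1 e) := by
      simp only [Fin.sum_univ_two]
      ring
    rw [s1]
    simp only [e, e', mul_ite, mul_one, mul_zero, Finset.sum_ite_eq, Finset.sum_ite_eq',
      Finset.mem_univ, if_true]
  simp only [dNorm, hs.dirD_inv hz, hs.dirD_vt_metric hz]
  have s2 : ∑ c, (g z)⁻¹ c b * dirD (vx c) (n a) z + ∑ c, (g z)⁻¹ a c * dirD (vx c) (n b) z
      = _ := (add_comm _ _).trans key.symm
  rw [sub_sub, s2, raise]
  have h5 : ∀ c, (g z)⁻¹ b c = (g z)⁻¹ c b := fun c => hs.inv_symm hz b c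
  simp only [Fin.sum_univ_two, h5]
  ring

variable {τ : ℝ}

/-- The evolution of the area density. -/
lemma dNorm_logDensity (hz : z ∈ U) (hτ : ∑ a, ∑ b, (g z)⁻¹ a b * extr g N n z a b = τ) :
    dNorm n (logDensity g) z = -(N z * τ) + ∑ c, dirD (vx c) (n c) z := by
  have e : ∀ a b, (g z)⁻¹ a 0 * g z 0 b + (g z)⁻¹ a 1 * g z 1 b = if a = b then 1 else 0 :=
    fun a b => by rw [← hs.inv_mul hz a b, Fin.sum_univ_two]
  have e0 := e 0 0
  have e1 := e 0 1
  have e2 := e 1 0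
  have e3 := e 1 1
  simp at e0 e1 e2 e3
  have h3 := hs.inv_symm hz 1 0
  have h4 := hs.symm z hz 1 0
  simp only [dNorm, hs.dirD_logDensity hz, hs.dirD_vt_metric hz, ← hτ]
  simp only [Fin.sum_univ_two, h3, h4] at e0 e1 e2 e3 ⊢
  linear_combination dirD (vx 0) (n 0) z * e0 + dirD (vx 1) (n 0) z * e2
    + dirD (vx 0) (n 1) z * e1 + dirD (vx 1) (n 1) z * e3

/-- The Lie derivative of a gradient. -/
lemma lieVec_grd {f : ℝ × Plane → ℝ} (hf : ContDiffOn ℝ 2 f U) (hz : z ∈ U) (a : Fin 2) :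
    lieVec n (grd g f) a z = ∑ b, 2 * N z * raise g (extr g N n) a b z * dirD (vx b) f z
      + grd g (dNorm n f) a z := by
  have hfd : ∀ v, DifferentiableAt ℝ (dirD v f) z := fun v =>
    (contDiffOn_dirD (n := 1) hf hs.isOpen (by norm_num) _).differentiableAt_of_isOpen
      hs.isOpen (by norm_num) hz
  have hc : ∀ v w, dirD v (dirD w f) z = dirD w (dirD v f) z := fun v w =>
    dirD_comm (hf.contDiffAt (hs.isOpen.mem_nhds hz))
  have h1 : dNorm n (grd g f a) z = ∑ b, (dNorm n (fun y => (g y)⁻¹ a b) z * dirD (vx b) f z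
      + (g z)⁻¹ a b * dNorm n (dirD (vx b) f) z) := by
    rw [show grd g f a = fun y => ∑ b, (g y)⁻¹ a b * dirD (vx b) f y from rfl,
      dNorm_sum _ fun b _ => (hs.diff_inv hz a b).fun_mul (hfd _)]
    exact Finset.sum_congr rfl fun b _ => dNorm_mul (hs.diff_inv hz a b) (hfd _)
  have h2 : ∀ v, dirD v (dNorm n f) z = dirD v (dirD vt f) z
      - ∑ c, (dirD v (n c) z * dirD (vx c) f z + n c z * dirD v (dirD (vx c) f) z) := by
    intro v
    rw [← dirD_sum_mul _ (fun c _ => hs.diff_shift hz c) fun c _ => hfd _]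
    exact dirD_sub (hfd _) (DifferentiableAt.fun_sum fun c _ => (hs.diff_shift hz c).fun_mul (hfd _))
  -- Of the two ∂ν terms in the evolution of g⁻¹, one cancels against the ∂ν term of `lieVec`, the
  -- other against the commutator of ∂_b with ∂₀.
  simp only [lieVec, h1, grd, h2, hs.dNorm_inv hz]
  simp only [dNorm, Fin.sum_univ_two, hc vt, hc (vx 1) (vx 0)]
  have h3 := hs.inv_symm hz 1 0
  fin_cases a <;> simp only [Fin.isValue, Fin.zero_eta, Fin.mk_one, h3] <;> ring

/-- The evolution of a divergence. -/
lemma dNorm_dvg {X : Fin 2 → ℝ × Plane → ℝ} (hX : ∀ a, ContDiffOn ℝ 2 (X a) U) (hz : z ∈ U)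
    {T : ℝ × Plane → ℝ} (hTd : DifferentiableAt ℝ T z) (hT0 : ∀ a, dirD (vx a) T z = 0)
    (hT : ∀ z ∈ U, ∑ a, ∑ b, (g z)⁻¹ a b * extr g N n z a b = T z) :
    dNorm n (dvg g X) z = dvg g (lieVec n X) z - T z * ∑ a, X a z * dirD (vx a) N z := by
  have hd : ∀ {f : ℝ × Plane → ℝ}, ContDiffOn ℝ 2 f U → ∀ v, DifferentiableAt ℝ (dirD v f) z :=
    fun hf v => (contDiffOn_dirD (n := 1) hf hs.isOpen (by norm_num) _).differentiableAt_of_isOpen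
      hs.isOpen (by norm_num) hz
  have hd0 : ∀ {f : ℝ × Plane → ℝ}, ContDiffOn ℝ 2 f U → DifferentiableAt ℝ f z :=
    fun hf => hf.differentiableAt_of_isOpen hs.isOpen (by norm_num) hz
  have hc : ∀ {f : ℝ × Plane → ℝ}, ContDiffOn ℝ 2 f U → ∀ v w,
      dirD v (dirD w f) z = dirD w (dirD v f) z := fun hf v w =>
    dirD_comm (hf.contDiffAt (hs.isOpen.mem_nhds hz))
  have hL := hs.contDiff_logDensity
  have hn := hs.contDiff_shift
  have hdn : ∀ {f : ℝ × Plane → ℝ}, ContDiffOn ℝ 2 f U → DifferentiableAt ℝ (dNorm n f) z :=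
    fun hf => (hd hf _).fun_sub
      (DifferentiableAt.fun_sum fun c _ => (hd0 (hn c)).fun_mul (hd hf _))
  have h2 : ∀ {f : ℝ × Plane → ℝ}, ContDiffOn ℝ 2 f U → ∀ v, dirD v (dNorm n f) z
      = dirD v (dirD vt f) z
        - ∑ c, (dirD v (n c) z * dirD (vx c) f z + n c z * dirD v (dirD (vx c) f) z) := by
    intro f hf v
    rw [← dirD_sum_mul _ (fun c _ => hs.diff_shift hz c) fun c _ => hd hf _]
    exact dirD_sub (hd hf _)
      (DifferentiableAt.fun_sum fun c _ => (hs.diff_shift hz c).fun_mul (hd hf _))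
  -- The constancy of the mean curvature on the slice enters here: the gradient of NT reduces to T
  -- ∂_a N, which is the correction term of the lemma.
  have h3 : ∀ a, dirD (vx a) (dNorm n (logDensity g)) z
      = -(dirD (vx a) N z * T z) + ∑ c, dirD (vx c) (dirD (vx a) (n c)) z := by
    intro a
    rw [dirD_congr_of_eqOn hs.isOpen hz fun y hy => hs.dNorm_logDensity hy (hT y hy)]
    rw [dirD_add ((hs.diff_lapse hz).fun_mul hTd).fun_neg
      (DifferentiableAt.fun_sum fun c _ => hd (hn c) _), dirD_neg,
      dirD_mul (hs.diff_lapse hz) hTd, hT0, dirD_sum _ fun c _ => hd (hn c) _]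
    simp only [hc (hn _) (vx a), mul_zero, add_zero]
  have h4 : dNorm n (dvg g X) z = ∑ a, (dNorm n (dirD (vx a) (X a)) z
      + (dNorm n (dirD (vx a) (logDensity g)) z * X a z
        + dirD (vx a) (logDensity g) z * dNorm n (X a) z)) := by
    rw [show dvg g X = fun y => ∑ a, (dirD (vx a) (X a) y + dirD (vx a) (logDensity g) y * X a y)
      from rfl, dNorm_sum _ fun a _ => (hd (hX a) _).fun_add ((hd hL _).fun_mul (hd0 (hX a)))]
    refine Finset.sum_congr rfl fun a _ => ?_
    rw [dNorm_add (hd (hX a) _) ((hd hL _).fun_mul (hd0 (hX a))), dNorm_mul (hd hL _) (hd0 (hX a))]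
  have h5 : ∀ a, dirD (vx a) (lieVec n X a) z = dirD (vx a) (dNorm n (X a)) z
      + ∑ c, (dirD (vx a) (X c) z * dirD (vx c) (n a) z
        + X c z * dirD (vx a) (dirD (vx c) (n a)) z) := by
    intro a
    rw [show lieVec n X a = fun z => dNorm n (X a) z + ∑ c, X c z * dirD (vx c) (n a) z from rfl,
      dirD_add (hdn (hX a)) (DifferentiableAt.fun_sum fun c _ => (hd0 (hX c)).fun_mul (hd (hn a) _)),
      dirD_sum_mul _ (fun c _ => hd0 (hX c)) fun c _ => hd (hn a) _]
  rw [h4]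
  simp only [dvg, h5, h2 (hX _)]
  -- Two expressions for ∂_a ∂₀ log √(det g), one from commuting derivatives and one from the
  -- evolution of the density. Their equality is all that is needed besides symmetry of second
  -- derivatives.
  have h6 := fun a => (h2 hL (vx a)).symm.trans (h3 a)
  have h60 := h6 0
  have h61 := h6 1
  simp only [dNorm, lieVec, Fin.sum_univ_two, hc (hX _) vt, hc hL vt, hc hL (vx 1) (vx 0),
    hc (hX _) (vx 1) (vx 0), hc (hn _) (vx 1) (vx 0)] at h60 h61 ⊢
  linear_combination X 0 z * h60 + X 1 z * h61

end IsSlicingOn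

/-! ### The local energy identity -/

section LocalEnergy

variable (g : ℝ × Plane → Matrix (Fin 2) (Fin 2) ℝ) (N : ℝ × Plane → ℝ)
  (n : Fin 2 → ℝ × Plane → ℝ)

/-- The double contraction `T^{ab} ∂_a f₁ ∂_b f₂`. -/
def tenGrad (T : ℝ × Plane → Matrix (Fin 2) (Fin 2) ℝ) (f₁ f₂ : ℝ × Plane → ℝ)
    (z : ℝ × Plane) : ℝ :=
  ∑ a, ∑ b, raise g T a b z * dirD (vx a) f₁ z * dirD (vx b) f₂ z

/-- The double contraction `T^{ab} ∇_a ∂_b f`. -/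
def tenHess (T : ℝ × Plane → Matrix (Fin 2) (Fin 2) ℝ) (f : ℝ × Plane → ℝ)
    (z : ℝ × Plane) : ℝ :=
  ∑ a, ∑ b, raise g T a b z * cov g (fun c => dirD (vx c) f) a b z

/-- The trace of a 2-tensor. -/
def trc (T : ℝ × Plane → Matrix (Fin 2) (Fin 2) ℝ) (z : ℝ × Plane) : ℝ :=
  ∑ a, ∑ b, (g z)⁻¹ a b * T z a b

/-- The traceless part of a 2-tensor. -/
def traceless (T : ℝ × Plane → Matrix (Fin 2) (Fin 2) ℝ) (z : ℝ × Plane) :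
    Matrix (Fin 2) (Fin 2) ℝ :=
  Matrix.of fun a b => T z a b - (1 / 2) * g z a b * trc g T z

/-- The divergence of a 2-tensor. -/
def dvgT (T : ℝ × Plane → Matrix (Fin 2) (Fin 2) ℝ) (a : Fin 2) (z : ℝ × Plane) : ℝ :=
  ∑ b, ∑ c, (g z)⁻¹ b c * covT g T c a b z

/-- The normal derivative `N⁻¹ (∂_t f - ν^a ∂_a f)`. -/
def prm (f : ℝ × Plane → ℝ) (z : ℝ × Plane) : ℝ := (N z)⁻¹ * dNorm n f z

/-- The energy density `J₀ = ½ |Du'|²`. -/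
def locJ0 (u : ℝ × Plane → ℝ) (z : ℝ × Plane) : ℝ :=
  (1 / 2) * dot 1 (grdInner g (prm N n u) (prm N n u) z)

/-- The energy density `J₁ = ½ |Δu|²`. -/
def locJ1 (u : ℝ × Plane → ℝ) (z : ℝ × Plane) : ℝ := (1 / 2) * dot (lapl g u z) (lapl g u z)

/-- The integrand of `Y₁`. -/
def locY1 (u : ℝ × Plane → ℝ) (z : ℝ × Plane) : ℝ :=
  dot (2 * tenGrad g (traceless g (extr g N n)) N u z
      - 2 * N z * dot (grdInner g u u z) (prm N n u z)
      + 2 * grdInner g N (prm N n u) z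
      + prm N n u z * lapl g N z)
    (lapl g u z)

/-- The integrand of `Z`. -/
def locZ (T : ℝ × Plane → ℝ) (u : ℝ × Plane → ℝ) (z : ℝ × Plane) : ℝ :=
  N z * dot 1 (tenGrad g (traceless g (extr g N n)) (prm N n u) (prm N n u) z)
    + 2 * N z * dot (tenHess g (traceless g (extr g N n)) u z) (lapl g u z)
    + dot 1 (grdInner g (grdInner g N u) (prm N n u) z)
    + T z * dot (prm N n u z) (grdInner g N (prm N n u) z)
    + locY1 g N n u z

/-- The vector field whose divergence is the exact part of the energy identity. -/
def flux (u : ℝ × Plane → ℝ) (a : Fin 2) (z : ℝ × Plane) : ℝ :=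
  (locJ0 g N n u z + locJ1 g u z) * n a z
    + (2 * (N z * lapl g u z)) * grd g (prm N n u) a z

end LocalEnergy

lemma dvg_add {g : ℝ × Plane → Matrix (Fin 2) (Fin 2) ℝ} {z : ℝ × Plane}
    {X Y : Fin 2 → ℝ × Plane → ℝ} (hX : ∀ a, DifferentiableAt ℝ (X a) z)
    (hY : ∀ a, DifferentiableAt ℝ (Y a) z) :
    dvg g (fun a y => X a y + Y a y) z = dvg g X z + dvg g Y z := by
  simp only [dvg, dirD_add (hX _) (hY _), Fin.sum_univ_two]
  ring

/-! ### Gradients, Laplacians and divergences on a slice, and the traceless part. -/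

namespace IsMetricOn

variable {U : Set (ℝ × Plane)} {g : ℝ × Plane → Matrix (Fin 2) (Fin 2) ℝ} {z : ℝ × Plane}

variable (hg : IsMetricOn U g)
include hg

lemma dvg_congr {X Y : Fin 2 → ℝ × Plane → ℝ} (h : ∀ a, Set.EqOn (X a) (Y a) U) (hz : z ∈ U) :
    dvg g X z = dvg g Y z := by
  simp only [dvg, fun a => dirD_congr_of_eqOn (v := vx a) hg.isOpen hz (h a), fun a => h a hz]

lemma contDiff_grd {k : WithTop ℕ∞} {f : ℝ × Plane → ℝ} (hk : k ≤ 2)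
    (hf : ContDiffOn ℝ (k + 1) f U) (a : Fin 2) : ContDiffOn ℝ k (grd g f a) U :=
  ContDiffOn.sum fun b _ => ((hg.contDiff_inv a b).of_le hk).mul
    (contDiffOn_dirD hf hg.isOpen le_rfl _)

lemma contDiff_grdInner {f₁ f₂ : ℝ × Plane → ℝ} (h₁ : ContDiffOn ℝ 2 f₁ U)
    (h₂ : ContDiffOn ℝ 2 f₂ U) : ContDiffOn ℝ 1 (grdInner g f₁ f₂) U :=
  ContDiffOn.sum fun a _ => ContDiffOn.sum fun b _ =>
    (((hg.contDiff_inv a b).of_le (by norm_num)).mul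
      (contDiffOn_dirD h₁ hg.isOpen (by norm_num) _)).mul
        (contDiffOn_dirD h₂ hg.isOpen (by norm_num) _)

lemma contDiff_cov {k : WithTop ℕ∞} (hk : k ≤ 1) {w : Fin 2 → ℝ × Plane → ℝ}
    (hw : ∀ a, ContDiffOn ℝ (k + 1) (w a) U) (a b : Fin 2) : ContDiffOn ℝ k (cov g w a b) U :=
  (contDiffOn_dirD (hw b) hg.isOpen le_rfl _).sub (ContDiffOn.sum fun c _ =>
    ((hg.contDiff_chr c a b).of_le hk).mul ((hw c).of_le le_self_add))

lemma contDiff_lapl {k : WithTop ℕ∞} (hk : k ≤ 1) {f : ℝ × Plane → ℝ}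
    (hf : ContDiffOn ℝ (k + 1 + 1) f U) : ContDiffOn ℝ k (lapl g f) U :=
  ContDiffOn.sum fun a _ => ContDiffOn.sum fun b _ =>
    ((hg.contDiff_inv a b).of_le (hk.trans (by norm_num))).mul
      (hg.contDiff_cov hk (fun _ => contDiffOn_dirD hf hg.isOpen le_rfl _) a b)

lemma grdInner_comm (hz : z ∈ U) (f₁ f₂ : ℝ × Plane → ℝ) :
    grdInner g f₁ f₂ z = grdInner g f₂ f₁ z := by
  simp only [grdInner, Fin.sum_univ_two, hg.inv_symm hz 1 0]
  ring

lemma sum_grd_mul (hz : z ∈ U) (f₁ f₂ : ℝ × Plane → ℝ) :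
    ∑ a, grd g f₁ a z * dirD (vx a) f₂ z = grdInner g f₁ f₂ z := by
  simp only [grd, grdInner, Fin.sum_univ_two, hg.inv_symm hz 1 0]
  ring

/-- Meant for ∂₀u = N u': it produces the terms 2 ∂^a N ∂_a u' and u' Δ_g N of Y₁. -/
lemma lapl_mul {f₁ f₂ : ℝ × Plane → ℝ} (h₁ : ContDiffOn ℝ 2 f₁ U) (h₂ : ContDiffOn ℝ 2 f₂ U)
    (hz : z ∈ U) : lapl g (fun y => f₁ y * f₂ y) z
      = f₁ z * lapl g f₂ z + 2 * grdInner g f₁ f₂ z + f₂ z * lapl g f₁ z := by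
  have hd : ∀ {f : ℝ × Plane → ℝ}, ContDiffOn ℝ 2 f U → ∀ y ∈ U, DifferentiableAt ℝ f y :=
    fun hf y hy => hf.differentiableAt_of_isOpen hg.isOpen (by norm_num) hy
  have hdd : ∀ {f : ℝ × Plane → ℝ}, ContDiffOn ℝ 2 f U → ∀ v, DifferentiableAt ℝ (dirD v f) z :=
    fun hf v => (contDiffOn_dirD (n := 1) hf hg.isOpen (by norm_num) _).differentiableAt_of_isOpen
      hg.isOpen (by norm_num) hz
  have e1 : ∀ v, dirD v (fun y => f₁ y * f₂ y) z = _ := fun v => dirD_mul (hd h₁ z hz) (hd h₂ z hz)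
  have e2 : ∀ v w, dirD w (dirD v (fun y => f₁ y * f₂ y)) z
      = dirD w (dirD v f₁) z * f₂ z + dirD v f₁ z * dirD w f₂ z
        + (dirD w f₁ z * dirD v f₂ z + f₁ z * dirD w (dirD v f₂) z) := by
    intro v w
    rw [dirD_congr_of_eqOn hg.isOpen hz fun y hy => dirD_mul (hd h₁ y hy) (hd h₂ y hy),
      dirD_add ((hdd h₁ v).fun_mul (hd h₂ z hz)) ((hd h₁ z hz).fun_mul (hdd h₂ v)),
      dirD_mul (hdd h₁ v) (hd h₂ z hz), dirD_mul (hd h₁ z hz) (hdd h₂ v)]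
  simp only [lapl, cov, grdInner, e1, e2, Fin.sum_univ_two, hg.inv_symm hz 1 0]
  ring

lemma raise_metric (hz : z ∈ U) (a b : Fin 2) :
    ∑ c, ∑ d, (g z)⁻¹ a c * (g z)⁻¹ b d * g z c d = (g z)⁻¹ a b := by
  have h : ∀ c, ∑ d, (g z)⁻¹ b d * g z d c = if b = c then 1 else 0 := hg.inv_mul hz b
  calc ∑ c, ∑ d, (g z)⁻¹ a c * (g z)⁻¹ b d * g z c d
      = ∑ c, (g z)⁻¹ a c * ∑ d, (g z)⁻¹ b d * g z d c := by
        refine Finset.sum_congr rfl fun c _ => ?_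
        rw [Finset.mul_sum]
        refine Finset.sum_congr rfl fun d _ => ?_
        rw [hg.symm z hz c d, mul_assoc]
    _ = _ := by simp [h]

/-- Raising both indices of g gives g⁻¹. Hence each contraction with k is one with h plus ½ τ times
a gradient product or a Laplacian, and this is how the explicit multiples of τ arise. -/
lemma raise_traceless (hz : z ∈ U) (T : ℝ × Plane → Matrix (Fin 2) (Fin 2) ℝ) (a b : Fin 2) :
    raise g (traceless g T) a b z = raise g T a b z - (1 / 2) * trc g T z * (g z)⁻¹ a b := by
  rw [← hg.raise_metric hz a b]
  simp only [raise, traceless, Matrix.of_apply, Fin.sum_univ_two]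
  ring

lemma tenGrad_traceless (hz : z ∈ U) (T : ℝ × Plane → Matrix (Fin 2) (Fin 2) ℝ)
    (f₁ f₂ : ℝ × Plane → ℝ) : tenGrad g (traceless g T) f₁ f₂ z
      = tenGrad g T f₁ f₂ z - (1 / 2) * trc g T z * grdInner g f₁ f₂ z := by
  simp only [tenGrad, grdInner, hg.raise_traceless hz, Fin.sum_univ_two]
  ring

lemma tenHess_traceless (hz : z ∈ U) (T : ℝ × Plane → Matrix (Fin 2) (Fin 2) ℝ)
    (f : ℝ × Plane → ℝ) : tenHess g (traceless g T) f z
      = tenHess g T f z - (1 / 2) * trc g T z * lapl g f z := by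
  simp only [tenHess, lapl, hg.raise_traceless hz, Fin.sum_univ_two]
  ring

/-- The divergence of a symmetric 2-tensor applied to a gradient. -/
lemma dvg_raise {T : ℝ × Plane → Matrix (Fin 2) (Fin 2) ℝ}
    (hT : ∀ a b, DifferentiableAt ℝ (fun y => T y a b) z)
    (hTs : ∀ y ∈ U, ∀ a b, T y a b = T y b a) {f : ℝ × Plane → ℝ} (hf : ContDiffOn ℝ 2 f U)
    (hz : z ∈ U) :
    dvg g (fun a y => ∑ b, raise g T a b y * dirD (vx b) f y) z
      = ∑ a, dvgT g T a z * grd g f a z + tenHess g T f z := by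
  have hfd : ∀ v, DifferentiableAt ℝ (dirD v f) z := fun v =>
    (contDiffOn_dirD (n := 1) hf hg.isOpen (by norm_num) _).differentiableAt_of_isOpen
      hg.isOpen (by norm_num) hz
  have hi := hg.diff_inv hz
  have hr1 : ∀ a b c d, DifferentiableAt ℝ
      (fun y => (g y)⁻¹ a c * (g y)⁻¹ b d * T y c d) z := fun a b c d =>
    ((hi a c).fun_mul (hi b d)).fun_mul (hT c d)
  have hr : ∀ a b, DifferentiableAt ℝ (raise g T a b) z := fun a b =>
    DifferentiableAt.fun_sum fun c _ => DifferentiableAt.fun_sum fun d _ => hr1 a b c d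
  have er : ∀ v a b, dirD v (raise g T a b) z = ∑ c, ∑ d,
      ((dirD v (fun y => (g y)⁻¹ a c) z * (g z)⁻¹ b d
        + (g z)⁻¹ a c * dirD v (fun y => (g y)⁻¹ b d) z) * T z c d
        + (g z)⁻¹ a c * (g z)⁻¹ b d * dirD v (fun y => T y c d) z) := by
    intro v a b
    rw [show raise g T a b = fun y => ∑ c, ∑ d, (g y)⁻¹ a c * (g y)⁻¹ b d * T y c d from rfl,
      dirD_sum _ fun c _ => DifferentiableAt.fun_sum fun d _ => hr1 a b c d]
    refine Finset.sum_congr rfl fun c _ => ?_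
    rw [dirD_sum _ fun d _ => hr1 a b c d]
    refine Finset.sum_congr rfl fun d _ => ?_
    rw [dirD_mul ((hi a c).fun_mul (hi b d)) (hT c d), dirD_mul (hi a c) (hi b d)]
  have eT : ∀ v, dirD v (fun y => T y 1 0) z = dirD v (fun y => T y 0 1) z := fun v =>
    dirD_congr_of_eqOn hg.isOpen hz fun y hy => hTs y hy 1 0
  have e1 : ∀ a, dirD (vx a) (fun y => ∑ b, raise g T a b y * dirD (vx b) f y) z = _ := fun a =>
    dirD_sum_mul (v := vx a) Finset.univ (fun b _ => hr a b) (fun b _ => hfd _)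
  simp only [dvg, e1, er]
  -- Every metric derivative is now a Christoffel symbol, and the claim is a polynomial identity.
  simp only [hg.dirD_logDensity_chr hz, hg.dirD_inv_chr hz, dvgT, covT, tenHess, raise, grd, cov,
    Fin.sum_univ_two, hg.inv_symm hz 1 0, hTs z hz 1 0, eT, hg.chr_symm hz _ 1 0]
  ring

end IsMetricOn

/-! ### Evolution of |Df|² and Δf, and the pointwise energy identity. -/

namespace IsSlicingOn

variable {U : Set (ℝ × Plane)} {g : ℝ × Plane → Matrix (Fin 2) (Fin 2) ℝ}
  {N : ℝ × Plane → ℝ} {n : Fin 2 → ℝ × Plane → ℝ} {z : ℝ × Plane}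
  (hs : IsSlicingOn U g N n)
include hs

lemma contDiff_dNorm {k : WithTop ℕ∞} (hk : k ≤ 2) {f : ℝ × Plane → ℝ}
    (hf : ContDiffOn ℝ (k + 1) f U) : ContDiffOn ℝ k (dNorm n f) U :=
  (contDiffOn_dirD hf hs.isOpen le_rfl _).sub (ContDiffOn.sum fun c _ =>
    ((hs.contDiff_shift c).of_le hk).mul (contDiffOn_dirD hf hs.isOpen le_rfl _))

lemma contDiff_prm {k : WithTop ℕ∞} (hk : k ≤ 2) {f : ℝ × Plane → ℝ}
    (hf : ContDiffOn ℝ (k + 1) f U) : ContDiffOn ℝ k (prm N n f) U :=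
  ((hs.contDiff_lapse.inv fun y hy => (hs.lapse_pos y hy).ne').of_le hk).mul
    (hs.contDiff_dNorm hk hf)

lemma contDiff_extr (a b : Fin 2) : ContDiffOn ℝ 1 (fun y => extr g N n y a b) U := by
  have hl : ∀ a, ContDiffOn ℝ 2 (lower g n a) U := fun a => ContDiffOn.sum fun b _ =>
    (hs.contDiff a b).mul (hs.contDiff_shift b)
  have hc := hs.contDiff_cov (k := 1) le_rfl (w := lower g n) fun a => (hl a).of_le (by norm_num)
  have hN : ContDiffOn ℝ 1 (fun y => (2 * N y)⁻¹) U :=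
    ((contDiffOn_const.mul hs.contDiff_lapse).inv fun y hy =>
      mul_ne_zero two_ne_zero (hs.lapse_pos y hy).ne').of_le (by norm_num)
  exact hN.mul (((contDiffOn_dirD (hs.contDiff a b) hs.isOpen (by norm_num) _).neg.add
    (hc a b)).add (hc b a))

/-- The evolution of `|Df|²`. -/
lemma dNorm_grdInner {f : ℝ × Plane → ℝ} (hf : ContDiffOn ℝ 2 f U) (hz : z ∈ U) :
    dNorm n (grdInner g f f) z = 2 * N z * tenGrad g (extr g N n) f f z
      + 2 * grdInner g f (dNorm n f) z := by
  have hfd : ∀ v, DifferentiableAt ℝ (dirD v f) z := fun v =>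
    (contDiffOn_dirD (n := 1) hf hs.isOpen (by norm_num) _).differentiableAt_of_isOpen
      hs.isOpen (by norm_num) hz
  have hgd : ∀ a, DifferentiableAt ℝ (grd g f a) z := fun a =>
    (hs.contDiff_grd (k := 1) (by norm_num) (hf.of_le (by norm_num)) a).differentiableAt_of_isOpen
      hs.isOpen (by norm_num) hz
  have hc : ∀ v w, dirD v (dirD w f) z = dirD w (dirD v f) z := fun v w =>
    dirD_comm (hf.contDiffAt (hs.isOpen.mem_nhds hz))
  have h1 : dNorm n (grdInner g f f) z
      = ∑ a, (dNorm n (grd g f a) z * dirD (vx a) f z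
        + grd g f a z * dNorm n (dirD (vx a) f) z) := by
    rw [show dNorm n (grdInner g f f) z
      = dNorm n (fun y => ∑ a, grd g f a y * dirD (vx a) f y) z by
        have e : Set.EqOn (grdInner g f f) (fun y => ∑ a, grd g f a y * dirD (vx a) f y) U :=
          fun y hy => (hs.sum_grd_mul hy f f).symm
        simp only [dNorm, dirD_congr_of_eqOn hs.isOpen hz e],
      dNorm_sum _ fun a _ => (hgd a).fun_mul (hfd _)]
    exact Finset.sum_congr rfl fun a _ => dNorm_mul (hgd a) (hfd _)
  have h2 : ∀ v, dirD v (dNorm n f) z = dirD v (dirD vt f) z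
      - ∑ c, (dirD v (n c) z * dirD (vx c) f z + n c z * dirD v (dirD (vx c) f) z) := by
    intro v
    rw [← dirD_sum_mul _ (fun c _ => hs.diff_shift hz c) fun c _ => hfd _]
    exact dirD_sub (hfd _) (DifferentiableAt.fun_sum fun c _ => (hs.diff_shift hz c).fun_mul (hfd _))
  -- This determines ∂₀ of the gradient up to X^c ∂_c ν^a, and that term cancels against the
  -- commutator of ∂₀ and ∂_a applied to f.
  have h3 := fun a => hs.lieVec_grd hf hz a
  have h30 := h3 0
  have h31 := h3 1
  rw [h1, ← hs.sum_grd_mul hz]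
  simp only [h2]
  simp only [lieVec, tenGrad, Fin.sum_univ_two] at h30 h31 ⊢
  have h4 : ∀ a, grd g (dNorm n f) a z = (g z)⁻¹ a 0 * dirD (vx 0) (dNorm n f) z
      + (g z)⁻¹ a 1 * dirD (vx 1) (dNorm n f) z := fun a => Fin.sum_univ_two _
  have h5 : ∀ a, grd g f a z = (g z)⁻¹ a 0 * dirD (vx 0) f z
      + (g z)⁻¹ a 1 * dirD (vx 1) f z := fun a => Fin.sum_univ_two _
  have h6 := h2 (vx 0)
  have h7 := h2 (vx 1)
  rw [h4] at h30 h31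
  simp only [Fin.sum_univ_two, h6, h7] at h30 h31
  have h8 : ∀ w, dNorm n (dirD (vx w) f) z = dirD (vx w) (dirD vt f) z
      - (n 0 z * dirD (vx w) (dirD (vx 0) f) z + n 1 z * dirD (vx w) (dirD (vx 1) f) z) := by
    intro w
    simp only [dNorm, Fin.sum_univ_two, hc vt]
    rw [hc (vx w) (vx 0), hc (vx w) (vx 1)]
  simp only [h8]
  simp only [h5, hs.inv_symm hz 1 0] at h30 h31 ⊢
  linear_combination dirD (vx 0) f z * h30 + dirD (vx 1) f z * h31

/-- The evolution of the Laplacian of a function. -/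
lemma dNorm_lapl {f : ℝ × Plane → ℝ} (hf : ContDiffOn ℝ 3 f U) (hz : z ∈ U)
    (hT0 : ∀ a, dirD (vx a) (trc g (extr g N n)) z = 0) :
    dNorm n (lapl g f) z = lapl g (dNorm n f) z + 2 * tenGrad g (extr g N n) N f z
      + 2 * N z * (∑ a, dvgT g (extr g N n) a z * grd g f a z)
      + 2 * N z * tenHess g (extr g N n) f z
      - trc g (extr g N n) z * grdInner g N f z := by
  have hf2 : ContDiffOn ℝ 2 f U := hf.of_le (by norm_num)
  -- The C³ regularity of f is spent here: `dNorm_dvg` takes a C² vector field.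
  have hgd := hs.contDiff_grd (k := 2) le_rfl (hf.of_le (by norm_num))
  have hdn : ContDiffOn ℝ 2 (dNorm n f) U := hs.contDiff_dNorm le_rfl (hf.of_le (by norm_num))
  have hk := fun a b => (hs.contDiff_extr a b).differentiableAt_of_isOpen hs.isOpen (by norm_num) hz
  have htd : DifferentiableAt ℝ (trc g (extr g N n)) z :=
    DifferentiableAt.fun_sum fun a _ => DifferentiableAt.fun_sum fun b _ =>
      (hs.diff_inv hz a b).fun_mul (hk a b)
  -- With Δ = div grad, ∂₀ passes through the divergence by `dNorm_dvg`; then `lieVec_grd` describes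
  -- the Lie derivative of the gradient and `dvg_raise` the divergence of k(grad f).
  have h1 : dNorm n (lapl g f) z = dNorm n (dvg g (grd g f)) z := by
    have e : Set.EqOn (lapl g f) (dvg g (grd g f)) U := fun y hy => (hs.dvg_grd hf2 hy).symm
    simp only [dNorm, dirD_congr_of_eqOn hs.isOpen hz e]
  have hr : ∀ a, DifferentiableAt ℝ
      (fun y => ∑ b, raise g (extr g N n) a b y * dirD (vx b) f y) z := fun a =>
    DifferentiableAt.fun_sum fun b _ => DifferentiableAt.fun_mul
      (DifferentiableAt.fun_sum fun c _ => DifferentiableAt.fun_sum fun d _ =>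
        ((hs.diff_inv hz a c).fun_mul (hs.diff_inv hz b d)).fun_mul (hk c d))
      ((contDiffOn_dirD (n := 1) hf2 hs.isOpen (by norm_num) _).differentiableAt_of_isOpen
        hs.isOpen (by norm_num) hz)
  have hN2 : DifferentiableAt ℝ (fun y => 2 * N y) z := (hs.diff_lapse hz).const_mul 2
  have h2 : dvg g (lieVec n (grd g f)) z
      = dvg g (fun a y => (2 * N y) * (∑ b, raise g (extr g N n) a b y * dirD (vx b) f y)
        + grd g (dNorm n f) a y) z := by
    refine hs.dvg_congr (fun a y hy => ?_) hz
    rw [hs.lieVec_grd hf2 hy, Finset.mul_sum]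
    simp only [mul_assoc]
  rw [h1, hs.dNorm_dvg hgd hz htd hT0 fun _ _ => rfl, h2,
    dvg_add (fun a => hN2.fun_mul (hr a)) (fun a =>
      (hs.contDiff_grd (k := 1) (by norm_num) (hdn.of_le (by norm_num)) a).differentiableAt_of_isOpen
        hs.isOpen (by norm_num) hz),
    dvg_mul hN2 hr, hs.dvg_raise hk (fun y hy => hs.extr_symm hy) hf2 hz, hs.dvg_grd hdn hz,
    hs.sum_grd_mul hz, hs.grdInner_comm hz f N]
  simp only [dirD_const_mul 2 (hs.diff_lapse hz), tenGrad, Fin.sum_univ_two]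
  ring

/-- The local form of the energy identity. -/
theorem local_energy {u T : ℝ × Plane → ℝ} (hu : ContDiffOn ℝ 3 u U)
    (hT0 : ∀ z ∈ U, ∀ a, dirD (vx a) (trc g (extr g N n)) z = 0)
    (hT : ∀ z ∈ U, trc g (extr g N n) z = T z)
    (hmom : ∀ z ∈ U, ∀ a, N z * -dvgT g (extr g N n) a z = dot (dNorm n u z) (dirD (vx a) u z))
    (hwave : ∀ z ∈ U, dNorm n (prm N n u) z
      = N z * lapl g u z + grdInner g N u z + T z * N z * prm N n u z)
    (hz : z ∈ U) :
    dirD vt (fun y => locJ0 g N n u y + locJ1 g u y) z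
      + (locJ0 g N n u z + locJ1 g u z) * dirD vt (logDensity g) z
      = 2 * T z * (locJ0 g N n u z + locJ1 g u z)
        + T z * (N z * locJ0 g N n u z + (N z - 2) * (locJ0 g N n u z + locJ1 g u z))
        + locZ g N n T u z + dvg g (flux g N n u) z := by
  set k := extr g N n with hk
  set p := prm N n u with hp
  set q := lapl g u with hq
  have dd : ∀ {f : ℝ × Plane → ℝ}, ContDiffOn ℝ 1 f U → DifferentiableAt ℝ f z := fun hf =>
    hf.differentiableAt_of_isOpen hs.isOpen (by norm_num) hz
  have hpC : ContDiffOn ℝ 2 p U := hs.contDiff_prm le_rfl (hu.of_le (by norm_num))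
  have hqC : ContDiffOn ℝ 1 q U := hs.contDiff_lapl le_rfl (hu.of_le (by norm_num))
  have hpd := dd (hpC.of_le (by norm_num))
  have hqd := dd hqC
  have hNd := hs.diff_lapse hz
  have hu2 : ContDiffOn ℝ 2 u U := hu.of_le (by norm_num)
  have hi1 := dd (hs.contDiff_grdInner hpC hpC)
  have hi2 := dd (hs.contDiff_grdInner hs.contDiff_lapse hu2)
  have hkd := fun a b => dd (hs.contDiff_extr a b)
  have htd : DifferentiableAt ℝ (trc g k) z :=
    DifferentiableAt.fun_sum fun a _ => DifferentiableAt.fun_sum fun b _ =>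
      (hs.diff_inv hz a b).fun_mul (hkd a b)
  have hgp : ∀ a, DifferentiableAt ℝ (grd g p a) z := fun a =>
    dd (hs.contDiff_grd (by norm_num) (hpC.of_le (by norm_num)) a)
  have hTz := hT z hz
  -- The product a.b = 2ab cancels the factors ½.
  have hF : (fun y => locJ0 g N n u y + locJ1 g u y) = fun y => grdInner g p p y + q y * q y := by
    funext y
    simp only [locJ0, locJ1, dot, ← hp, ← hq]
    ring
  have hFd : DifferentiableAt ℝ (fun y => locJ0 g N n u y + locJ1 g u y) z := by
    rw [hF]
    exact hi1.fun_add (hqd.fun_mul hqd)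
  have eF : dNorm n (fun y => locJ0 g N n u y + locJ1 g u y) z
      = 2 * N z * tenGrad g k p p z + 2 * grdInner g p (dNorm n p) z + 2 * q z * dNorm n q z := by
    rw [hF, dNorm_add hi1 (hqd.fun_mul hqd), hs.dNorm_grdInner hpC hz, dNorm_mul hqd hqd]
    ring
  have eNp : Set.EqOn (dNorm n u) (fun y => N y * p y) U := fun y hy => by
    simp only [hp, prm]
    field_simp [(hs.lapse_pos y hy).ne']
  have elap : lapl g (dNorm n u) z
      = N z * lapl g p z + 2 * grdInner g N p z + p z * lapl g N z := by
    rw [← hs.lapl_mul hs.contDiff_lapse hpC hz, ← hs.dvg_grd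
      (hs.contDiff_dNorm le_rfl (hu.of_le (by norm_num))) hz, ← hs.dvg_grd
      (hs.contDiff_lapse.mul hpC) hz]
    refine hs.dvg_congr (fun a y hy => ?_) hz
    simp only [grd, dirD_congr_of_eqOn hs.isOpen hy eNp]
  -- The momentum constraint contracted with grad u, after ∂₀u = N u'; the factor 2 is that of
  -- `dot`.
  have emom : N z * (∑ a, dvgT g k a z * grd g u a z)
      = -(2 * N z * p z * grdInner g u u z) := by
    have h0 := hmom z hz 0
    have h1 := hmom z hz 1
    have h2 := eNp hz
    rw [← hs.sum_grd_mul hz]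
    simp only [dot, Fin.sum_univ_two, h2] at h0 h1 ⊢
    linear_combination (-grd g u 0 z) * h0 - grd g u 1 z * h1
  have eq := hs.dNorm_lapl hu hz (hT0 z hz)
  have ewave : ∀ f, grdInner g f (dNorm n p) z = q z * grdInner g f N z + N z * grdInner g f q z
      + grdInner g f (grdInner g N u) z
      + T z * (N z * grdInner g f p z + p z * grdInner g f N z) := by
    intro f
    -- The wave equation is written with the trace of k instead of `T`: the trace is differentiable
    -- with vanishing space derivatives, whereas no regularity of `T` is assumed.
    have e : Set.EqOn (dNorm n p) (fun y => N y * q y + grdInner g N u y + trc g k y * (N y * p y)) U :=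
      fun y hy => by
        simp only [hwave y hy, hT y hy]
        ring
    have e1 : ∀ b, dirD (vx b) (dNorm n p) z = dirD (vx b) N z * q z + N z * dirD (vx b) q z
        + dirD (vx b) (grdInner g N u) z
        + T z * (dirD (vx b) N z * p z + N z * dirD (vx b) p z) := by
      intro b
      rw [dirD_congr_of_eqOn hs.isOpen hz e,
        dirD_add ((hNd.fun_mul hqd).fun_add hi2) (htd.fun_mul (hNd.fun_mul hpd)),
        dirD_add (hNd.fun_mul hqd) hi2, dirD_mul hNd hqd, dirD_mul htd (hNd.fun_mul hpd),
        dirD_mul hNd hpd, hT0 z hz b, hTz]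
      ring
    simp only [grdInner]
    simp only [e1, Fin.sum_univ_two]
    ring
  -- The product rule splits the flux into transport of the density by the shift and the part 2 N Δu
  -- Du', whose divergence absorbs N Δu Δu' and the derivative of Δu along Du'.
  have eflux : dvg g (flux g N n u) z
      = (locJ0 g N n u z + locJ1 g u z) * dvg g n z
        + ∑ a, n a z * dirD (vx a) (fun y => locJ0 g N n u y + locJ1 g u y) z
        + (2 * (N z * q z) * lapl g p z
          + 2 * (q z * grdInner g p N z + N z * grdInner g p q z)) := by
    have hNq := (hNd.fun_mul hqd).const_mul 2
    rw [show flux g N n u = fun a y => (fun y => locJ0 g N n u y + locJ1 g u y) y * n a y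
      + (fun y => 2 * (N y * q y)) y * grd g p a y from rfl,
      dvg_add (fun a => hFd.fun_mul (hs.diff_shift hz a)) (fun a => hNq.fun_mul (hgp a)),
      dvg_mul hFd (hs.diff_shift hz), dvg_mul hNq hgp, hs.dvg_grd hpC hz]
    simp only [dirD_const_mul 2 (hNd.fun_mul hqd), dirD_mul hNd hqd, ← hs.sum_grd_mul hz,
      Fin.sum_univ_two]
    ring
  have elog : dirD vt (logDensity g) z = -(N z * T z) + dvg g n z := by
    have := hs.dNorm_logDensity hz hTz
    simp only [dNorm, dvg, Fin.sum_univ_two] at this ⊢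
    linear_combination this
  have et : dirD vt (fun y => locJ0 g N n u y + locJ1 g u y) z
      = dNorm n (fun y => locJ0 g N n u y + locJ1 g u y) z
        + ∑ a, n a z * dirD (vx a) (fun y => locJ0 g N n u y + locJ1 g u y) z := by
    simp only [dNorm]
    ring
  rw [et, eF, ewave, eq, elap, eflux, elog]
  simp only [locZ, locY1, dot, hs.tenGrad_traceless hz, hs.tenHess_traceless hz, ← hp, ← hq, ← hk,
    hTz, hs.grdInner_comm hz p N, hs.grdInner_comm hz p (grdInner g N u), locJ0, locJ1]
  -- The coefficient is 2 Δu, from differentiating (Δu)², times the 2 in front of N div k in ∂₀Δu.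
  linear_combination (4 * q z) * emom

end IsSlicingOn

/-! ### Change of coordinates -/

lemma plane_eq_sum (x : Plane) : x = ∑ j, x j • (EuclideanSpace.single j (1 : ℝ) : Plane) := by
  ext i
  fin_cases i <;> simp [Fin.sum_univ_two]

/-- The coordinate functions of the plane. -/
def coordProj (i : Fin 2) : Plane →L[ℝ] ℝ := EuclideanSpace.proj i

section CoordinateChange

variable {Φ : Plane → Plane} {y : Plane}

/-- The Jacobian matrix `∂_a Φ^i`. -/
def jac (Φ : Plane → Plane) (y : Plane) (i a : Fin 2) : ℝ := pd a (fun z => Φ z i) y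

lemma jac_eq_fderiv (h : DifferentiableAt ℝ Φ y) (i a : Fin 2) :
    jac Φ y i a = fderiv ℝ Φ y (EuclideanSpace.single a (1 : ℝ)) i := by
  have := ((coordProj i).hasFDerivAt.comp y
    h.hasFDerivAt).fderiv
  simp only [jac, pd]
  rw [show (fun z => Φ z i)
    = (coordProj i) ∘ Φ from rfl, this]
  rfl

lemma fderiv_single (h : DifferentiableAt ℝ Φ y) (a : Fin 2) :
    fderiv ℝ Φ y (EuclideanSpace.single a (1 : ℝ))
      = ∑ i, jac Φ y i a • (EuclideanSpace.single i (1 : ℝ) : Plane) := by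
  conv_lhs => rw [plane_eq_sum (fderiv ℝ Φ y (EuclideanSpace.single a (1 : ℝ)))]
  simp only [jac_eq_fderiv h]

lemma fderiv_apply_coord (h : DifferentiableAt ℝ Φ y) (v : Plane) (i : Fin 2) :
    fderiv ℝ Φ y v i = ∑ a, jac Φ y i a * v a := by
  conv_lhs => rw [plane_eq_sum v, map_sum]
  simp only [map_smul, jac_eq_fderiv h, WithLp.ofLp_sum, Finset.sum_apply, PiLp.smul_apply,
    smul_eq_mul, mul_comm]

/-- The chain rule in coordinates. -/
lemma pd_comp {f : Plane → ℝ} (hf : DifferentiableAt ℝ f (Φ y)) (h : DifferentiableAt ℝ Φ y)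
    (a : Fin 2) : pd a (fun z => f (Φ z)) y = ∑ i, jac Φ y i a * pd i f (Φ y) := by
  have := (hf.hasFDerivAt.comp y h.hasFDerivAt).fderiv
  simp only [pd]
  rw [show (fun z => f (Φ z)) = f ∘ Φ from rfl, this, ContinuousLinearMap.comp_apply,
    fderiv_single h, map_sum]
  simp

/-- The covariant derivative of a covector field is a tensor. -/
lemma covDerivCovector_change {V : Set Plane} (hV : IsOpen V) (hy : y ∈ V)
    (hΦ : ContDiffOn ℝ 2 Φ V) {G G' : Plane → Matrix (Fin 2) (Fin 2) ℝ}
    (hG : ∀ z ∈ V, ∀ a b, G z a b = ∑ i, ∑ j, jac Φ z i a * jac Φ z j b * G' (Φ z) i j)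
    (hG' : ∀ i j, DifferentiableAt ℝ (fun z => G' z i j) (Φ y))
    (hs : G' (Φ y) 1 0 = G' (Φ y) 0 1)
    (hW : ∀ i j, (G' (Φ y))⁻¹ i j = ∑ a, ∑ b, jac Φ y i a * jac Φ y j b * (G y)⁻¹ a b)
    (hWG : ∀ i j, ∑ k, (G' (Φ y))⁻¹ i k * G' (Φ y) k j = if i = j then 1 else 0)
    {w w' : Plane → Fin 2 → ℝ} (hw : ∀ z ∈ V, ∀ a, w z a = ∑ i, jac Φ z i a * w' (Φ z) i)
    (hw' : ∀ i, DifferentiableAt ℝ (fun z => w' z i) (Φ y)) (a b : Fin 2) :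
    covDerivCovector G w a b y
      = ∑ i, ∑ j, jac Φ y i a * jac Φ y j b * covDerivCovector G' w' i j (Φ y) := by
  have hΦi : ∀ i, ContDiffOn ℝ 2 (fun z => Φ z i) V := fun i =>
    (coordProj i).contDiff.comp_contDiffOn hΦ
  have hΦd : DifferentiableAt ℝ Φ y := hΦ.differentiableAt_of_isOpen hV (by norm_num) hy
  have hA : ∀ i a, DifferentiableAt ℝ (fun z => jac Φ z i a) y := fun i a =>
    (contDiffOn_dirD (n := 1) (hΦi i) hV (by norm_num) _).differentiableAt_of_isOpen hV
      (by norm_num) hy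
  set A := jac Φ y with hAdef
  set B : Fin 2 → Fin 2 → Fin 2 → ℝ := fun i a b => pd b (fun z => jac Φ z i a) y with hB
  have hBs : ∀ i a b, B i a b = B i b a := fun i a b =>
    dirD_comm ((hΦi i).contDiffAt (hV.mem_nhds hy))
  have hc : ∀ {f : Plane → ℝ}, DifferentiableAt ℝ f (Φ y) →
      DifferentiableAt ℝ (fun z => f (Φ z)) y := fun hf => hf.comp y hΦd
  have dG : ∀ c a b, pd c (fun z => G z a b) y = ∑ i, ∑ j,
      ((B i a c * A j b + A i a * B j b c) * G' (Φ y) i j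
        + A i a * A j b * ∑ k, A k c * pd k (fun z => G' z i j) (Φ y)) := by
    intro c a b
    have h1 : ∀ i j, DifferentiableAt ℝ (fun z => jac Φ z i a * jac Φ z j b * G' (Φ z) i j) y :=
      fun i j => ((hA i a).fun_mul (hA j b)).fun_mul (hc (hG' i j))
    simp only [pd_eq_dirD]
    rw [dirD_congr_of_eqOn hV hy fun z hz => hG z hz a b,
      dirD_sum _ fun i _ => DifferentiableAt.fun_sum fun j _ => h1 i j]
    refine Finset.sum_congr rfl fun i _ => ?_
    rw [dirD_sum _ fun j _ => h1 i j]
    refine Finset.sum_congr rfl fun j _ => ?_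
    rw [dirD_mul ((hA i a).fun_mul (hA j b)) (hc (hG' i j)), dirD_mul (hA i a) (hA j b)]
    congr 2
    exact pd_comp (hG' i j) hΦd c
  have dw : pd a (fun z => w z b) y = ∑ i, (B i b a * w' (Φ y) i
      + A i b * ∑ k, A k a * pd k (fun z => w' z i) (Φ y)) := by
    simp only [pd_eq_dirD]
    rw [dirD_congr_of_eqOn hV hy fun z hz => hw z hz b,
      dirD_sum_mul _ (fun i _ => hA i b) fun i _ => hc (hw' i)]
    refine Finset.sum_congr rfl fun i _ => ?_
    congr 2
    exact pd_comp (hw' i) hΦd a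
  set L : Fin 2 → ℝ := fun d => pd a (fun z => G z d b) y + pd b (fun z => G z d a) y
    - pd d (fun z => G z a b) y with hL
  set L' : Fin 2 → Fin 2 → Fin 2 → ℝ := fun d i j => pd i (fun z => G' z d j) (Φ y)
    + pd j (fun z => G' z d i) (Φ y) - pd d (fun z => G' z i j) (Φ y) with hL'
  -- Of the six second-derivative terms of Φ, four cancel in pairs by symmetry and two agree, whence
  -- the factor 2.
  have eL : ∀ d, L d = ∑ k, A k d * (∑ i, ∑ j, A i a * A j b * L' k i j
      + 2 * ∑ m, G' (Φ y) k m * B m a b) := by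
    intro d
    simp only [hL, hL', dG, hBs _ d a, hBs _ d b, hBs _ b a, Fin.sum_univ_two, hs]
    ring
  -- The inhomogeneous transformation law of the Christoffel symbols. Its extra term `B` cancels
  -- against the second derivatives of Φ in `dw`.
  have eΓ : ∀ l, ∑ c, A l c * christoffel G c a b y
      = ∑ i, ∑ j, A i a * A j b * christoffel G' l i j (Φ y) + B l a b := by
    intro l
    have h1 : ∑ c, A l c * christoffel G c a b y
        = (1 / 2) * ∑ k, (G' (Φ y))⁻¹ l k * (∑ i, ∑ j, A i a * A j b * L' k i j
          + 2 * ∑ m, G' (Φ y) k m * B m a b) := by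
      have : ∀ c, christoffel G c a b y = (1 / 2) * ∑ d, (G y)⁻¹ c d * L d := fun c => rfl
      simp only [this, eL, hW, Fin.sum_univ_two]
      ring
    have h2 : B l a b = ∑ m, (∑ k, (G' (Φ y))⁻¹ l k * G' (Φ y) k m) * B m a b := by
      simp [hWG]
    have h3 : ∀ i j, christoffel G' l i j (Φ y) = (1 / 2) * ∑ k, (G' (Φ y))⁻¹ l k * L' k i j :=
      fun i j => rfl
    rw [h1, h2]
    simp only [h3, Fin.sum_univ_two]
    ring
  have e0 := eΓ 0
  have e1 := eΓ 1
  simp only [covDerivCovector, dw, hw y hy, hBs _ b a]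
  simp only [Fin.sum_univ_two, ← hAdef] at e0 e1 ⊢
  linear_combination (-w' (Φ y) 0) * e0 - w' (Φ y) 1 * e1

/-- Inverse metrics transform with the Jacobian matrix. -/
lemma inv_change {G G' A : Matrix (Fin 2) (Fin 2) ℝ} (hG : IsUnit G.det)
    (h : G = A.transpose * G' * A) : G'⁻¹ = A * G⁻¹ * A.transpose := by
  -- Invertibility of G forces that of both A and G'.
  have hd : IsUnit (A.transpose.det * G'.det * A.det) := by
    rwa [h, Matrix.det_mul, Matrix.det_mul] at hG
  have hA : IsUnit A.det := isUnit_of_mul_isUnit_right hd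
  have hG' : IsUnit G'.det := isUnit_of_mul_isUnit_right (isUnit_of_mul_isUnit_left hd)
  refine Matrix.inv_eq_left_inv ?_
  have e1 : A.transpose * G' = G * A⁻¹ := by
    rw [h, mul_assoc, Matrix.mul_nonsing_inv _ hA, mul_one]
  calc A * G⁻¹ * A.transpose * G' = A * G⁻¹ * (A.transpose * G') := by rw [mul_assoc]
    _ = A * (G⁻¹ * G) * A⁻¹ := by rw [e1]; simp only [mul_assoc]
    _ = 1 := by rw [Matrix.nonsing_inv_mul _ hG, mul_one, Matrix.mul_nonsing_inv _ hA]

lemma contract_change {A : Fin 2 → Fin 2 → ℝ} {P P' T T' : Fin 2 → Fin 2 → ℝ}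
    (hP : ∀ i j, P' i j = ∑ a, ∑ b, A i a * A j b * P a b)
    (hT : ∀ a b, T a b = ∑ i, ∑ j, A i a * A j b * T' i j) :
    ∑ a, ∑ b, P a b * T a b = ∑ i, ∑ j, P' i j * T' i j := by
  simp only [hP, hT, Fin.sum_univ_two]
  ring

lemma raise_change {A : Fin 2 → Fin 2 → ℝ} {P P' T T' : Fin 2 → Fin 2 → ℝ}
    (hP : ∀ i j, P' i j = ∑ a, ∑ b, A i a * A j b * P a b)
    (hT : ∀ a b, T a b = ∑ i, ∑ j, A i a * A j b * T' i j) (i j : Fin 2) :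
    ∑ k, ∑ l, P' i k * P' j l * T' k l
      = ∑ a, ∑ b, A i a * A j b * ∑ c, ∑ d, P a c * P b d * T c d := by
  simp only [hP, hT, Fin.sum_univ_two]
  ring

end CoordinateChange

/-! ### Change of charts on the surface -/

section Charts

variable {M : Type*} [TopologicalSpace M]

/-- The coordinate change from the chart `e` to the chart `e'`. -/
def coordChange (e e' : OpenPartialHomeomorph M Plane) (y : Plane) : Plane := e' (e.symm y)

/-- The domain of the coordinate change. -/
def overlap (e e' : OpenPartialHomeomorph M Plane) : Set Plane := (e.symm.trans e').source

variable {e e' : OpenPartialHomeomorph M Plane} {y : Plane}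

lemma isOpen_overlap : IsOpen (overlap e e') := (e.symm.trans e').open_source

lemma mem_overlap : y ∈ overlap e e' ↔ y ∈ e.target ∧ e.symm y ∈ e'.source := by
  simp [overlap]

lemma coordChange_mem (hy : y ∈ overlap e e') : coordChange e e' y ∈ e'.target :=
  e'.map_source (mem_overlap.1 hy).2

lemma symm_coordChange (hy : y ∈ overlap e e') : e'.symm (coordChange e e' y) = e.symm y :=
  e'.left_inv (mem_overlap.1 hy).2

variable [ChartedSpace Plane M]

/-- The derivative of the inverse of a chart, as a linear map of the plane. -/
def chartMap (e : OpenPartialHomeomorph M Plane) (y : Plane) : Plane →L[ℝ] Plane :=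
  mfderiv (𝓡 2) (𝓡 2) e.symm y

/-- The derivative of a chart, as a linear map of the plane. -/
def chartInvMap (e : OpenPartialHomeomorph M Plane) (x : M) : Plane →L[ℝ] Plane :=
  mfderiv (𝓡 2) (𝓡 2) e x

/-- The metric in the model tangent space. -/
def Slicing.metricAt (S : Slicing M) (t : ℝ) (x : M) : Plane →L[ℝ] Plane →L[ℝ] ℝ := S.g t x

/-- The shift in the model tangent space. -/
def Slicing.shiftAt (S : Slicing M) (t : ℝ) (x : M) : Plane := S.ν t x

lemma Slicing.G_eq (S : Slicing M) (e : OpenPartialHomeomorph M Plane) (t : ℝ) (y : Plane)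
    (a b : Fin 2) : S.G e t y a b = S.metricAt t (e.symm y)
      (chartMap e y (EuclideanSpace.single a 1)) (chartMap e y (EuclideanSpace.single b 1)) := rfl

lemma Slicing.shiftUp_eq (S : Slicing M) (e : OpenPartialHomeomorph M Plane) (t : ℝ) (y : Plane)
    (a : Fin 2) : S.shiftUp e t y a = chartInvMap e (e.symm y) (S.shiftAt t (e.symm y)) a := rfl

variable [IsManifold (𝓡 2) ∞ M]

lemma contDiffOn_coordChange (he : e ∈ atlas Plane M) (he' : e' ∈ atlas Plane M) :
    ContDiffOn ℝ ∞ (coordChange e e') (overlap e e') :=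
  (contMDiffOn_of_mem_contDiffGroupoid
    (StructureGroupoid.compatible (contDiffGroupoid ∞ (𝓡 2)) he he')).contDiffOn

lemma differentiableAt_coordChange (he : e ∈ atlas Plane M) (he' : e' ∈ atlas Plane M)
    (hy : y ∈ overlap e e') : DifferentiableAt ℝ (coordChange e e') y :=
  (contDiffOn_coordChange he he').differentiableAt_of_isOpen isOpen_overlap (by norm_num) hy

lemma chartMap_change (he : e ∈ atlas Plane M) (he' : e' ∈ atlas Plane M)
    (hy : y ∈ overlap e e') (v : Plane) :
    chartMap e y v = chartMap e' (coordChange e e' y) (fderiv ℝ (coordChange e e') y v) := by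
  have h1 : HasMFDerivAt (𝓡 2) (𝓡 2) (coordChange e e') y (fderiv ℝ (coordChange e e') y) :=
    (differentiableAt_coordChange he he' hy).hasFDerivAt.hasMFDerivAt
  have h2 : HasMFDerivAt (𝓡 2) (𝓡 2) e'.symm (coordChange e e' y)
      (chartMap e' (coordChange e e' y)) :=
    (mdifferentiableAt_atlas_symm he' (coordChange_mem hy)).hasMFDerivAt
  have h3 := (h2.comp y h1).congr_of_eventuallyEq (f₁ := e.symm)
    (Filter.eventuallyEq_of_mem (isOpen_overlap.mem_nhds hy) fun z hz =>
      (symm_coordChange hz).symm)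
  have h4 : chartMap e y
      = (chartMap e' (coordChange e e' y)).comp (fderiv ℝ (coordChange e e') y) := h3.mfderiv
  rw [h4]
  rfl

lemma chartInvMap_change (he : e ∈ atlas Plane M) (he' : e' ∈ atlas Plane M)
    (hy : y ∈ overlap e e') (v : Plane) :
    chartInvMap e' (e.symm y) v
      = fderiv ℝ (coordChange e e') y (chartInvMap e (e.symm y) v) := by
  have hx := e.map_target (mem_overlap.1 hy).1
  have hxy : e (e.symm y) = y := e.right_inv (mem_overlap.1 hy).1
  have h1 : HasMFDerivAt (𝓡 2) (𝓡 2) (coordChange e e') (e (e.symm y))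
      (fderiv ℝ (coordChange e e') y) := by
    rw [hxy]
    exact (differentiableAt_coordChange he he' hy).hasFDerivAt.hasMFDerivAt
  have h2 : HasMFDerivAt (𝓡 2) (𝓡 2) e (e.symm y) (chartInvMap e (e.symm y)) :=
    (mdifferentiableAt_atlas he hx).hasMFDerivAt
  have h3 := (h1.comp (e.symm y) h2).congr_of_eventuallyEq (f₁ := e')
    (Filter.eventuallyEq_of_mem (e.open_source.mem_nhds hx) fun z hz => by
      simp [coordChange, e.left_inv hz])
  have h4 : chartInvMap e' (e.symm y)
      = (fderiv ℝ (coordChange e e') y).comp (chartInvMap e (e.symm y)) := h3.mfderiv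
  rw [h4]
  rfl

lemma chartMap_injective (he : e ∈ atlas Plane M) (hy : y ∈ e.target) :
    Function.Injective (chartMap e y) :=
  (mdifferentiable_of_mem_atlas (I := 𝓡 2) (M := M) he).symm.mfderiv_injective hy

namespace Slicing

variable (S : Slicing M) (t : ℝ)

lemma G_change (he : e ∈ atlas Plane M) (he' : e' ∈ atlas Plane M)
    (hy : y ∈ overlap e e') (a b : Fin 2) :
    S.G e t y a b = ∑ i, ∑ j, jac (coordChange e e') y i a * jac (coordChange e e') y j b
      * S.G e' t (coordChange e e' y) i j := by
  have hd := differentiableAt_coordChange he he' hy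
  simp only [G_eq, chartMap_change he he' hy, fderiv_single hd, symm_coordChange hy]
  simp only [Fin.sum_univ_two, map_add, map_smul, add_apply,
    smul_apply, smul_eq_mul]
  ring

lemma shiftUp_change (he : e ∈ atlas Plane M) (he' : e' ∈ atlas Plane M)
    (hy : y ∈ overlap e e') (i : Fin 2) :
    S.shiftUp e' t (coordChange e e' y) i
      = ∑ a, jac (coordChange e e') y i a * S.shiftUp e t y a := by
  have hd := differentiableAt_coordChange he he' hy
  simp only [shiftUp_eq, symm_coordChange hy, chartInvMap_change he he' hy,
    fderiv_apply_coord hd]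

lemma shiftDown_change (he : e ∈ atlas Plane M) (he' : e' ∈ atlas Plane M)
    (hy : y ∈ overlap e e') (a : Fin 2) :
    S.shiftDown e t y a
      = ∑ i, jac (coordChange e e') y i a * S.shiftDown e' t (coordChange e e' y) i := by
  simp only [shiftDown, S.G_change t he he' hy, S.shiftUp_change t he he' hy, Fin.sum_univ_two]
  ring

end Slicing

/-- The function `f`, which depends on the time, in the chart `e`. -/
def inChart (e : OpenPartialHomeomorph M Plane) (f : ℝ → M → ℝ) (z : ℝ × Plane) : ℝ :=
  f z.1 (e.symm z.2)

/-- Regularity of a time dependent function in all charts. -/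
def RegularOn (k : WithTop ℕ∞) (J : Set ℝ) (f : ℝ → M → ℝ) : Prop :=
  ∀ e ∈ atlas Plane M, ContDiffOn ℝ k (inChart e f) (J ×ˢ e.target)

/-- The metric in the chart `e` as a function of time and coordinates. -/
def Slicing.jointG (S : Slicing M) (e : OpenPartialHomeomorph M Plane) (z : ℝ × Plane) :
    Matrix (Fin 2) (Fin 2) ℝ := S.G e z.1 z.2

/-- The shift in the chart `e` as a function of time and coordinates. -/
def Slicing.jointShift (S : Slicing M) (e : OpenPartialHomeomorph M Plane) (a : Fin 2)
    (z : ℝ × Plane) : ℝ := S.shiftUp e z.1 z.2 a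

/-- The extrinsic curvature in the chart `e` as a function of time and coordinates. -/
def Slicing.jointK (S : Slicing M) (e : OpenPartialHomeomorph M Plane) :
    ℝ × Plane → Matrix (Fin 2) (Fin 2) ℝ := extr (S.jointG e) (inChart e S.N) (S.jointShift e)

namespace Slicing.IsSolution

variable {S : Slicing M} {J : Set ℝ} {τ : ℝ → ℝ} {u : ℝ → M → ℝ}
  (hS : S.IsSolution J τ u) {t : ℝ}
include hS

omit [IsManifold (𝓡 2) ∞ M] in
lemma G_symm (ht : t ∈ J) (y : Plane) (a b : Fin 2) : S.G e t y a b = S.G e t y b a :=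
  hS.g_symm t ht _ _ _

lemma G_det_pos (he : e ∈ atlas Plane M) (ht : t ∈ J) (hy : y ∈ e.target) :
    0 < (S.G e t y).det := by
  have hpos : ∀ v : Plane, v ≠ 0 →
      0 < S.metricAt t (e.symm y) (chartMap e y v) (chartMap e y v) := by
    intro v hv
    refine hS.g_pos t ht _ _ fun h => hv (chartMap_injective he hy ?_)
    rw [map_zero]
    exact h
  have h00 : 0 < S.G e t y 0 0 := by
    rw [G_eq]
    refine hpos _ fun h => ?_
    have := congrArg (fun w : Plane => w 0) h
    simp at this
  -- The vector g₀₀ e₁ - g₀₁ e₀ has squared length g₀₀ det g, so positivity of the metric gives a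
  -- positive determinant.
  have hv := hpos (S.G e t y 0 0 • EuclideanSpace.single 1 1
    - S.G e t y 0 1 • EuclideanSpace.single 0 1) fun h => by
      have := congrArg (fun w : Plane => w 1) h
      simp [h00.ne'] at this
  simp only [map_sub, map_smul, sub_apply, smul_apply,
    smul_eq_mul, ← G_eq, hS.G_symm ht y 1 0] at hv
  rw [Matrix.det_fin_two, hS.G_symm ht y 1 0]
  by_contra hneg
  rw [not_lt] at hneg
  nlinarith

lemma isSlicingOn (hJ : IsOpen J) (he : e ∈ atlas Plane M) :
    IsSlicingOn (J ×ˢ e.target) (S.jointG e) (inChart e S.N) (S.jointShift e) where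
  isOpen := hJ.prod e.open_target
  contDiff := hS.g_reg e he
  symm _ hz := hS.G_symm hz.1 _
  det_pos _ hz := hS.G_det_pos he hz.1 hz.2
  contDiff_lapse := hS.N_reg e he
  lapse_pos _ hz := hS.N_pos _ hz.1 _
  contDiff_shift := hS.ν_reg e he

end Slicing.IsSolution

end Charts

/-! ### Scalars of the surface in an arbitrary chart -/

section Bridge

variable {M : Type*} [TopologicalSpace M] [ChartedSpace Plane M]
  {e e' : OpenPartialHomeomorph M Plane} {y : Plane}

namespace Slicing

variable (S : Slicing M)

/-- `T^{ab} ∂_a f₁ ∂_b f₂` in the chart `e`. -/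
def gradIn (P : Fin 2 → Fin 2 → ℝ) (e : OpenPartialHomeomorph M Plane) (f₁ f₂ : M → ℝ)
    (y : Plane) : ℝ :=
  ∑ a, ∑ b, P a b * (pd a (f₁ ∘ e.symm) y * pd b (f₂ ∘ e.symm) y)

/-- `T^{ab} ∇_a ∂_b f` in the chart `e`. -/
def hessIn (P : Fin 2 → Fin 2 → ℝ) (e : OpenPartialHomeomorph M Plane) (t : ℝ) (f : M → ℝ)
    (y : Plane) : ℝ :=
  ∑ a, ∑ b, P a b * hess (S.G e t) (f ∘ e.symm) a b y

end Slicing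

lemma RegularOn.comp_differentiableAt {k : WithTop ℕ∞} {J : Set ℝ} {f : ℝ → M → ℝ}
    (hf : RegularOn k J f) (hJ : IsOpen J) (hk : k ≠ 0) (he : e ∈ atlas Plane M) {t : ℝ}
    (ht : t ∈ J) (hy : y ∈ e.target) : DifferentiableAt ℝ (inChart e f) (t, y) :=
  (hf e he).differentiableAt_of_isOpen (hJ.prod e.open_target) hk ⟨ht, hy⟩

lemma slice_differentiableAt {F : ℝ × Plane → ℝ} {t : ℝ} (h : DifferentiableAt ℝ F (t, y)) :
    DifferentiableAt ℝ (fun y => F (t, y)) y :=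
  h.comp y (hasFDerivAt_prodMk_right t y).differentiableAt

lemma pd_inChart {k : WithTop ℕ∞} {J : Set ℝ} {f : ℝ → M → ℝ}
    (hf : RegularOn k J f) (hJ : IsOpen J) (hk : k ≠ 0) (he : e ∈ atlas Plane M) {t : ℝ}
    (ht : t ∈ J) (hy : y ∈ e.target) (a : Fin 2) :
    pd a (f t ∘ e.symm) y = dirD (vx a) (inChart e f) (t, y) :=
  pd_slice (hf.comp_differentiableAt hJ hk he ht hy) a

/-- A second differentiation requires the slice and joint first derivatives to agree on a
neighbourhood, not only at the point. -/
lemma pd_pd_inChart {J : Set ℝ} {f : ℝ → M → ℝ}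
    (hf : RegularOn 2 J f) (hJ : IsOpen J) (he : e ∈ atlas Plane M) {t : ℝ}
    (ht : t ∈ J) (hy : y ∈ e.target) (b : Fin 2) :
    DifferentiableAt ℝ (dirD (vx b) (inChart e f)) (t, y) ∧
    pd b (f t ∘ e.symm) =ᶠ[nhds y] fun y => dirD (vx b) (inChart e f) (t, y) :=
  ⟨(contDiffOn_dirD (n := 1) (hf e he) (hJ.prod e.open_target) (by norm_num)
      _).differentiableAt_of_isOpen (hJ.prod e.open_target) (by norm_num) ⟨ht, hy⟩,
    Filter.eventuallyEq_of_mem (e.open_target.mem_nhds hy) fun _ hz =>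
      pd_inChart hf hJ (by norm_num) he ht hz b⟩

variable {S : Slicing M} {J : Set ℝ} {τ : ℝ → ℝ} {u : ℝ → M → ℝ} {t : ℝ}

namespace Slicing.IsSolution

/-! ### The geometric quantities of one chart as joint functions of time and coordinates. -/

section SingleChart

variable (hS : S.IsSolution J τ u) (hJ : IsOpen J) (he : e ∈ atlas Plane M) (ht : t ∈ J)
  (hy : y ∈ e.target)
include hS hJ he ht hy

lemma christoffel_eq (c a b : Fin 2) :
    christoffel (S.G e t) c a b y = chr (S.jointG e) c a b (t, y) := by
  have h : ∀ v a b, pd v (fun z => S.G e t z a b) y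
      = dirD (vx v) (fun z => S.jointG e z a b) (t, y) := fun v a b =>
    pd_slice (F := fun z => S.jointG e z a b) ((hS.g_reg e he a b).differentiableAt_of_isOpen
      (hJ.prod e.open_target) (by norm_num) ⟨ht, hy⟩) v
  simp only [christoffel, chr, h]
  rfl

lemma covDerivCovector_eq {w : Plane → Fin 2 → ℝ} {W : Fin 2 → ℝ × Plane → ℝ}
    (hW : ∀ a, DifferentiableAt ℝ (W a) (t, y))
    (hw : ∀ a, (fun z => w z a) =ᶠ[nhds y] fun z => W a (t, z)) (a b : Fin 2) :
    covDerivCovector (S.G e t) w a b y = cov (S.jointG e) W a b (t, y) := by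
  have h1 : pd a (fun z => w z b) y = dirD (vx a) (W b) (t, y) :=
    (dirD_congr (hw b)).trans (pd_slice (hW b) a)
  simp only [covDerivCovector, cov, h1, hS.christoffel_eq hJ he ht hy, fun a => (hw a).eq_of_nhds]

lemma hess_eq {f : ℝ → M → ℝ} (hf : RegularOn 2 J f) (a b : Fin 2) :
    hess (S.G e t) (f t ∘ e.symm) a b y
      = cov (S.jointG e) (fun c => dirD (vx c) (inChart e f)) a b (t, y) :=
  hS.covDerivCovector_eq hJ he ht hy (w := fun z c => pd c (f t ∘ e.symm) z)
    (fun c => (pd_pd_inChart hf hJ he ht hy c).1) (fun c => (pd_pd_inChart hf hJ he ht hy c).2) a b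

lemma differentiableAt_lower (a : Fin 2) :
    DifferentiableAt ℝ (lower (S.jointG e) (S.jointShift e) a) (t, y) :=
  DifferentiableAt.fun_sum fun b _ =>
    ((hS.g_reg e he a b).differentiableAt_of_isOpen (hJ.prod e.open_target) (by norm_num)
      ⟨ht, hy⟩).fun_mul ((hS.ν_reg e he b).differentiableAt_of_isOpen (hJ.prod e.open_target)
        (by norm_num) ⟨ht, hy⟩)

lemma k_eq : S.k e t y = S.jointK e (t, y) := by
  ext a b
  have h1 := hS.covDerivCovector_eq hJ he ht hy (w := S.shiftDown e t)
    (W := lower (S.jointG e) (S.jointShift e)) (hS.differentiableAt_lower hJ he ht hy)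
    fun a => Filter.Eventually.of_forall fun z => rfl
  have h2 : deriv (fun s => S.G e s y a b) t = dirD vt (fun z => S.jointG e z a b) (t, y) :=
    deriv_slice (F := fun z => S.jointG e z a b) ((hS.g_reg e he a b).differentiableAt_of_isOpen
      (hJ.prod e.open_target) (by norm_num) ⟨ht, hy⟩)
  simp only [k, jointK, extr, Matrix.of_apply, h1, h2]
  rfl

lemma trk_eq : S.trk e t y = trc (S.jointG e) (S.jointK e) (t, y) := by
  simp only [trk, trc, hS.k_eq hJ he ht hy]
  rfl

lemma hUp_eq (a b : Fin 2) :
    S.hUp e t y a b = raise (S.jointG e) (traceless (S.jointG e) (S.jointK e)) a b (t, y) := by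
  simp only [hUp, raise, traceless, h, Matrix.of_apply, hS.k_eq hJ he ht hy,
    hS.trk_eq hJ he ht hy]
  rfl

-- Near the point, f is its coordinate expression composed with the chart, so the chain rule
-- applies; the derivative of the chart maps ν to its components.
omit hS in
lemma shift_mfderiv {k : WithTop ℕ∞} {f : ℝ → M → ℝ} [IsManifold (𝓡 2) ∞ M] (hf : RegularOn k J f)
    (hk : k ≠ 0) :
    (mfderiv (𝓡 2) 𝓘(ℝ, ℝ) (f t) (e.symm y) (S.ν t (e.symm y)) : ℝ)
      = ∑ a, S.shiftUp e t y a * pd a (f t ∘ e.symm) y := by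
  have hx := e.map_target hy
  have hd : DifferentiableAt ℝ (f t ∘ e.symm) y :=
    slice_differentiableAt (hf.comp_differentiableAt hJ hk he ht hy)
  have h1 : HasMFDerivAt (𝓡 2) 𝓘(ℝ, ℝ) (f t ∘ e.symm) (e (e.symm y))
      (fderiv ℝ (f t ∘ e.symm) y) := by
    rw [e.right_inv hy]
    exact hd.hasFDerivAt.hasMFDerivAt
  have h2 : HasMFDerivAt (𝓡 2) (𝓡 2) e (e.symm y) (chartInvMap e (e.symm y)) :=
    (mdifferentiableAt_atlas he hx).hasMFDerivAt
  have h3 := (h1.comp (e.symm y) h2).congr_of_eventuallyEq (f₁ := f t)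
    (Filter.eventuallyEq_of_mem (e.open_source.mem_nhds hx) fun z hz => by
      simp [e.left_inv hz])
  rw [h3.mfderiv]
  change fderiv ℝ (f t ∘ e.symm) y (chartInvMap e (e.symm y) (S.shiftAt t (e.symm y))) = _
  rw [plane_eq_sum (chartInvMap e (e.symm y) (S.shiftAt t (e.symm y))), map_sum]
  simp only [map_smul, smul_eq_mul]
  rfl

omit hS in
lemma dZero_eq {k : WithTop ℕ∞} {f : ℝ → M → ℝ} [IsManifold (𝓡 2) ∞ M] (hf : RegularOn k J f)
    (hk : k ≠ 0) :
    S.dZero f t (e.symm y) = dNorm (S.jointShift e) (inChart e f) (t, y) := by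
  have hd := hf.comp_differentiableAt hJ hk he ht hy
  have h1 : deriv (fun s => f s (e.symm y)) t = dirD vt (inChart e f) (t, y) := deriv_slice hd
  simp only [dZero, shift_mfderiv hJ he ht hy hf hk, h1, dNorm,
    pd_inChart hf hJ hk he ht hy]
  rfl

omit hS in
lemma prime_eq {k : WithTop ℕ∞} {f : ℝ → M → ℝ} [IsManifold (𝓡 2) ∞ M] (hf : RegularOn k J f)
    (hk : k ≠ 0) :
    S.prime f t (e.symm y) = prm (inChart e S.N) (S.jointShift e) (inChart e f) (t, y) := by
  rw [prime, dZero_eq hJ he ht hy hf hk]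
  rfl

end SingleChart

variable [IsManifold (𝓡 2) ∞ M]

/-! ### Tensor laws under a change of chart. -/

section TwoCharts

variable (hS : S.IsSolution J τ u) (hJ : IsOpen J) (he : e ∈ atlas Plane M)
  (he' : e' ∈ atlas Plane M) (ht : t ∈ J) (hy : y ∈ overlap e e')

lemma pd_change {k : WithTop ℕ∞} {f : ℝ → M → ℝ} (hJ : IsOpen J) (he : e ∈ atlas Plane M)
    (he' : e' ∈ atlas Plane M) (ht : t ∈ J) (hf : RegularOn k J f) (hk : k ≠ 0)
    (hy : y ∈ overlap e e') (a : Fin 2) :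
    pd a (f t ∘ e.symm) y = ∑ i, jac (coordChange e e') y i a
      * pd i (f t ∘ e'.symm) (coordChange e e' y) := by
  have hd : DifferentiableAt ℝ (f t ∘ e'.symm) (coordChange e e' y) :=
    slice_differentiableAt (hf.comp_differentiableAt hJ hk he' ht (coordChange_mem hy))
  rw [← pd_comp hd (differentiableAt_coordChange he he' hy)]
  exact dirD_congr_of_eqOn isOpen_overlap hy fun z hz => by
    simp [symm_coordChange hz]

include hS hJ he he' ht hy

omit hJ in
lemma inv_G_change (i j : Fin 2) : (S.G e' t (coordChange e e' y))⁻¹ i j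
    = ∑ a, ∑ b, jac (coordChange e e') y i a * jac (coordChange e e') y j b
      * (S.G e t y)⁻¹ a b := by
  have hd := hS.G_det_pos he ht (mem_overlap.1 hy).1
  have h1 : S.G e t y = (Matrix.of (jac (coordChange e e') y)).transpose
      * S.G e' t (coordChange e e' y) * Matrix.of (jac (coordChange e e') y) := by
    ext a b
    rw [S.G_change t he he' hy]
    simp only [Matrix.mul_apply, Matrix.transpose_apply, Matrix.of_apply, Fin.sum_univ_two]
    ring
  rw [inv_change hd.ne'.isUnit h1]
  simp only [Matrix.mul_apply, Matrix.transpose_apply, Matrix.of_apply, Fin.sum_univ_two]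
  ring

lemma covDerivCovector_change {w w' : Plane → Fin 2 → ℝ}
    (hw : ∀ z ∈ overlap e e', ∀ a, w z a
      = ∑ i, jac (coordChange e e') z i a * w' (coordChange e e' z) i)
    (hw' : ∀ i, DifferentiableAt ℝ (fun z => w' z i) (coordChange e e' y)) (a b : Fin 2) :
    covDerivCovector (S.G e t) w a b y = ∑ i, ∑ j, jac (coordChange e e') y i a
      * jac (coordChange e e') y j b * covDerivCovector (S.G e' t) w' i j (coordChange e e' y) := by
  have hs := hS.isSlicingOn hJ he'
  have hz : (t, coordChange e e' y) ∈ J ×ˢ e'.target := ⟨ht, coordChange_mem hy⟩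
  have h1 : ContDiffOn ℝ 2 (coordChange e e') (overlap e e') :=
    (contDiffOn_coordChange he he').of_le ENat.LEInfty.out
  have h2 : ∀ i j, DifferentiableAt ℝ (fun z => S.G e' t z i j) (coordChange e e' y) := fun i j =>
    slice_differentiableAt (F := fun z => S.jointG e' z i j) (hs.diff hz i j)
  have h3 : ∀ i j, ∑ k, (S.G e' t (coordChange e e' y))⁻¹ i k * S.G e' t (coordChange e e' y) k j
      = if i = j then 1 else 0 := fun i j => by
    simpa only [jointG] using hs.inv_mul hz i j
  exact PolarizedU1.covDerivCovector_change isOpen_overlap hy h1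
    (fun z hz => S.G_change t he he' hz) h2 (hS.G_symm ht _ 1 0)
    (hS.inv_G_change he he' ht hy) h3 hw hw' a b

lemma hess_change {f : ℝ → M → ℝ} (hf : RegularOn 2 J f) (a b : Fin 2) :
    hess (S.G e t) (f t ∘ e.symm) a b y = ∑ i, ∑ j, jac (coordChange e e') y i a
      * jac (coordChange e e') y j b
      * hess (S.G e' t) (f t ∘ e'.symm) i j (coordChange e e' y) := by
  refine hS.covDerivCovector_change hJ he he' ht hy (w := fun z c => pd c (f t ∘ e.symm) z)
    (w' := fun z c => pd c (f t ∘ e'.symm) z)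
    (fun z hz c => pd_change hJ he he' ht hf (by norm_num) hz c) (fun i => ?_) a b
  obtain ⟨h1, h2⟩ := pd_pd_inChart hf hJ he' ht (coordChange_mem hy) i
  exact (slice_differentiableAt h1).congr_of_eventuallyEq h2

/-- The coordinate change does not depend on time, so ∂_t g transforms like g; the remaining terms
are covariant derivatives of a covector. -/
lemma k_change (a b : Fin 2) :
    S.k e t y a b = ∑ i, ∑ j, jac (coordChange e e') y i a
      * jac (coordChange e e') y j b * S.k e' t (coordChange e e' y) i j := by
  have h1 := hS.covDerivCovector_change hJ he he' ht hy (w := S.shiftDown e t)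
    (w' := S.shiftDown e' t) (fun z hz c => S.shiftDown_change t he he' hz c) fun i =>
      slice_differentiableAt (hS.differentiableAt_lower hJ he' ht (coordChange_mem hy) i)
  have h2 : deriv (fun s => S.G e s y a b) t = ∑ i, ∑ j, jac (coordChange e e') y i a
      * jac (coordChange e e') y j b
      * deriv (fun s => S.G e' s (coordChange e e' y) i j) t := by
    have hd : ∀ i j, DifferentiableAt ℝ (fun s => S.G e' s (coordChange e e' y) i j) t := fun i j =>
      (hasDerivAt_slice (F := fun z => S.jointG e' z i j)
        ((hS.isSlicingOn hJ he').diff ⟨ht, coordChange_mem hy⟩ i j)).differentiableAt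
    simp only [S.G_change _ he he' hy]
    rw [deriv_fun_sum fun i _ => DifferentiableAt.fun_sum fun j _ => (hd i j).const_mul _]
    refine Finset.sum_congr rfl fun i _ => ?_
    rw [deriv_fun_sum fun j _ => (hd i j).const_mul _]
    exact Finset.sum_congr rfl fun j _ => deriv_const_mul _ (hd i j)
  simp only [k, Matrix.of_apply, h1, h2, symm_coordChange hy, Fin.sum_univ_two]
  ring

/-- The trace equals τ in both charts by hypothesis, so its invariance need not be proved
separately. -/
lemma h_change (a b : Fin 2) :
    S.h e t y a b = ∑ i, ∑ j, jac (coordChange e e') y i a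
      * jac (coordChange e e') y j b * S.h e' t (coordChange e e' y) i j := by
  simp only [h, Matrix.of_apply, hS.k_change hJ he he' ht hy, S.G_change t he he' hy,
    hS.cmc e he t ht y (mem_overlap.1 hy).1, hS.cmc e' he' t ht _ (coordChange_mem hy),
    Fin.sum_univ_two]
  ring

lemma hUp_change (i j : Fin 2) :
    S.hUp e' t (coordChange e e' y) i j = ∑ a, ∑ b, jac (coordChange e e') y i a
      * jac (coordChange e e') y j b * S.hUp e t y a b :=
  raise_change (hS.inv_G_change he he' ht hy) (hS.h_change hJ he he' ht hy) i j

omit hS in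
lemma gradIn_change {P P' : Fin 2 → Fin 2 → ℝ} (hP : ∀ i j, P' i j
      = ∑ a, ∑ b, jac (coordChange e e') y i a * jac (coordChange e e') y j b * P a b)
    {k k' : WithTop ℕ∞} {f₁ f₂ : ℝ → M → ℝ}
    (h₁ : RegularOn k J f₁) (hk : k ≠ 0) (h₂ : RegularOn k' J f₂) (hk' : k' ≠ 0) :
    gradIn P e (f₁ t) (f₂ t) y = gradIn P' e' (f₁ t) (f₂ t) (coordChange e e' y) := by
  refine contract_change hP fun a b => ?_
  rw [pd_change hJ he he' ht h₁ hk hy, pd_change hJ he he' ht h₂ hk' hy]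
  simp only [Fin.sum_univ_two]
  ring

lemma hessIn_change {P P' : Fin 2 → Fin 2 → ℝ} (hP : ∀ i j, P' i j
      = ∑ a, ∑ b, jac (coordChange e e') y i a * jac (coordChange e e') y j b * P a b)
    {f : ℝ → M → ℝ} (hf : RegularOn 2 J f) :
    S.hessIn P e t (f t) y = S.hessIn P' e' t (f t) (coordChange e e' y) :=
  contract_change hP (hS.hess_change hJ he he' ht hy hf)

end TwoCharts

/-! ### Evaluation of the scalars of the surface in an arbitrary chart. -/

section Scalars

variable (hS : S.IsSolution J τ u) (hJ : IsOpen J) (he : e ∈ atlas Plane M) (ht : t ∈ J)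
  (hy : y ∈ e.target)
include hS hJ he ht hy

omit hS hJ he ht [IsManifold (𝓡 2) ∞ M] in
lemma mem_overlap_chartAt : y ∈ overlap e (chartAt Plane (e.symm y)) :=
  mem_overlap.2 ⟨hy, mem_chart_source Plane _⟩

/-- By definition the left side uses the preferred chart at the point. Invariance of the contraction
moves it to `e`, and slice derivatives then become joint ones. The next three lemmas follow the same
pattern. -/
lemma gradInner_eq {k k' : WithTop ℕ∞} {f₁ f₂ : ℝ → M → ℝ}
    (h₁ : RegularOn k J f₁) (hk : k ≠ 0) (h₂ : RegularOn k' J f₂) (hk' : k' ≠ 0) :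
    S.gradInner t (f₁ t) (f₂ t) (e.symm y)
      = grdInner (S.jointG e) (inChart e f₁) (inChart e f₂) (t, y) := by
  have hm := mem_overlap_chartAt (e := e) hy
  have he' := chart_mem_atlas Plane (e.symm y)
  have h1 := gradIn_change hJ he he' ht hm
    (hS.inv_G_change he he' ht hm) h₁ hk h₂ hk'
  simp only [gradIn, ← mul_assoc] at h1
  refine h1.symm.trans ?_
  simp only [pd_inChart h₁ hJ hk he ht hy, pd_inChart h₂ hJ hk' he ht hy]
  rfl

lemma lap_eq {f : ℝ → M → ℝ} (hf : RegularOn 2 J f) :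
    S.lap t (f t) (e.symm y) = lapl (S.jointG e) (inChart e f) (t, y) := by
  have hm := mem_overlap_chartAt (e := e) hy
  have he' := chart_mem_atlas Plane (e.symm y)
  have h1 := hS.hessIn_change hJ he he' ht hm (hS.inv_G_change he he' ht hm) hf
  refine h1.symm.trans ?_
  simp only [hessIn, hS.hess_eq hJ he ht hy hf]
  rfl

lemma hGrad_eq {k k' : WithTop ℕ∞} {f₁ f₂ : ℝ → M → ℝ}
    (h₁ : RegularOn k J f₁) (hk : k ≠ 0) (h₂ : RegularOn k' J f₂) (hk' : k' ≠ 0) :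
    S.hGrad t (f₁ t) (f₂ t) (e.symm y) = tenGrad (S.jointG e)
      (traceless (S.jointG e) (S.jointK e)) (inChart e f₁) (inChart e f₂) (t, y) := by
  have hm := mem_overlap_chartAt (e := e) hy
  have he' := chart_mem_atlas Plane (e.symm y)
  have h1 := gradIn_change hJ he he' ht hm
    (hS.hUp_change hJ he he' ht hm) h₁ hk h₂ hk'
  simp only [gradIn, ← mul_assoc] at h1
  refine h1.symm.trans ?_
  simp only [pd_inChart h₁ hJ hk he ht hy, pd_inChart h₂ hJ hk' he ht hy,
    hS.hUp_eq hJ he ht hy]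
  rfl

lemma hHess_eq {f : ℝ → M → ℝ} (hf : RegularOn 2 J f) :
    S.hHess t (f t) (e.symm y) = tenHess (S.jointG e)
      (traceless (S.jointG e) (S.jointK e)) (inChart e f) (t, y) := by
  have hm := mem_overlap_chartAt (e := e) hy
  have he' := chart_mem_atlas Plane (e.symm y)
  have h1 := hS.hessIn_change hJ he he' ht hm (hS.hUp_change hJ he he' ht hm) hf
  refine h1.symm.trans ?_
  simp only [hessIn, hS.hess_eq hJ he ht hy hf, hS.hUp_eq hJ he ht hy]
  rfl

end Scalars

end Slicing.IsSolution

end Bridge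

/-! ### Integrals over open sets of the plane -/

section PlaneIntegrals

variable {U K : Set Plane}

lemma integrableOn_of_eq_zero_off_compact {f : Plane → ℝ} (hU : IsOpen U) (hK : IsCompact K)
    (hKU : K ⊆ U) (hf : ContinuousOn f U) (h0 : ∀ y ∈ U \ K, f y = 0) : IntegrableOn f U :=
  IntegrableOn.of_forall_sdiff_eq_zero ((hf.mono hKU).integrableOn_compact hK) hU.measurableSet h0

/-- Extended by zero, f is C¹ with compact support on the whole plane, and integrating by parts
against the constant 1 gives zero. -/
lemma setIntegral_dirD_eq_zero {f : Plane → ℝ} (hU : IsOpen U) (hK : IsCompact K)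
    (hKU : K ⊆ U) (hf : ContDiffOn ℝ 1 f U) (h0 : ∀ y ∈ U \ K, f y = 0) (v : Plane) :
    ∫ y in U, dirD v f y = 0 := by
  classical
  set F : Plane → ℝ := U.indicator f with hF
  have hF1 : ∀ y ∈ U, F =ᶠ[nhds y] f := fun y hy =>
    Filter.eventuallyEq_of_mem (hU.mem_nhds hy) fun z hz => Set.indicator_of_mem hz f
  have hF0 : ∀ y ∉ K, F =ᶠ[nhds y] fun _ => 0 := fun y hy =>
    Filter.eventuallyEq_of_mem (hK.isClosed.isOpen_compl.mem_nhds hy) fun z hz => by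
      by_cases hzU : z ∈ U
      · rw [hF, Set.indicator_of_mem hzU, h0 z ⟨hzU, hz⟩]
      · exact Set.indicator_of_notMem hzU f
  have hFC : ContDiff ℝ 1 F := contDiff_iff_contDiffAt.2 fun y => by
    by_cases hy : y ∈ U
    · exact (hf.contDiffAt (hU.mem_nhds hy)).congr_of_eventuallyEq (hF1 y hy)
    · exact contDiffAt_const.congr_of_eventuallyEq (hF0 y fun h => hy (hKU h))
  have hFs : HasCompactSupport F := HasCompactSupport.intro hK fun y hy => (hF0 y hy).eq_of_nhds
  have hdc : Continuous fun y => fderiv ℝ F y v :=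
    (hFC.continuous_fderiv (by norm_num)).clm_apply continuous_const
  have hds : HasCompactSupport fun y => fderiv ℝ F y v := hFs.fderiv_apply ℝ v
  have h1 : ∫ y, fderiv ℝ F y v = 0 := by
    have := integral_mul_fderiv_eq_neg_fderiv_mul_of_integrable (μ := (volume : Measure Plane))
      (f := fun _ => (1 : ℝ)) (g := F) (v := v) (by simp)
      (by simpa using hdc.integrable_of_hasCompactSupport hds)
      (by simpa using hFC.continuous.integrable_of_hasCompactSupport hFs)
      (fun _ _ => differentiableAt_const _) (fun y _ => hFC.differentiable (by norm_num) y)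
    simpa using this
  have h2 : ∫ y in U, fderiv ℝ F y v = ∫ y, fderiv ℝ F y v :=
    setIntegral_eq_integral_of_forall_compl_eq_zero fun y hy => by
      rw [(hF0 y fun h => hy (hKU h)).fderiv_eq]
      simp
  rw [← h1, ← h2]
  exact setIntegral_congr_fun hU.measurableSet fun y hy => (dirD_congr (hF1 y hy)).symm

lemma hasDerivAt_setIntegral {J : Set ℝ} (hJ : IsOpen J) {t : ℝ} (ht : t ∈ J) {F : ℝ × Plane → ℝ}
    (hU : IsOpen U) (hK : IsCompact K) (hKU : K ⊆ U) (hF : ContDiffOn ℝ 1 F (J ×ˢ U))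
    (h0 : ∀ s ∈ J, ∀ y ∈ U \ K, F (s, y) = 0) :
    HasDerivAt (fun s => ∫ y in U, F (s, y)) (∫ y in U, dirD vt F (t, y)) t := by
  have hJU := hJ.prod hU
  obtain ⟨ε, hε, hball⟩ := Metric.nhds_basis_closedBall.mem_iff.1 (hJ.mem_nhds ht)
  have hD : ContinuousOn (dirD vt F) (J ×ˢ U) :=
    (contDiffOn_dirD (n := 0) hF hJU (by norm_num) vt).continuousOn
  have hslice : ∀ s ∈ J, ∀ {H : ℝ × Plane → ℝ}, ContinuousOn H (J ×ˢ U) →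
      ContinuousOn (fun y => H (s, y)) U := fun s hs H hH =>
    hH.comp (by fun_prop) fun y hy => ⟨hs, hy⟩
  have hd : ∀ s ∈ J, ∀ y ∈ U, HasDerivAt (fun s => F (s, y)) (dirD vt F (s, y)) s :=
    fun s hs y hy => hasDerivAt_slice (hF.differentiableAt_of_isOpen hJU (by norm_num) ⟨hs, hy⟩)
  have hD0 : ∀ s ∈ J, ∀ y ∈ U \ K, dirD vt F (s, y) = 0 := by
    intro s hs y hy
    refine (hd s hs y hy.1).unique ((hasDerivAt_const s (0 : ℝ)).congr_of_eventuallyEq ?_)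
    exact Filter.eventuallyEq_of_mem (hJ.mem_nhds hs) fun r hr => h0 r hr y hy
  -- A bound for the time derivative on a compact time interval times K. Off K that derivative
  -- vanishes, so C on K and 0 elsewhere is an integrable majorant.
  obtain ⟨C, hC⟩ := ((isCompact_closedBall t ε).prod hK).exists_bound_of_continuousOn
    (hD.mono (Set.prod_mono hball hKU))
  have hint : ∀ s ∈ J, Integrable (fun y => F (s, y)) (volume.restrict U) := fun s hs =>
    integrableOn_of_eq_zero_off_compact hU hK hKU (hslice s hs hF.continuousOn) (h0 s hs)
  refine (hasDerivAt_integral_of_dominated_loc_of_deriv_le (F := fun s y => F (s, y))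
    (F' := fun s y => dirD vt F (s, y)) (bound := K.indicator fun _ => C)
    (Metric.closedBall_mem_nhds t hε) ?_ (hint t ht) ?_ ?_ ?_ ?_).2
  · filter_upwards [hJ.mem_nhds ht] with s hs
    exact (hint s hs).aestronglyMeasurable
  · exact ((hslice t ht hD).aestronglyMeasurable hU.measurableSet)
  · refine (ae_restrict_iff' hU.measurableSet).2 (Filter.Eventually.of_forall fun y hy s hs => ?_)
    by_cases hyK : y ∈ K
    · rw [Set.indicator_of_mem hyK]
      exact hC (s, y) ⟨hs, hyK⟩
    · rw [hD0 s (hball hs) y ⟨hy, hyK⟩, Set.indicator_of_notMem hyK, norm_zero]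
  · refine (IntegrableOn.integrable_indicator ?_ hK.measurableSet).mono_measure
      Measure.restrict_le_self
    exact continuousOn_const.integrableOn_compact hK
  · exact (ae_restrict_iff' hU.measurableSet).2
      (Filter.Eventually.of_forall fun y hy s hs => hd s (hball hs) y hy)

lemma det_fderiv {Φ : Plane → Plane} {y : Plane} (h : DifferentiableAt ℝ Φ y) :
    (fderiv ℝ Φ y).det = (Matrix.of (jac Φ y)).det := by
  rw [ContinuousLinearMap.det, ← LinearMap.det_toMatrix (EuclideanSpace.basisFun (Fin 2) ℝ).toBasis]
  congr 1
  ext i a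
  rw [LinearMap.toMatrix_apply]
  simp [jac_eq_fderiv h]

end PlaneIntegrals

/-! ### The area measure -/

section Area

variable {M : Type*} [TopologicalSpace M] [ChartedSpace Plane M] [IsManifold (𝓡 2) ∞ M]
  {S : Slicing M} {J : Set ℝ} {τ : ℝ → ℝ} {u : ℝ → M → ℝ} {t : ℝ}
  {e e' : OpenPartialHomeomorph M Plane}

/-- The area density in the chart `e`. -/
def Slicing.density (S : Slicing M) (e : OpenPartialHomeomorph M Plane) (t : ℝ) (y : Plane) : ℝ :=
  Real.sqrt (S.G e t y).det

namespace Slicing.IsSolution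

variable (hS : S.IsSolution J τ u)
include hS

/-- From g = Aᵀ g' A, with A the Jacobian matrix: the determinant acquires (det A)² and its square
root |det A|. -/
lemma density_change (he : e ∈ atlas Plane M) (he' : e' ∈ atlas Plane M) (ht : t ∈ J) {y : Plane}
    (hy : y ∈ overlap e e') :
    S.density e t y
      = |(fderiv ℝ (coordChange e e') y).det| * S.density e' t (coordChange e e' y) := by
  have h1 : (S.G e t y).det = (Matrix.of (jac (coordChange e e') y)).det ^ 2
      * (S.G e' t (coordChange e e' y)).det := by
    simp only [Matrix.det_fin_two, Matrix.of_apply, S.G_change t he he' hy, Fin.sum_univ_two,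
      hS.G_symm ht _ 1 0]
    ring
  rw [det_fderiv (differentiableAt_coordChange he he' hy), density, density, h1,
    Real.sqrt_mul (sq_nonneg _), Real.sqrt_sq_eq_abs]

/-- As H vanishes off both chart domains, both integrals live on the overlap. There the factor |det|
of the density is exactly the one in the change of variables formula. -/
lemma integral_chart_change (he : e ∈ atlas Plane M) (he' : e' ∈ atlas Plane M) (ht : t ∈ J)
    {H : M → ℝ} (h1 : ∀ x ∉ e.source, H x = 0) (h2 : ∀ x ∉ e'.source, H x = 0) :
    ∫ y in e.target, S.density e t y * H (e.symm y)
      = ∫ y in e'.target, S.density e' t y * H (e'.symm y) := by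
  have himage : coordChange e e' '' overlap e e' = overlap e' e := by
    ext z
    constructor
    · rintro ⟨y, hy, rfl⟩
      refine mem_overlap.2 ⟨coordChange_mem hy, ?_⟩
      rw [symm_coordChange hy]
      exact e.map_target (mem_overlap.1 hy).1
    · intro hz
      refine ⟨coordChange e' e z, mem_overlap.2 ⟨coordChange_mem hz, ?_⟩, ?_⟩
      · rw [symm_coordChange hz]
        exact e'.map_target (mem_overlap.1 hz).1
      · rw [coordChange, symm_coordChange hz, e'.right_inv (mem_overlap.1 hz).1]
  have hinj : Set.InjOn (coordChange e e') (overlap e e') := by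
    intro y hy z hz h
    have h3 : e.symm y = e.symm z := by rw [← symm_coordChange hy, ← symm_coordChange hz, h]
    exact e.symm.injOn (mem_overlap.1 hy).1 (mem_overlap.1 hz).1 h3
  rw [setIntegral_eq_of_subset_of_forall_sdiff_eq_zero e.open_target.measurableSet
      (s := overlap e e') (fun y hy => (mem_overlap.1 hy).1) fun y hy => by
        rw [h2 _ fun h => hy.2 (mem_overlap.2 ⟨hy.1, h⟩), mul_zero],
    setIntegral_eq_of_subset_of_forall_sdiff_eq_zero e'.open_target.measurableSet
      (s := overlap e' e) (fun y hy => (mem_overlap.1 hy).1) fun y hy => by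
        rw [h1 _ fun h => hy.2 (mem_overlap.2 ⟨hy.1, h⟩), mul_zero],
    ← himage, integral_image_eq_integral_abs_det_fderiv_smul volume isOpen_overlap.measurableSet
      (fun y hy => (differentiableAt_coordChange he he' hy).hasFDerivAt.hasFDerivWithinAt) hinj]
  refine setIntegral_congr_fun isOpen_overlap.measurableSet fun y hy => ?_
  simp only [smul_eq_mul]
  rw [symm_coordChange hy, hS.density_change he he' ht hy, mul_assoc]

omit [IsManifold (𝓡 2) ∞ M] in
lemma continuousOn_density (he : e ∈ atlas Plane M) (ht : t ∈ J) :
    ContinuousOn (S.density e t) e.target := by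
  have h : ∀ a b, ContinuousOn (fun y => S.G e t y a b) e.target := fun a b =>
    (hS.g_reg e he a b).continuousOn.comp (f := fun y => (t, y)) (by fun_prop)
      fun y hy => ⟨ht, hy⟩
  refine ContinuousOn.sqrt ?_
  simp only [Matrix.det_fin_two]
  exact ((h 0 0).mul (h 1 1)).sub ((h 0 1).mul (h 1 0))

end Slicing.IsSolution

omit [IsManifold (𝓡 2) ∞ M] in
/-- A function is continuous if it is in every chart. -/
lemma continuous_of_charts {f : M → ℝ}
    (h : ∀ e ∈ atlas Plane M, ContinuousOn (f ∘ e.symm) e.target) : Continuous f := by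
  refine continuous_iff_continuousAt.2 fun x => ?_
  set e := chartAt Plane x
  have hx : x ∈ e.source := mem_chart_source Plane x
  have h1 : ContinuousAt ((f ∘ e.symm) ∘ e) x :=
    ((h e (chart_mem_atlas Plane x)).continuousAt (e.open_target.mem_nhds (e.map_source hx))).comp
      (e.continuousAt hx)
  refine h1.congr (Filter.eventuallyEq_of_mem (e.open_source.mem_nhds hx) fun z hz => ?_)
  simp [e.left_inv hz]

variable [T2Space M] [CompactSpace M]

variable (M) in
/-- The partition of unity which glues the area measure. -/
def chartPartition : SmoothPartitionOfUnity M (𝓡 2) M Set.univ :=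
  (SmoothPartitionOfUnity.exists_isSubordinate (M := M) (𝓡 2) isClosed_univ
    (fun p : M => (chartAt Plane p).source) (fun p => (chartAt Plane p).open_source)
    (fun p _ => Set.mem_iUnion.2 ⟨p, mem_chart_source Plane p⟩)).choose

lemma chartPartition_isSubordinate :
    (chartPartition M).IsSubordinate fun p : M => (chartAt Plane p).source :=
  (SmoothPartitionOfUnity.exists_isSubordinate (M := M) (𝓡 2) isClosed_univ
    (fun p : M => (chartAt Plane p).source) (fun p => (chartAt Plane p).open_source)
    (fun p _ => Set.mem_iUnion.2 ⟨p, mem_chart_source Plane p⟩)).choose_spec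

lemma finite_chartPartition : {p : M | (Function.support (chartPartition M p)).Nonempty}.Finite :=
  (chartPartition M).locallyFinite.finite_nonempty_of_compact

variable (M) in
/-- The finitely many charts which contribute to the area measure. -/
def activeCharts : Finset M := (finite_chartPartition (M := M)).toFinset

lemma chartPartition_eq_zero {p : M} (hp : p ∉ activeCharts M) (x : M) :
    chartPartition M p x = 0 := by
  by_contra h
  exact hp ((finite_chartPartition (M := M)).mem_toFinset.2 ⟨x, h⟩)

lemma sum_chartPartition (x : M) : ∑ p ∈ activeCharts M, chartPartition M p x = 1 := by
  rw [← (chartPartition M).sum_eq_one (Set.mem_univ x), finsum_eq_sum_of_support_subset]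
  intro p hp
  by_contra h
  exact hp (chartPartition_eq_zero h x)

/-- The compact set of the coordinate plane in which a partition function lives. -/
def partitionCarrier (p : M) : Set Plane := chartAt Plane p '' tsupport (chartPartition M p)

lemma isCompact_partitionCarrier (p : M) : IsCompact (partitionCarrier p) :=
  (isClosed_tsupport _).isCompact.image_of_continuousOn
    ((chartAt Plane p).continuousOn.mono (chartPartition_isSubordinate p))

lemma partitionCarrier_subset (p : M) : partitionCarrier p ⊆ (chartAt Plane p).target := by
  rintro _ ⟨x, hx, rfl⟩
  exact (chartAt Plane p).map_source (chartPartition_isSubordinate p hx)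

lemma notMem_tsupport_of_notMem_carrier {p : M} {y : Plane}
    (hy : y ∈ (chartAt Plane p).target \ partitionCarrier p) :
    (chartAt Plane p).symm y ∉ tsupport (chartPartition M p) := fun h =>
  hy.2 ⟨_, h, (chartAt Plane p).right_inv hy.1⟩

lemma chartPartition_symm_eq_zero {p : M} {y : Plane}
    (hy : y ∈ (chartAt Plane p).target \ partitionCarrier p) :
    chartPartition M p ((chartAt Plane p).symm y) = 0 :=
  image_eq_zero_of_notMem_tsupport (notMem_tsupport_of_notMem_carrier hy)

lemma contDiffOn_chartPartition (he : e ∈ atlas Plane M) (p : M) :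
    ContDiffOn ℝ ∞ (chartPartition M p ∘ e.symm) e.target :=
  ((chartPartition M p).contMDiff.comp_contMDiffOn
    (contMDiffOn_symm_of_mem_maximalAtlas (IsManifold.subset_maximalAtlas he))).contDiffOn

variable [MeasurableSpace M] [BorelSpace M]

/-- The part of the area measure coming from one chart. -/
def Slicing.areaPart (S : Slicing M) (t : ℝ) (p : M) : Measure M :=
  (Measure.map (chartAt Plane p).symm
      ((volume.restrict (chartAt Plane p).target).withDensity
        fun y => ENNReal.ofReal (Real.sqrt (S.G (chartAt Plane p) t y).det))).withDensity
      fun x => ENNReal.ofReal (chartPartition M p x)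

omit [BorelSpace M] in
lemma Slicing.area_eq_sum (S : Slicing M) (t : ℝ) :
    S.area t = ∑ p ∈ activeCharts M, S.areaPart t p := by
  -- Definitional, because `chartPartition` is the very choice made in `area`.
  have h : S.area t = Measure.sum fun p => S.areaPart t p := rfl
  ext s hs
  rw [h, Measure.sum_apply _ hs, Measure.finsetSum_apply, tsum_eq_sum]
  intro p hp
  have : S.areaPart t p = 0 := by
    simp [areaPart, chartPartition_eq_zero hp]
  simp [this]

namespace Slicing.IsSolution

variable (hS : S.IsSolution J τ u) (ht : t ∈ J)
include hS ht

/-- Both densities and the push-forward unfold to a plane integral. The partition function confines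
the integrand to a compact subset of the chart, where continuity gives integrability. -/
lemma integral_areaPart {F : M → ℝ} (hF : Continuous F) (p : M) :
    Integrable F (S.areaPart t p) ∧ ∫ x, F x ∂(S.areaPart t p)
      = ∫ y in (chartAt Plane p).target, S.density (chartAt Plane p) t y
        * (chartPartition M p ((chartAt Plane p).symm y) * F ((chartAt Plane p).symm y)) := by
  set e := chartAt Plane p
  have he : e ∈ atlas Plane M := chart_mem_atlas Plane p
  have hr := hS.continuousOn_density he ht
  have hm := e.open_target.measurableSet
  set ν := (volume.restrict e.target).withDensity
    fun y => ENNReal.ofReal (Real.sqrt (S.G e t y).det) with hν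
  have hρ : Continuous (chartPartition M p) := (chartPartition M p).contMDiff.continuous
  have hsymm : AEMeasurable e.symm ν :=
    (e.continuousOn_symm.aemeasurable hm).mono_ac (withDensity_absolutelyContinuous _ _)
  have hdm : AEMeasurable (fun y => ENNReal.ofReal (Real.sqrt (S.G e t y).det))
      (volume.restrict e.target) := (hr.aemeasurable hm).ennreal_ofReal
  have hρm : Measurable fun x => ENNReal.ofReal (chartPartition M p x) :=
    hρ.measurable.ennreal_ofReal
  have hρr : ∀ x, (ENNReal.ofReal (chartPartition M p x)).toReal = chartPartition M p x :=
    fun x => ENNReal.toReal_ofReal ((chartPartition M).nonneg p x)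
  have hrr : ∀ y, (ENNReal.ofReal (Real.sqrt (S.G e t y).det)).toReal = S.density e t y :=
    fun y => ENNReal.toReal_ofReal (Real.sqrt_nonneg _)
  have hFm : AEStronglyMeasurable (fun x => chartPartition M p x • F x)
      (Measure.map e.symm ν) := (hρ.smul hF).aestronglyMeasurable
  constructor
  · rw [areaPart, integrable_withDensity_iff_integrable_smul' hρm (by simp)]
    simp only [hρr]
    rw [integrable_map_measure hFm hsymm, hν,
      integrable_withDensity_iff_integrable_smul₀' hdm (by simp)]
    simp only [hrr]
    refine integrableOn_of_eq_zero_off_compact e.open_target (isCompact_partitionCarrier p)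
      (partitionCarrier_subset p) ?_ fun y hy => ?_
    · exact hr.smul ((hρ.smul hF).comp_continuousOn e.continuousOn_symm)
    · simp [e, chartPartition_symm_eq_zero hy]
  · rw [areaPart, integral_withDensity_eq_integral_toReal_smul hρm (by simp)]
    simp only [hρr]
    rw [integral_map hsymm hFm, hν, integral_withDensity_eq_integral_toReal_smul₀ hdm (by simp)]
    simp only [hrr, smul_eq_mul]

lemma integrable_of_continuous {F : M → ℝ} (hF : Continuous F) : Integrable F (S.area t) := by
  rw [S.area_eq_sum, integrable_finsetSum_measure]
  exact fun p _ => (hS.integral_areaPart ht hF p).1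

lemma integral_eq_sum {F : M → ℝ} (hF : Continuous F) : ∫ x, F x ∂(S.area t)
    = ∑ p ∈ activeCharts M, ∫ y in (chartAt Plane p).target, S.density (chartAt Plane p) t y
        * (chartPartition M p ((chartAt Plane p).symm y) * F ((chartAt Plane p).symm y)) := by
  rw [S.area_eq_sum, integral_finsetSum_measure fun p _ => (hS.integral_areaPart ht hF p).1]
  exact Finset.sum_congr rfl fun p _ => (hS.integral_areaPart ht hF p).2

end Slicing.IsSolution

end Area

/-! ### The divergence theorem -/

section DivergenceTheorem

variable {M : Type*} [TopologicalSpace M] [ChartedSpace Plane M] [IsManifold (𝓡 2) ∞ M]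
  {S : Slicing M} {J : Set ℝ} {τ : ℝ → ℝ} {u : ℝ → M → ℝ} {t : ℝ}
  [T2Space M] [CompactSpace M]

lemma pd_chartPartition_eq_zero {e : OpenPartialHomeomorph M Plane} {p : M} {y : Plane}
    (hy : y ∈ e.target) (h : e.symm y ∉ tsupport (chartPartition M p)) (a : Fin 2) :
    pd a (chartPartition M p ∘ e.symm) y = 0 := by
  have hev : chartPartition M p ∘ e.symm =ᶠ[nhds y] fun _ => 0 := by
    have h1 : ∀ᶠ x in nhds (e.symm y), x ∉ tsupport (chartPartition M p) :=
      (isClosed_tsupport _).isOpen_compl.mem_nhds h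
    filter_upwards [(e.continuousAt_symm hy).eventually h1] with z hz
    exact image_eq_zero_of_notMem_tsupport (f := chartPartition M p) hz
  exact (dirD_congr hev).trans (dirD_const 0)

/-- The divergence theorem on the surface. The vector field is given by its components `X p` in
the charts, and `D q` is the derivative of the `q`-th partition function along it. -/
theorem Slicing.IsSolution.sum_integral_divergence (hS : S.IsSolution J τ u) (ht : t ∈ J)
    {X : M → Fin 2 → Plane → ℝ} {D : M → M → ℝ}
    (hX : ∀ p a, ContDiffOn ℝ 1 (X p a) (chartAt Plane p).target)
    (hr : ∀ p, ContDiffOn ℝ 1 (S.density (chartAt Plane p) t) (chartAt Plane p).target)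
    (hD : ∀ p q, ∀ y ∈ (chartAt Plane p).target, D q ((chartAt Plane p).symm y)
      = ∑ a, X p a y * pd a (chartPartition M q ∘ (chartAt Plane p).symm) y) :
    ∑ p ∈ activeCharts M, ∫ y in (chartAt Plane p).target,
      chartPartition M p ((chartAt Plane p).symm y)
        * ∑ a, pd a (fun z => S.density (chartAt Plane p) t z * X p a z) y = 0 := by
  set c : M → OpenPartialHomeomorph M Plane := fun p => chartAt Plane p with hc
  change ∑ p ∈ activeCharts M, ∫ y in (c p).target, chartPartition M p ((c p).symm y)
        * ∑ a, pd a (fun z => S.density (c p) t z * X p a z) y = 0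
  have hca : ∀ p, c p ∈ atlas Plane M := fun p => chart_mem_atlas Plane p
  have hρ : ∀ p q, ContDiffOn ℝ ∞ (chartPartition M q ∘ (c p).symm) (c p).target := fun p q =>
    contDiffOn_chartPartition (hca p) q
  have hρ1 : ∀ p q, ContDiffOn ℝ 1 (chartPartition M q ∘ (c p).symm) (c p).target := fun p q =>
    (hρ p q).of_le ENat.LEInfty.out
  have hop : ∀ p, IsOpen (c p).target := fun p => (c p).open_target
  have hDc : ∀ p q, ContinuousOn (fun y => D q ((c p).symm y)) (c p).target := fun p q => by
    refine ContinuousOn.congr (f := fun y => ∑ a, X p a y * pd a (chartPartition M q ∘ (c p).symm) y)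
      ?_ (hD p q)
    exact continuousOn_finsetSum _ fun a _ => (hX p a).continuousOn.mul
      (contDiffOn_dirD (n := 0) (hρ1 p q) (hop p) (by norm_num) _).continuousOn
  -- Read in the preferred chart at x: off the closed support the partition function vanishes near
  -- x, and so do its derivatives.
  have hD0 : ∀ q x, x ∉ tsupport (chartPartition M q) → D q x = 0 := by
    intro q x hx
    have hxs := mem_chart_source Plane x
    have h1 := hD x q (c x x) ((c x).map_source hxs)
    have h2 : (c x).symm (c x x) = x := (c x).left_inv hxs
    rw [h2] at h1
    rw [h1]
    refine Finset.sum_eq_zero fun a _ => ?_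
    rw [pd_chartPartition_eq_zero ((c x).map_source hxs) (by rwa [h2]), mul_zero]
  -- Integration by parts inside one chart: the total derivative of ρ_p √(det g) X^a integrates to
  -- zero.
  have step1 : ∀ p, ∫ y in (c p).target, chartPartition M p ((c p).symm y)
        * ∑ a, pd a (fun z => S.density (c p) t z * X p a z) y
      = -∫ y in (c p).target, S.density (c p) t y * D p ((c p).symm y) := by
    intro p
    have hrX : ∀ a, ContDiffOn ℝ 1 (fun z => S.density (c p) t z * X p a z) (c p).target :=
      fun a => (hr p).mul (hX p a)
    have hint1 : IntegrableOn (fun y => chartPartition M p ((c p).symm y)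
        * ∑ a, pd a (fun z => S.density (c p) t z * X p a z) y) (c p).target := by
      refine integrableOn_of_eq_zero_off_compact (hop p) (isCompact_partitionCarrier p)
        (partitionCarrier_subset p) ?_ fun y hy => ?_
      · exact (hρ1 p p).continuousOn.mul (continuousOn_finsetSum _ fun a _ =>
          (contDiffOn_dirD (n := 0) (hrX a) (hop p) (by norm_num) _).continuousOn)
      · rw [chartPartition_symm_eq_zero hy, zero_mul]
    have hint2 : IntegrableOn (fun y => S.density (c p) t y * D p ((c p).symm y)) (c p).target := by
      refine integrableOn_of_eq_zero_off_compact (hop p) (isCompact_partitionCarrier p)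
        (partitionCarrier_subset p) ((hr p).continuousOn.mul (hDc p p)) fun y hy => ?_
      rw [hD0 p _ (notMem_tsupport_of_notMem_carrier hy), mul_zero]
    rw [eq_neg_iff_add_eq_zero, ← integral_add hint1 hint2]
    have hΨ : ∀ a, ContDiffOn ℝ 1 (fun z => (chartPartition M p ∘ (c p).symm) z
        * (S.density (c p) t z * X p a z)) (c p).target := fun a => (hρ1 p p).mul (hrX a)
    have hΨ0 : ∀ a, ∀ y ∈ (c p).target \ partitionCarrier p,
        (chartPartition M p ∘ (c p).symm) y * (S.density (c p) t y * X p a y) = 0 :=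
      fun a y hy => by
        rw [Function.comp_apply, chartPartition_symm_eq_zero hy, zero_mul]
    have h0 : ∀ a, ∫ y in (c p).target, pd a (fun z => (chartPartition M p ∘ (c p).symm) z
        * (S.density (c p) t z * X p a z)) y = 0 := fun a =>
      setIntegral_dirD_eq_zero (hop p) (isCompact_partitionCarrier p)
        (partitionCarrier_subset p) (hΨ a) (hΨ0 a) _
    have hprod : ∀ a, ∀ y ∈ (c p).target, pd a (fun z => (chartPartition M p ∘ (c p).symm) z
        * (S.density (c p) t z * X p a z)) y
        = pd a (chartPartition M p ∘ (c p).symm) y * (S.density (c p) t y * X p a y)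
          + chartPartition M p ((c p).symm y)
            * pd a (fun z => S.density (c p) t z * X p a z) y := fun a y hy =>
      dirD_mul ((hρ1 p p).differentiableAt_of_isOpen (hop p) (by norm_num) hy)
        ((hrX a).differentiableAt_of_isOpen (hop p) (by norm_num) hy)
    have hint3 : ∀ a, IntegrableOn (pd a (fun z => (chartPartition M p ∘ (c p).symm) z
        * (S.density (c p) t z * X p a z))) (c p).target := fun a => by
      refine integrableOn_of_eq_zero_off_compact (hop p) (isCompact_partitionCarrier p)
        (partitionCarrier_subset p)
        (contDiffOn_dirD (n := 0) (hΨ a) (hop p) (by norm_num) _).continuousOn fun y hy => ?_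
      rw [hprod a y hy.1, chartPartition_symm_eq_zero hy,
        pd_chartPartition_eq_zero hy.1 (notMem_tsupport_of_notMem_carrier hy), zero_mul, zero_mul,
        add_zero]
    calc _ = ∫ y in (c p).target, ∑ a, pd a (fun z => (chartPartition M p ∘ (c p).symm) z
          * (S.density (c p) t z * X p a z)) y := by
          refine setIntegral_congr_fun (hop p).measurableSet fun y hy => ?_
          have hDy : D p ((c p).symm y)
              = ∑ a, X p a y * pd a (chartPartition M p ∘ (c p).symm) y := hD p p y hy
          simp only [hprod _ y hy, hDy, Fin.sum_univ_two]
          ring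
      _ = 0 := by
          rw [integral_finsetSum _ fun a _ => hint3 a]
          simp only [h0, Finset.sum_const_zero]
  have hint4 : ∀ p q, IntegrableOn (fun y => S.density (c q) t y
      * (chartPartition M q ((c q).symm y) * D p ((c q).symm y))) (c q).target := fun p q => by
    refine integrableOn_of_eq_zero_off_compact (hop q) (isCompact_partitionCarrier q)
      (partitionCarrier_subset q)
      ((hr q).continuousOn.mul ((hρ1 q q).continuousOn.mul (hDc q p))) fun y hy => ?_
    rw [chartPartition_symm_eq_zero hy, zero_mul, mul_zero]
  have hint5 : ∀ p q, IntegrableOn (fun y => S.density (c p) t y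
      * (chartPartition M q ((c p).symm y) * D p ((c p).symm y))) (c p).target := fun p q => by
    refine integrableOn_of_eq_zero_off_compact (hop p) (isCompact_partitionCarrier p)
      (partitionCarrier_subset p)
      ((hr p).continuousOn.mul ((hρ1 p q).continuousOn.mul (hDc p p))) fun y hy => ?_
    rw [hD0 p _ (notMem_tsupport_of_notMem_carrier hy), mul_zero, mul_zero]
  -- Insert 1 = Σ_q ρ_q and move each summand to chart q. The invariance of X is used only through
  -- `hD`, which makes its derivative of ρ_p a function on the surface.
  have step2 : ∀ p, ∫ y in (c p).target, S.density (c p) t y * D p ((c p).symm y)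
      = ∑ q ∈ activeCharts M, ∫ y in (c q).target, S.density (c q) t y
        * (chartPartition M q ((c q).symm y) * D p ((c q).symm y)) := by
    intro p
    have h1 : ∀ q, ∫ y in (c q).target, S.density (c q) t y
        * (chartPartition M q ((c q).symm y) * D p ((c q).symm y))
        = ∫ y in (c p).target, S.density (c p) t y
        * (chartPartition M q ((c p).symm y) * D p ((c p).symm y)) := by
      intro q
      refine hS.integral_chart_change (hca q) (hca p) ht
        (H := fun x => chartPartition M q x * D p x) (fun x hx => ?_) fun x hx => ?_
      · rw [image_eq_zero_of_notMem_tsupport fun h => hx (chartPartition_isSubordinate q h), zero_mul]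
      · rw [hD0 p x fun h => hx (chartPartition_isSubordinate p h), mul_zero]
    simp only [h1]
    rw [← integral_finsetSum _ fun q _ => hint5 p q]
    congr 1
    funext y
    rw [← Finset.mul_sum, ← Finset.sum_mul, sum_chartPartition, one_mul]
  -- In the fixed chart q, Σ_p X(ρ_p) = X(1) = 0.
  have step3 : ∀ q, ∑ p ∈ activeCharts M, ∫ y in (c q).target, S.density (c q) t y
        * (chartPartition M q ((c q).symm y) * D p ((c q).symm y)) = 0 := by
    intro q
    rw [← integral_finsetSum _ fun p _ => hint4 p q]
    refine setIntegral_eq_zero_of_forall_eq_zero fun y hy => ?_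
    have h1 : ∀ a, ∑ p ∈ activeCharts M, pd a (chartPartition M p ∘ (c q).symm) y = 0 := by
      intro a
      have h2 := dirD_sum (v := (EuclideanSpace.single a (1 : ℝ) : Plane)) (z := y) (activeCharts M)
        (f := fun p => chartPartition M p ∘ (c q).symm) fun p _ =>
          (hρ1 q p).differentiableAt_of_isOpen (hop q) (by norm_num) hy
      rw [pd_eq_dirD, ← h2]
      have h3 : (fun z => ∑ p ∈ activeCharts M, (chartPartition M p ∘ (c q).symm) z)
          = fun _ => (1 : ℝ) := funext fun z => sum_chartPartition _
      rw [h3, dirD_const]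
    have h4 : ∑ p ∈ activeCharts M, D p ((c q).symm y) = 0 := by
      rw [Finset.sum_congr rfl fun p _ => hD q p y hy, Finset.sum_comm]
      refine Finset.sum_eq_zero fun a _ => ?_
      rw [← Finset.mul_sum, h1, mul_zero]
    rw [← Finset.mul_sum, ← Finset.mul_sum, h4, mul_zero, mul_zero]
  simp only [step1, Finset.sum_neg_distrib, step2]
  rw [Finset.sum_comm, Finset.sum_eq_zero fun q _ => step3 q, neg_zero]

end DivergenceTheorem

/-! ### The energy identity on the surface -/

section EnergyIdentity

variable {M : Type*} [TopologicalSpace M] [ChartedSpace Plane M] [IsManifold (𝓡 2) ∞ M]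
  {S : Slicing M} {J : Set ℝ} {τ : ℝ → ℝ} {u : ℝ → M → ℝ} {t : ℝ}
  {e : OpenPartialHomeomorph M Plane} {z : ℝ × Plane}

lemma dNorm_congr {U : Set (ℝ × Plane)} (hU : IsOpen U) (hz : z ∈ U) {n : Fin 2 → ℝ × Plane → ℝ}
    {f f' : ℝ × Plane → ℝ} (h : Set.EqOn f f' U) : dNorm n f z = dNorm n f' z := by
  simp only [dNorm, dirD_congr_of_eqOn hU hz h]

lemma exp_logDensity {g : ℝ × Plane → Matrix (Fin 2) (Fin 2) ℝ} (h : 0 < (g z).det) :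
    Real.exp (logDensity g z) = Real.sqrt (g z).det := by
  rw [Real.sqrt_eq_rpow, Real.rpow_def_of_pos h, logDensity, mul_comm]

/-- The density turns the covariant divergence into a plain coordinate divergence, the form needed
for integration by parts in a chart. -/
lemma IsMetricOn.exp_mul_dvg {U : Set (ℝ × Plane)} {g : ℝ × Plane → Matrix (Fin 2) (Fin 2) ℝ}
    (hg : IsMetricOn U g) {X : Fin 2 → ℝ × Plane → ℝ} (hX : ∀ a, DifferentiableAt ℝ (X a) z)
    (hz : z ∈ U) : Real.exp (logDensity g z) * dvg g X z
      = ∑ a, dirD (vx a) (fun y => Real.exp (logDensity g y) * X a y) z := by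
  have hL : DifferentiableAt ℝ (logDensity g) z :=
    hg.contDiff_logDensity.differentiableAt_of_isOpen hg.isOpen (by norm_num) hz
  have h1 : ∀ v, dirD v (fun y => Real.exp (logDensity g y)) z = _ := fun v =>
    dirD_comp (Real.hasDerivAt_exp _) hL
  simp only [dvg, dirD_mul hL.exp (hX _), h1, Fin.sum_univ_two]
  ring

namespace Slicing.IsSolution

variable (hS : S.IsSolution J τ u) (hJ : IsOpen J)
include hS hJ

/-- Since u' is itself differentiated in the energy and in the wave equation, it must count as a
regular function on the surface: C² because u is C³ and the lapse and shift are C². -/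
lemma regular_prime : RegularOn 2 J (S.prime u) := fun e he =>
  ((hS.isSlicingOn hJ he).contDiff_prm (k := 2) le_rfl
    ((hS.u_reg e he).of_le (by norm_num))).congr fun z hz =>
      prime_eq hJ he hz.1 hz.2 hS.u_reg (by norm_num)

lemma regular_gradInner : RegularOn 1 J (fun t => S.gradInner t (S.N t) (u t)) := fun e he =>
  ((hS.isSlicingOn hJ he).contDiff_grdInner (hS.N_reg e he)
    ((hS.u_reg e he).of_le (by norm_num))).congr fun z hz =>
      hS.gradInner_eq hJ he hz.1 hz.2 hS.N_reg (by norm_num) hS.u_reg (by norm_num)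

section InChart

variable (he : e ∈ atlas Plane M)
include he

lemma eqOn_prime : Set.EqOn (inChart e (S.prime u))
    (prm (inChart e S.N) (S.jointShift e) (inChart e u)) (J ×ˢ e.target) := fun z hz =>
  prime_eq hJ he hz.1 hz.2 hS.u_reg (by norm_num)

lemma dirD_prime (hz : z ∈ J ×ˢ e.target) (v : ℝ × Plane) : dirD v (inChart e (S.prime u)) z
    = dirD v (prm (inChart e S.N) (S.jointShift e) (inChart e u)) z :=
  dirD_congr_of_eqOn (hJ.prod e.open_target) hz (hS.eqOn_prime hJ he)

lemma lap_u_eq (hz : z ∈ J ×ˢ e.target) :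
    S.lap z.1 (u z.1) (e.symm z.2) = lapl (S.jointG e) (inChart e u) z :=
  hS.lap_eq hJ he hz.1 hz.2 fun e he => (hS.u_reg e he).of_le (by norm_num)

lemma J0_eq (hz : z ∈ J ×ˢ e.target) : S.J0 u z.1 (e.symm z.2)
    = locJ0 (S.jointG e) (inChart e S.N) (S.jointShift e) (inChart e u) z := by
  have hp := hS.regular_prime hJ
  have h := hS.gradInner_eq hJ he hz.1 hz.2 hp (by norm_num) hp (by norm_num)
  simp only [J0, locJ0, h]
  simp only [grdInner, Prod.mk.eta, hS.dirD_prime hJ he hz]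

lemma J1_eq (hz : z ∈ J ×ˢ e.target) : S.J1 u z.1 (e.symm z.2)
    = locJ1 (S.jointG e) (inChart e u) z := by
  simp only [J1, locJ1, hS.lap_u_eq hJ he hz]

/-- The nested terms differentiate u' and ∂^a N ∂_a u. Their chart expressions hold on the whole
open chart domain, hence may be differentiated. -/
lemma ZDensity_eq (hz : z ∈ J ×ˢ e.target) : S.ZDensity τ u z.1 (e.symm z.2)
    = locZ (S.jointG e) (inChart e S.N) (S.jointShift e) (fun z => τ z.1) (inChart e u) z := by
  have hp := hS.regular_prime hJ
  have hN : RegularOn 2 J S.N := hS.N_reg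
  have hu : RegularOn 3 J u := hS.u_reg
  have hu2 : RegularOn 2 J u := fun e he => (hu e he).of_le (by norm_num)
  have hq := hS.regular_gradInner hJ
  have h1 := hS.hGrad_eq hJ he hz.1 hz.2 hp (by norm_num) hp (by norm_num)
  have h2 := hS.hHess_eq hJ he hz.1 hz.2 hu2
  have h3 := hS.gradInner_eq hJ he hz.1 hz.2 hq (by norm_num) hp (by norm_num)
  have h4 := hS.gradInner_eq hJ he hz.1 hz.2 hN (by norm_num) hp (by norm_num)
  have h5 := hS.hGrad_eq hJ he hz.1 hz.2 hN (by norm_num) hu (by norm_num)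
  have h6 := hS.gradInner_eq hJ he hz.1 hz.2 hu (by norm_num) hu (by norm_num)
  have h7 := hS.lap_eq hJ he hz.1 hz.2 hN
  have h8 : S.prime u z.1 (e.symm z.2) = _ := hS.eqOn_prime hJ he hz
  have h9 := hS.lap_u_eq hJ he hz
  have h10 : ∀ v, dirD v (inChart e fun t => S.gradInner t (S.N t) (u t)) z
      = dirD v (grdInner (S.jointG e) (inChart e S.N) (inChart e u)) z := fun v =>
    dirD_congr_of_eqOn (hJ.prod e.open_target) hz fun z hz =>
      hS.gradInner_eq hJ he hz.1 hz.2 hN (by norm_num) hu (by norm_num)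
  have hd := hS.dirD_prime hJ he hz
  simp only [ZDensity, Y1Density, h1, h2, h3, h4, h5, h6, h7, h8, h9]
  simp only [locZ, locY1, Prod.mk.eta]
  have g1 : grdInner (S.jointG e) (inChart e fun t => S.gradInner t (S.N t) (u t))
      (inChart e (S.prime u)) z = grdInner (S.jointG e)
      (grdInner (S.jointG e) (inChart e S.N) (inChart e u))
      (prm (inChart e S.N) (S.jointShift e) (inChart e u)) z := by
    simp only [grdInner, hd, h10]
  have g2 : grdInner (S.jointG e) (inChart e S.N) (inChart e (S.prime u)) z
      = grdInner (S.jointG e) (inChart e S.N)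
      (prm (inChart e S.N) (S.jointShift e) (inChart e u)) z := by
    simp only [grdInner, hd]
  have g3 : ∀ T, tenGrad (S.jointG e) T (inChart e (S.prime u)) (inChart e (S.prime u)) z
      = tenGrad (S.jointG e) T (prm (inChart e S.N) (S.jointShift e) (inChart e u))
      (prm (inChart e S.N) (S.jointShift e) (inChart e u)) z := fun T => by
    simp only [tenGrad, hd]
  rw [g1, g2, g3]
  rfl

lemma contDiff_trc : ContDiffOn ℝ 1 (trc (S.jointG e) (S.jointK e)) (J ×ˢ e.target) :=
  have hs := hS.isSlicingOn hJ he
  ContDiffOn.sum fun a _ => ContDiffOn.sum fun b _ =>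
    ((hs.contDiff_inv a b).of_le (by norm_num)).mul (hs.contDiff_extr a b)

omit [IsManifold (𝓡 2) ∞ M] in
lemma trc_eq (hz : z ∈ J ×ˢ e.target) : trc (S.jointG e) (S.jointK e) z = τ z.1 :=
  (hS.trk_eq hJ he hz.1 hz.2).symm.trans (hS.cmc e he z.1 hz.1 z.2 hz.2)

omit hJ [IsManifold (𝓡 2) ∞ M] in
lemma pd_trk (hz : z ∈ J ×ˢ e.target) (a : Fin 2) : pd a (S.trk e z.1) z.2 = 0 :=
  (dirD_congr_of_eqOn e.open_target hz.2 fun y hy => hS.cmc e he z.1 hz.1 y hy).trans (dirD_const _)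

lemma dirD_trc (hz : z ∈ J ×ˢ e.target) (a : Fin 2) :
    dirD (vx a) (trc (S.jointG e) (S.jointK e)) z = 0 := by
  have hd := (hS.contDiff_trc hJ he).differentiableAt_of_isOpen (hJ.prod e.open_target)
    (by norm_num) hz
  refine (pd_slice (t := z.1) (y := z.2) hd a).symm.trans ?_
  exact (dirD_congr_of_eqOn e.open_target hz.2 fun y hy =>
    hS.trc_eq hJ he (z := (z.1, y)) ⟨hz.1, hy⟩).trans (dirD_const (τ z.1))

lemma divk_eq (hz : z ∈ J ×ˢ e.target) (a : Fin 2) :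
    S.divk e z.1 z.2 a = dvgT (S.jointG e) (S.jointK e) a z := by
  have hs := hS.isSlicingOn hJ he
  have h : ∀ c a b, pd c (fun y => S.k e z.1 y a b) z.2
      = dirD (vx c) (fun y => S.jointK e y a b) z := by
    intro c a b
    refine Eq.trans ?_ (pd_slice (t := z.1) (y := z.2) (F := fun y => S.jointK e y a b)
      ((hs.contDiff_extr a b).differentiableAt_of_isOpen hs.isOpen (by norm_num) hz) c)
    exact dirD_congr_of_eqOn e.open_target hz.2 fun y hy => by
      simp only [hS.k_eq hJ he hz.1 hy]
  simp only [divk, dvgT, covDerivTensor, covT, h, hS.christoffel_eq hJ he hz.1 hz.2,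
    hS.k_eq hJ he hz.1 hz.2]
  rfl

/-- The energy identity in a chart. -/
lemma energy_in_chart (hz : z ∈ J ×ˢ e.target) :
    dirD vt (inChart e fun t x => S.J0 u t x + S.J1 u t x) z
      + (S.J0 u z.1 (e.symm z.2) + S.J1 u z.1 (e.symm z.2)) * dirD vt (logDensity (S.jointG e)) z
      = 2 * τ z.1 * (S.J0 u z.1 (e.symm z.2) + S.J1 u z.1 (e.symm z.2))
        + τ z.1 * (S.N z.1 (e.symm z.2) * S.J0 u z.1 (e.symm z.2) + (S.N z.1 (e.symm z.2) - 2)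
          * (S.J0 u z.1 (e.symm z.2) + S.J1 u z.1 (e.symm z.2)))
        + S.ZDensity τ u z.1 (e.symm z.2)
        + dvg (S.jointG e) (flux (S.jointG e) (inChart e S.N) (S.jointShift e) (inChart e u)) z := by
  have hs := hS.isSlicingOn hJ he
  have h1 := hs.local_energy (T := fun z => τ z.1) (hS.u_reg e he)
    (fun z hz => hS.dirD_trc hJ he hz) (fun z hz => hS.trc_eq hJ he hz)
    -- The constant mean curvature removes ∂_a τ from the momentum constraint.
    (fun z hz a => by
      have h := hS.momentum e he z.1 hz.1 z.2 hz.2 a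
      rw [hS.pd_trk he hz, add_zero, hS.divk_eq hJ he hz,
        dZero_eq hJ he hz.1 hz.2 hS.u_reg (by norm_num),
        pd_inChart hS.u_reg hJ (by norm_num) he hz.1 hz.2] at h
      exact h)
    (fun z hz => by
      have h := hS.wave z.1 hz.1 (e.symm z.2)
      have hp : S.prime u z.1 (e.symm z.2) = _ := hS.eqOn_prime hJ he hz
      rw [dZero_eq hJ he hz.1 hz.2 (hS.regular_prime hJ) (by norm_num), hS.lap_u_eq hJ he hz,
        hS.gradInner_eq hJ he hz.1 hz.2 hS.N_reg (by norm_num) hS.u_reg (by norm_num), hp,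
        dNorm_congr hs.isOpen hz (hS.eqOn_prime hJ he)] at h
      exact h) hz
  rw [hS.J0_eq hJ he hz, hS.J1_eq hJ he hz, hS.ZDensity_eq hJ he hz,
    dirD_congr_of_eqOn hs.isOpen hz (F := inChart e fun t x => S.J0 u t x + S.J1 u t x)
      fun z hz => congrArg₂ (· + ·) (hS.J0_eq hJ he hz) (hS.J1_eq hJ he hz)]
  exact h1

lemma contDiff_locJ0 : ContDiffOn ℝ 1
    (locJ0 (S.jointG e) (inChart e S.N) (S.jointShift e) (inChart e u)) (J ×ˢ e.target) := by
  have hs := hS.isSlicingOn hJ he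
  have hp : ContDiffOn ℝ 2 (prm (inChart e S.N) (S.jointShift e) (inChart e u)) (J ×ˢ e.target) :=
    hs.contDiff_prm le_rfl ((hS.u_reg e he).of_le (by norm_num))
  exact contDiffOn_const.mul (contDiffOn_const.mul (hs.contDiff_grdInner hp hp))

lemma contDiff_locJ1 : ContDiffOn ℝ 1
    (locJ1 (S.jointG e) (inChart e u)) (J ×ˢ e.target) := by
  have hq := (hS.isSlicingOn hJ he).contDiff_lapl (k := 1) le_rfl
    ((hS.u_reg e he).of_le (by norm_num))
  exact contDiffOn_const.mul ((contDiffOn_const.mul hq).mul hq)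

lemma contDiff_energyDensity : ContDiffOn ℝ 1
    (inChart e fun t x => S.J0 u t x + S.J1 u t x) (J ×ˢ e.target) :=
  ((hS.contDiff_locJ0 hJ he).add (hS.contDiff_locJ1 hJ he)).congr fun _ hz =>
    congrArg₂ (· + ·) (hS.J0_eq hJ he hz) (hS.J1_eq hJ he hz)

lemma contDiff_flux (a : Fin 2) : ContDiffOn ℝ 1
    (flux (S.jointG e) (inChart e S.N) (S.jointShift e) (inChart e u) a) (J ×ˢ e.target) := by
  have hs := hS.isSlicingOn hJ he
  have hp : ContDiffOn ℝ 2 (prm (inChart e S.N) (S.jointShift e) (inChart e u)) (J ×ˢ e.target) :=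
    hs.contDiff_prm le_rfl ((hS.u_reg e he).of_le (by norm_num))
  have hq := hs.contDiff_lapl (k := 1) le_rfl ((hS.u_reg e he).of_le (by norm_num))
  have hN : ContDiffOn ℝ 1 (inChart e S.N) (J ×ˢ e.target) := hs.contDiff_lapse.of_le (by norm_num)
  exact (((hS.contDiff_locJ0 hJ he).add (hS.contDiff_locJ1 hJ he)).mul
    ((hs.contDiff_shift a).of_le (by norm_num))).add
      ((contDiffOn_const.mul (hN.mul hq)).mul
        (hs.contDiff_grd (k := 1) (by norm_num) (hp.of_le (by norm_num)) a))

lemma continuousOn_locZ (ht : t ∈ J) : ContinuousOn (fun y => locZ (S.jointG e) (inChart e S.N)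
    (S.jointShift e) (fun z => τ z.1) (inChart e u) (t, y)) e.target := by
  have hs := hS.isSlicingOn hJ he
  have hp : ContDiffOn ℝ 2 (prm (inChart e S.N) (S.jointShift e) (inChart e u)) (J ×ˢ e.target) :=
    hs.contDiff_prm le_rfl ((hS.u_reg e he).of_le (by norm_num))
  have hN : ContDiffOn ℝ 2 (inChart e S.N) (J ×ˢ e.target) := hs.contDiff_lapse
  have hu : ContDiffOn ℝ 2 (inChart e u) (J ×ˢ e.target) := (hS.u_reg e he).of_le (by norm_num)
  have hd : ∀ {f : ℝ × Plane → ℝ}, ContDiffOn ℝ 1 f (J ×ˢ e.target) → ∀ v,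
      ContinuousOn (dirD v f) (J ×ˢ e.target) := fun hf v =>
    (contDiffOn_dirD (n := 0) hf hs.isOpen (by norm_num) v).continuousOn
  have h1 : ∀ {f : ℝ × Plane → ℝ}, ContDiffOn ℝ 2 f (J ×ˢ e.target) →
      ContDiffOn ℝ 1 f (J ×ˢ e.target) := fun hf => hf.of_le (by norm_num)
  have hi : ∀ a b, ContinuousOn (fun z => (S.jointG e z)⁻¹ a b) (J ×ˢ e.target) :=
    fun a b => (hs.contDiff_inv a b).continuousOn
  have htl : ∀ a b, ContinuousOn (fun z => traceless (S.jointG e) (S.jointK e) z a b)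
      (J ×ˢ e.target) := fun a b =>
    (hs.contDiff_extr a b).continuousOn.sub ((continuousOn_const.mul
      (hs.contDiff a b).continuousOn).mul (hS.contDiff_trc hJ he).continuousOn)
  have hr : ∀ a b, ContinuousOn (raise (S.jointG e) (traceless (S.jointG e) (S.jointK e)) a b)
      (J ×ˢ e.target) := fun a b =>
    continuousOn_finsetSum _ fun c _ => continuousOn_finsetSum _ fun d _ =>
      ((hi a c).mul (hi b d)).mul (htl c d)
  have hg : ∀ {f₁ f₂ : ℝ × Plane → ℝ}, ContDiffOn ℝ 1 f₁ (J ×ˢ e.target) →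
      ContDiffOn ℝ 1 f₂ (J ×ˢ e.target) →
      ContinuousOn (grdInner (S.jointG e) f₁ f₂) (J ×ˢ e.target) := fun h h' =>
    continuousOn_finsetSum _ fun a _ => continuousOn_finsetSum _ fun b _ =>
      ((hi a b).mul (hd h _)).mul (hd h' _)
  have htg : ∀ {f₁ f₂ : ℝ × Plane → ℝ}, ContDiffOn ℝ 1 f₁ (J ×ˢ e.target) →
      ContDiffOn ℝ 1 f₂ (J ×ˢ e.target) → ContinuousOn (tenGrad (S.jointG e)
        (traceless (S.jointG e) (S.jointK e)) f₁ f₂) (J ×ˢ e.target) := fun h h' =>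
    continuousOn_finsetSum _ fun a _ => continuousOn_finsetSum _ fun b _ =>
      ((hr a b).mul (hd h _)).mul (hd h' _)
  have hth : ContinuousOn (tenHess (S.jointG e)
      (traceless (S.jointG e) (S.jointK e)) (inChart e u)) (J ×ˢ e.target) :=
    continuousOn_finsetSum _ fun a _ => continuousOn_finsetSum _ fun b _ =>
      (hr a b).mul (hs.contDiff_cov (k := 0) (by norm_num)
        (fun c => contDiffOn_dirD hu hs.isOpen (by norm_num) _) a b).continuousOn
  have hl : ∀ {f : ℝ × Plane → ℝ}, ContDiffOn ℝ 2 f (J ×ˢ e.target) →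
      ContinuousOn (lapl (S.jointG e) f) (J ×ˢ e.target) := fun hf =>
    (hs.contDiff_lapl (k := 0) (by norm_num) (hf.of_le (by norm_num))).continuousOn
  have hdot : ∀ {f₁ f₂ : ℝ × Plane → ℝ}, ContinuousOn f₁ (J ×ˢ e.target) →
      ContinuousOn f₂ (J ×ˢ e.target) → ContinuousOn (fun z => dot (f₁ z) (f₂ z))
        (J ×ˢ e.target) := fun h h' => (continuousOn_const.mul h).mul h'
  have hslice : ∀ {H : ℝ × Plane → ℝ}, ContinuousOn H (J ×ˢ e.target) →
      ContinuousOn (fun y => H (t, y)) e.target := fun hH =>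
    hH.comp (by fun_prop) fun y hy => ⟨ht, hy⟩
  have hNc := hN.continuousOn
  have hpc := hp.continuousOn
  have c1 := hslice ((hNc.mul (hdot (continuousOn_const (c := (1 : ℝ))) (htg (h1 hp) (h1 hp)))).add
    ((continuousOn_const (c := (2 : ℝ)).mul hNc).mul (hdot hth (hl hu))))
  have c2 := hslice (hdot (continuousOn_const (c := (1 : ℝ))) (hg (hs.contDiff_grdInner hN hu) (h1 hp)))
  have c3 := hslice (hdot hpc (hg (h1 hN) (h1 hp)))
  have c4 := hslice (hdot ((((continuousOn_const (c := (2 : ℝ)).mul (htg (h1 hN) (h1 hu))).sub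
    ((continuousOn_const (c := (2 : ℝ)).mul hNc).mul (hdot (hg (h1 hu) (h1 hu)) hpc))).add
    (continuousOn_const (c := (2 : ℝ)).mul (hg (h1 hN) (h1 hp)))).add (hpc.mul (hl hN))) (hl hu))
  -- At fixed time τ t is a constant, so continuity of τ is not needed.
  exact ((c1.add c2).add (continuousOn_const (c := τ t).mul c3)).add c4

end InChart

section Continuity

variable (ht : t ∈ J)
include ht

lemma continuous_J0 : Continuous (S.J0 u t) :=
  continuous_of_charts fun e he => ((hS.contDiff_locJ0 hJ he).continuousOn.comp
    (f := fun y => (t, y)) (by fun_prop) fun _ hy => ⟨ht, hy⟩).congr fun y hy =>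
      hS.J0_eq hJ he (z := (t, y)) ⟨ht, hy⟩

lemma continuous_J1 : Continuous (S.J1 u t) :=
  continuous_of_charts fun e he => ((hS.contDiff_locJ1 hJ he).continuousOn.comp
    (f := fun y => (t, y)) (by fun_prop) fun _ hy => ⟨ht, hy⟩).congr fun y hy =>
      hS.J1_eq hJ he (z := (t, y)) ⟨ht, hy⟩

omit [IsManifold (𝓡 2) ∞ M] hJ in
lemma continuous_N : Continuous (S.N t) :=
  continuous_of_charts fun _ he => (hS.N_reg _ he).continuousOn.comp
    (f := fun y => (t, y)) (by fun_prop) fun _ hy => ⟨ht, hy⟩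

lemma continuous_ZDensity : Continuous (S.ZDensity τ u t) :=
  continuous_of_charts fun _ he => (hS.continuousOn_locZ hJ he ht).congr fun y hy =>
    hS.ZDensity_eq hJ he (z := (t, y)) ⟨ht, hy⟩

end Continuity

end Slicing.IsSolution

end EnergyIdentity

/-! ### Differentiation of the energy under the integral. -/

section EnergyDerivative

variable {M : Type*} [TopologicalSpace M] [ChartedSpace Plane M] [IsManifold (𝓡 2) ∞ M]
  [T2Space M] [CompactSpace M]
  {S : Slicing M} {J : Set ℝ} {τ : ℝ → ℝ} {u : ℝ → M → ℝ} {t : ℝ}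

/-- The components of the flux at a fixed time. -/
def Slicing.fluxAt (S : Slicing M) (u : ℝ → M → ℝ) (t : ℝ) (p : M) (a : Fin 2) (y : Plane) : ℝ :=
  flux (S.jointG (chartAt Plane p)) (inChart (chartAt Plane p) S.N)
    (S.jointShift (chartAt Plane p)) (inChart (chartAt Plane p) u) a (t, y)

/-- The derivative of the `q`-th partition function along the flux. -/
def Slicing.fluxDeriv (S : Slicing M) (u : ℝ → M → ℝ) (t : ℝ) (q x : M) : ℝ :=
  let shiftDeriv : ℝ := mfderiv (𝓡 2) 𝓘(ℝ, ℝ) (chartPartition M q) x (S.ν t x)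
  (S.J0 u t x + S.J1 u t x) * shiftDeriv
    + 2 * (S.N t x * S.lap t (u t) x) * S.gradInner t (S.prime u t) (chartPartition M q) x

/-- The integrand of the time derivative of the energy. -/
def Slicing.energyRate (S : Slicing M) (τ : ℝ → ℝ) (u : ℝ → M → ℝ) (t : ℝ) (x : M) : ℝ :=
  2 * τ t * (S.J0 u t x + S.J1 u t x)
    + τ t * (S.N t x * S.J0 u t x + (S.N t x - 2) * (S.J0 u t x + S.J1 u t x))
    + S.ZDensity τ u t x

lemma regularOn_chartPartition (J : Set ℝ) (q : M) :
    RegularOn ∞ J fun _ : ℝ => (chartPartition M q : M → ℝ) := fun _ he =>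
  (contDiffOn_chartPartition he q).comp contDiff_snd.contDiffOn fun _ hz => hz.2

namespace Slicing.IsSolution

variable (hS : S.IsSolution J τ u) (hJ : IsOpen J)
include hS hJ

omit [T2Space M] [CompactSpace M] in
lemma exp_logDensity_eq {e : OpenPartialHomeomorph M Plane} (he : e ∈ atlas Plane M)
    {z : ℝ × Plane} (hz : z ∈ J ×ˢ e.target) :
    S.density e z.1 z.2 = Real.exp (logDensity (S.jointG e) z) :=
  (exp_logDensity ((hS.isSlicingOn hJ he).det_pos z hz)).symm

omit [T2Space M] [CompactSpace M] in
lemma contDiffOn_density {e : OpenPartialHomeomorph M Plane} (he : e ∈ atlas Plane M)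
    (ht : t ∈ J) : ContDiffOn ℝ 1 (S.density e t) e.target :=
  (((hS.isSlicingOn hJ he).contDiff_logDensity.exp.of_le (by norm_num)).comp
    (f := fun y => (t, y)) (by fun_prop) fun _ hy => ⟨ht, hy⟩).congr fun y hy =>
      hS.exp_logDensity_eq hJ he (z := (t, y)) ⟨ht, hy⟩

omit [T2Space M] [CompactSpace M] in
lemma contDiffOn_fluxAt (ht : t ∈ J) (p : M) (a : Fin 2) :
    ContDiffOn ℝ 1 (S.fluxAt u t p a) (chartAt Plane p).target :=
  (hS.contDiff_flux hJ (chart_mem_atlas Plane p) a).comp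
    (f := fun y => (t, y)) (by fun_prop) fun _ hy => ⟨ht, hy⟩

/-- This supplies `hD` for `sum_integral_divergence`: the flux applied to a partition function is
built from the shift derivative and a gradient product, so it has a meaning independent of the
chart. -/
lemma fluxDeriv_eq (ht : t ∈ J) (p q : M) {y : Plane} (hy : y ∈ (chartAt Plane p).target) :
    S.fluxDeriv u t q ((chartAt Plane p).symm y) = ∑ a, S.fluxAt u t p a y
      * pd a (chartPartition M q ∘ (chartAt Plane p).symm) y := by
  set e := chartAt Plane p with he0
  have he : e ∈ atlas Plane M := chart_mem_atlas Plane p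
  have hz : (t, y) ∈ J ×ˢ e.target := ⟨ht, hy⟩
  have hρ := regularOn_chartPartition J q
  have hs := hS.isSlicingOn hJ he
  have h1 := shift_mfderiv (S := S) hJ he ht hy hρ (by norm_num)
  have h2 := hS.gradInner_eq hJ he ht hy (hS.regular_prime hJ) (by norm_num) hρ (by norm_num)
  have h3 := fun a => pd_inChart hρ hJ (by norm_num) he ht hy a
  have h4 : grdInner (S.jointG e) (inChart e (S.prime u))
      (inChart e fun _ => (chartPartition M q : M → ℝ)) (t, y)
      = ∑ a, grd (S.jointG e) (prm (inChart e S.N) (S.jointShift e) (inChart e u)) a (t, y)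
        * pd a (chartPartition M q ∘ e.symm) y := by
    simp only [h3]
    rw [hs.sum_grd_mul hz]
    simp only [grdInner, hS.dirD_prime hJ he hz]
  have h5 := hS.J0_eq hJ he hz
  have h6 := hS.J1_eq hJ he hz
  have h7 := hS.lap_u_eq hJ he hz
  simp only at h5 h6 h7
  simp only [fluxDeriv, h1, h2, h4, h5, h6, h7, fluxAt, flux, ← he0, Fin.sum_univ_two]
  simp only [inChart, jointShift]
  ring

/-- The derivative of the energy density in a chart. -/
lemma dirD_weighted_energy (ht : t ∈ J) (p : M) {y : Plane} (hy : y ∈ (chartAt Plane p).target) :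
    dirD vt (fun z => Real.exp (logDensity (S.jointG (chartAt Plane p)) z)
      * (inChart (chartAt Plane p) (fun _ => (chartPartition M p : M → ℝ)) z
        * inChart (chartAt Plane p) (fun t x => S.J0 u t x + S.J1 u t x) z)) (t, y)
      = S.density (chartAt Plane p) t y * (chartPartition M p ((chartAt Plane p).symm y)
        * S.energyRate τ u t ((chartAt Plane p).symm y))
        + chartPartition M p ((chartAt Plane p).symm y)
          * ∑ a, pd a (fun z => S.density (chartAt Plane p) t z * S.fluxAt u t p a z) y := by
  set e := chartAt Plane p with he0
  have he : e ∈ atlas Plane M := chart_mem_atlas Plane p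
  have hz : (t, y) ∈ J ×ˢ e.target := ⟨ht, hy⟩
  have hs := hS.isSlicingOn hJ he
  have hρ := regularOn_chartPartition J p
  have hρd := hρ.comp_differentiableAt hJ (by norm_num) he ht hy
  have hFd := (hS.contDiff_energyDensity hJ he).differentiableAt_of_isOpen hs.isOpen (by norm_num) hz
  have hLd : DifferentiableAt ℝ (logDensity (S.jointG e)) (t, y) :=
    hs.contDiff_logDensity.differentiableAt_of_isOpen hs.isOpen (by norm_num) hz
  have hXd := fun a =>
    (hS.contDiff_flux hJ he a).differentiableAt_of_isOpen hs.isOpen (by norm_num) hz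
  have hρ0 : dirD vt (inChart e (fun _ => (chartPartition M p : M → ℝ))) (t, y) = 0 :=
    (hasDerivAt_slice hρd).unique (hasDerivAt_const t (chartPartition M p (e.symm y)))
  have h1 := hS.energy_in_chart hJ he hz
  have h2 := hs.exp_mul_dvg hXd hz
  have h3 : ∀ a, dirD (vx a) (fun z => Real.exp (logDensity (S.jointG e) z)
      * flux (S.jointG e) (inChart e S.N) (S.jointShift e) (inChart e u) a z) (t, y)
      = pd a (fun z => S.density e t z * S.fluxAt u t p a z) y := fun a => by
    refine (pd_slice (hLd.exp.fun_mul (hXd a)) a).symm.trans ?_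
    refine dirD_congr_of_eqOn e.open_target hy fun w hw => ?_
    simp only [hS.exp_logDensity_eq hJ he (z := (t, w)) ⟨ht, hw⟩, fluxAt, ← he0]
  have h4 : dirD vt (fun z => Real.exp (logDensity (S.jointG e) z)) (t, y) = _ :=
    dirD_comp (Real.hasDerivAt_exp _) hLd
  have h5 := hS.exp_logDensity_eq hJ he hz
  simp only at h1 h5
  simp only [h3] at h2
  rw [dirD_mul hLd.exp (hρd.fun_mul hFd), dirD_mul hρd hFd, hρ0, h4, h5, ← h2]
  simp only [energyRate, inChart] at h1 ⊢
  -- The partition function does not depend on time, so the claim is the energy identity in the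
  -- chart multiplied by √(det g) ρ_p.
  linear_combination Real.exp (logDensity (S.jointG e) (t, y))
    * chartPartition M p (e.symm y) * h1

omit [T2Space M] [CompactSpace M] in
lemma continuous_energyRate (ht : t ∈ J) : Continuous (S.energyRate τ u t) := by
  have h0 := hS.continuous_J0 hJ ht
  have h1 := hS.continuous_J1 hJ ht
  have hN := hS.continuous_N ht
  exact ((continuous_const.mul (h0.add h1)).add (continuous_const.mul ((hN.mul h0).add
    ((hN.sub continuous_const).mul (h0.add h1))))).add (hS.continuous_ZDensity hJ ht)

variable [MeasurableSpace M] [BorelSpace M]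

/-- The time derivative of the energy. -/
theorem hasDerivAt_energyOne (ht : t ∈ J) :
    HasDerivAt (S.energyOne u) (∫ x, S.energyRate τ u t x ∂(S.area t)) t := by
  set c : M → OpenPartialHomeomorph M Plane := fun p => chartAt Plane p
  set Ψ : M → ℝ × Plane → ℝ := fun p z => Real.exp (logDensity (S.jointG (c p)) z)
    * (inChart (c p) (fun _ => (chartPartition M p : M → ℝ)) z
      * inChart (c p) (fun t x => S.J0 u t x + S.J1 u t x) z) with hΨ
  have hca : ∀ p, c p ∈ atlas Plane M := fun p => chart_mem_atlas Plane p
  have hop : ∀ p, IsOpen (c p).target := fun p => (c p).open_target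
  have hE : ∀ s ∈ J, S.energyOne u s
      = ∑ p ∈ activeCharts M, ∫ y in (c p).target, Ψ p (s, y) := by
    intro s hs
    refine (hS.integral_eq_sum hs (F := fun x => S.J0 u s x + S.J1 u s x)
      ((hS.continuous_J0 hJ hs).add (hS.continuous_J1 hJ hs))).trans ?_
    refine Finset.sum_congr rfl fun p _ => setIntegral_congr_fun (hop p).measurableSet fun y hy => ?_
    simp only [hΨ, ← hS.exp_logDensity_eq hJ (hca p) (z := (s, y)) ⟨hs, hy⟩]
    rfl
  have hΨC : ∀ p, ContDiffOn ℝ 1 (Ψ p) (J ×ˢ (c p).target) := fun p =>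
    ((hS.isSlicingOn hJ (hca p)).contDiff_logDensity.exp.of_le (by norm_num)).mul
      (((regularOn_chartPartition J p (c p) (hca p)).of_le ENat.LEInfty.out).mul
        (hS.contDiff_energyDensity hJ (hca p)))
  have hΨ0 : ∀ p, ∀ s ∈ J, ∀ y ∈ (c p).target \ partitionCarrier p, Ψ p (s, y) = 0 := by
    intro p s _ y hy
    have h : inChart (c p) (fun _ => (chartPartition M p : M → ℝ)) (s, y) = 0 :=
      chartPartition_symm_eq_zero hy
    simp only [hΨ, h, zero_mul, mul_zero]
  have hder : HasDerivAt (fun s => ∑ p ∈ activeCharts M, ∫ y in (c p).target, Ψ p (s, y))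
      (∑ p ∈ activeCharts M, ∫ y in (c p).target, dirD vt (Ψ p) (t, y)) t :=
    HasDerivAt.fun_sum fun p _ => hasDerivAt_setIntegral hJ ht (hop p)
      (isCompact_partitionCarrier p) (partitionCarrier_subset p) (hΨC p) (hΨ0 p)
  have hint1 : ∀ p, IntegrableOn (fun y => S.density (c p) t y
      * (chartPartition M p ((c p).symm y) * S.energyRate τ u t ((c p).symm y))) (c p).target := by
    intro p
    refine integrableOn_of_eq_zero_off_compact (hop p) (isCompact_partitionCarrier p)
      (partitionCarrier_subset p) ?_ fun y hy => ?_
    · exact (hS.continuousOn_density (hca p) ht).mul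
        ((contDiffOn_chartPartition (hca p) p).continuousOn.mul
          ((hS.continuous_energyRate hJ ht).comp_continuousOn (c p).continuousOn_symm))
    · rw [chartPartition_symm_eq_zero hy, zero_mul, mul_zero]
  have hint2 : ∀ p, IntegrableOn (fun y => chartPartition M p ((c p).symm y)
      * ∑ a, pd a (fun z => S.density (c p) t z * S.fluxAt u t p a z) y) (c p).target := by
    intro p
    refine integrableOn_of_eq_zero_off_compact (hop p) (isCompact_partitionCarrier p)
      (partitionCarrier_subset p) ?_ fun y hy => ?_
    · exact (contDiffOn_chartPartition (hca p) p).continuousOn.mul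
        (continuousOn_finsetSum _ fun a _ => (contDiffOn_dirD (n := 0)
          ((hS.contDiffOn_density hJ (hca p) ht).mul (hS.contDiffOn_fluxAt hJ ht p a))
            (hop p) (by norm_num) _).continuousOn)
    · rw [chartPartition_symm_eq_zero hy, zero_mul]
  have hsum : ∑ p ∈ activeCharts M, ∫ y in (c p).target, dirD vt (Ψ p) (t, y)
      = ∫ x, S.energyRate τ u t x ∂(S.area t) := by
    -- The flux contributions of the individual charts need not vanish; only their sum does.
    have hdiv := hS.sum_integral_divergence ht (X := S.fluxAt u t) (D := S.fluxDeriv u t)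
      (hS.contDiffOn_fluxAt hJ ht) (fun p => hS.contDiffOn_density hJ (hca p) ht)
      fun p q y hy => hS.fluxDeriv_eq hJ ht p q hy
    rw [hS.integral_eq_sum ht (hS.continuous_energyRate hJ ht)]
    refine Eq.trans ?_ ((congrArg _ hdiv).trans (add_zero _))
    rw [← Finset.sum_add_distrib]
    refine Finset.sum_congr rfl fun p _ => ?_
    refine Eq.trans ?_ (integral_add (hint1 p) (hint2 p))
    exact setIntegral_congr_fun (hop p).measurableSet fun y hy =>
      hS.dirD_weighted_energy hJ ht p hy
  rw [hsum] at hder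
  exact hder.congr_of_eventuallyEq (Filter.eventuallyEq_of_mem (hJ.mem_nhds ht) hE)

end Slicing.IsSolution

end EnergyDerivative

end PolarizedU1

end

open PolarizedU1 in
theorem mainTheorem7 {M : Type*} [TopologicalSpace M] [ChartedSpace Plane M]
    [IsManifold (𝓡 2) ∞ M] [T2Space M] [CompactSpace M] [MeasurableSpace M] [BorelSpace M]
    (S : Slicing M) (J : Set ℝ) (hJ : IsOpen J) (τ : ℝ → ℝ) (u : ℝ → M → ℝ)
    (hS : S.IsSolution J τ u) (t : ℝ) (ht : t ∈ J) :
    Integrable (fun x => S.J0 u t x + S.J1 u t x) (S.area t) ∧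
    Integrable (fun x => S.N t x * S.J0 u t x + (S.N t x - 2) * (S.J0 u t x + S.J1 u t x))
      (S.area t) ∧
    Integrable (S.ZDensity τ u t) (S.area t) ∧
    DifferentiableAt ℝ (S.energyOne u) t ∧
    deriv (S.energyOne u) t - 2 * τ t * S.energyOne u t
      = τ t * (∫ x, (S.N t x * S.J0 u t x + (S.N t x - 2) * (S.J0 u t x + S.J1 u t x))
          ∂(S.area t))
        + ∫ x, S.ZDensity τ u t x ∂(S.area t) := by
  have h0 := hS.continuous_J0 hJ ht
  have h1 := hS.continuous_J1 hJ ht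
  have hN := hS.continuous_N ht
  have hE : Integrable (fun x => S.J0 u t x + S.J1 u t x) (S.area t) :=
    hS.integrable_of_continuous ht (h0.add h1)
  have hR : Integrable (fun x => S.N t x * S.J0 u t x
      + (S.N t x - 2) * (S.J0 u t x + S.J1 u t x)) (S.area t) :=
    hS.integrable_of_continuous ht ((hN.mul h0).add ((hN.sub continuous_const).mul (h0.add h1)))
  have hZ := hS.integrable_of_continuous ht (hS.continuous_ZDensity hJ ht)
  have hd := hS.hasDerivAt_energyOne hJ ht
  refine ⟨hE, hR, hZ, hd.differentiableAt, ?_⟩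
  -- The derivative of the energy is the integral of `energyRate`, which splits because each part is
  -- continuous and hence integrable.
  have h2 : ∫ x, S.energyRate τ u t x ∂(S.area t) = 2 * τ t * S.energyOne u t
      + τ t * (∫ x, (S.N t x * S.J0 u t x + (S.N t x - 2) * (S.J0 u t x + S.J1 u t x))
          ∂(S.area t)) + ∫ x, S.ZDensity τ u t x ∂(S.area t) := by
    have hA : Integrable (fun x => 2 * τ t * (S.J0 u t x + S.J1 u t x)
        + τ t * (S.N t x * S.J0 u t x + (S.N t x - 2) * (S.J0 u t x + S.J1 u t x))) (S.area t) :=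
      (hE.const_mul _).add (hR.const_mul _)
    refine (integral_add hA hZ).trans ?_
    rw [integral_add (hE.const_mul _) (hR.const_mul _), integral_const_mul, integral_const_mul]
    rfl
  rw [hd.deriv, h2]
  ring
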